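/- **Theorem.** *Setting.* Let $\{\phi_a\}_{a\in\mathcal A}\subset\mathbb R^d$, $d\ge 1$, $|\mathcal A|=K$, be arm features that affinely span $\mathbb R^d$. In each round $t=1,\dots,T$ ($T\ge 1$) a non-oblivious environment (which may use the past and internal randomization) chooses distributions $\nu_{t,a}$ of the losses $\ell_{t,a}$ with means $\langle\phi_a,\theta_t\rangle$ for some $\theta_t\in\mathbb R^d$ and with $\mathbb E|\ell_{t,a}|^{\varepsilon}\le\sigma$, where $\varepsilon\in(1,2]$ and $\sigma>0$ are known. The learner draws $a_t$ from a distribution $p_t$, independently of $\ell_t$ given the past, and observes $\ell_{t,a_t}$. The pseudo-regret is $\mathrm{Reg}_T=\max_a\mathbb E[\sum_{t\le T}(\ell_{t,a_t}-\ell_{t,a})]$. *Algorithm.* Fix $\alpha\in[1/2,1)$, $\bar\alpha=(\varepsilon-1)(1-\alpha)$, $\beta_1>0$ so large that $256(1-\alpha)^{-2}\sigma^{2/\varepsilon}d\,\beta_1^{-2}\le 1/2$, and $\bar\beta\ge 64(1-\alpha)^{-3}d^{\varepsilon}\beta_1^{1-\varepsilon}\max\{\sigma^{3/\varepsilon},\sigma\}$.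 For a distribution $p$ on $\mathcal A$ put $\mu(p)=\mathbb E_{a\sim p}\phi_a$ and $V(p)=\mathbb E_{a\sim p}[(\phi_a-\mu(p))(\phi_a-\mu(p))^\top]$, and let $p_0$ maximize $\log\det V(p)$ over all distributions $p$ on $\mathcal A$. With $\psi(q)=-\frac1\alpha\sum_a(q_a^\alpha-q_a)$ and $\bar\psi(q)=-\frac1{\bar\alpha}\sum_a(q_a^{\bar\alpha}-q_a)$, round $t$ is as follows. The distribution $q_t$ minimizes $\langle\sum_{s<t}(\hat\ell_s-b_s),q\rangle+\beta_t\psi(q)+\bar\beta\bar\psi(q)$ over distributions $q$ on $\mathcal A$; with $q_{t*}=\min\{\|q_t\|_\infty,1-\|q_t\|_\infty\}$, $$\gamma_t=256(1-\alpha)^{-2}\sigma^{2/\varepsilon}d\,\beta_t^{-2}q_{t*}^{2(1-\alpha)},\qquad s_{t,a}=(1-\alpha)\beta_tq_{t*}^{\alpha-1}/8,\qquad p_t=(1-\gamma_t)q_t+\gamma_tp_0 .$$ After drawing $a_t\sim p_t$, with $\bar\phi_a=\phi_a-\mu(p_t)$ and $V_t=V(p_t)$, $$\tilde\ell_{t,a}=\bar\phi_a^\top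 V_t^{-1}\bar\phi_{a_t}\ell_{t,a_t},\qquad \hat\ell_{t,a}=\tilde\ell_{t,a}\mathbf 1\{|\tilde\ell_{t,a}|\le s_{t,a}\},\qquad b_{t,a}=\sigma\sum_bp_{t,b}|\bar\phi_a^\top V_t^{-1}\bar\phi_b|^{\varepsilon}s_{t,a}^{1-\varepsilon},$$ $h_t=-\psi(q_t)$, $z_t=(1-\alpha)^{1-\varepsilon}\sigma q_{t*}^{(\varepsilon-1)(1-\alpha)}d^{\varepsilon/2}(1-\|p_t\|_\infty)^{2-\varepsilon}$, $w_t=\sigma^{3/\varepsilon}(1-\alpha)^{-2}d\,q_{t*}^{2(1-\alpha)}$, and $$\beta_{t+1}=\beta_t+\tfrac1{h_t}\big(\beta_t^{1-\varepsilon}z_t+\beta_t^{-2}w_t\big),\qquad \beta_0:=0 .$$ Let $\bar h=-\bar\psi(q_1)$, let $z_{\max},w_{\max}$ be the largest values of $z_t,w_t$ over all $t\le T$ and all histories, and let $\kappa=z_{\max}\beta_1^{1-\varepsilon}+w_{\max}\beta_1^{-2}+\beta_1h_1+\bar\beta\bar h$. *Conclusion.* The algorithm is well defined and $z_t,w_t>0$.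 There are an absolute constant $c_0$ and, for every $\sigma_0>0$, a constant $c_1$ depending only on $\varepsilon$ and $\sigma_0$ (all of them positive), such that the following holds. 1. $h_{t+1}\le c_0h_t$ for all $t$ and all histories; $h_1\le\frac1\alpha K^{1-\alpha}$ and $\bar h\le\frac1{\bar\alpha}K^{1-\bar\alpha}$; and $$\mathrm{Reg}_T\le c_0\Big(\mathbb E\Big[\sum_{t=1}^T\big((\beta_t-\beta_{t-1})h_t+\beta_t^{1-\varepsilon}z_t+\beta_t^{-2}w_t\big)\Big]+\bar\beta\bar h\Big).$$ 2. $h_1^{1-1/\varepsilon}z_{\max}^{1/\varepsilon}\le(\alpha(1-\alpha))^{1/\varepsilon-1}\sigma^{1/\varepsilon}d^{1/2}K^{(1-\alpha)(1-1/\varepsilon)}$ and $h_1^{2/3}w_{\max}^{1/3}\le(\alpha(1-\alpha))^{-2/3}\sigma^{1/\varepsilon}d^{1/3}K^{2(1-\alpha)/3}$. 3. In the adversarial regime, $\mathrm{Reg}_T\le c_0\big(h_1^{1-1/\varepsilon}(z_{\max}T)^{1/\varepsilon}+h_1^{2/3}(w_{\max}T)^{1/3}+\kappa\big)$. 4. Let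 $\Delta\in\mathbb R_{\ge0}^{\mathcal A}$ with $\Delta_a>0$ for all $a\ne a^*$, $\Delta_{\min}=\min_{a\ne a^*}\Delta_a$, and $$\zeta(\Delta)=2^{\varepsilon-1}((1-\alpha)\alpha)^{1-\varepsilon}\sigma\Big(\sum_{a\ne a^*}\Delta_a^{\frac{\alpha}{\alpha-1}}\Big)^{(1-\alpha)(\varepsilon-1)}\Delta_{\min}^{\alpha(\varepsilon-1)-1}d^{\varepsilon/2},\qquad \omega(\Delta)=(\alpha(1-\alpha))^{-2}\sigma^{3/\varepsilon}\Big(\sum_{a\ne a^*}\Delta_a^{\frac{\alpha}{\alpha-1}}\Big)^{2(1-\alpha)}d .$$ Then $\zeta(\Delta),\omega(\Delta)>0$ and $h_t^{\varepsilon-1}z_t\le\zeta(\Delta)\langle\Delta,p_t\rangle$; if moreover $\max_a\Delta_a\le1$, then $h_t^2w_t\le2\,\omega(\Delta)\langle\Delta,p_t\rangle$, for all $t$ and all histories. 5. Let $\Delta$ be as in 4 with $\max_a\Delta_a\le1$, let $C\ge0$ and $\sigma\ge\sigma_0$, and suppose that the environment satisfies $\mathrm{Reg}_T\ge\mathbb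 E[\sum_{t\le T}\Delta_{a_t}]-C$ for every algorithm (the $(\Delta,C,T)$ self-bounding constraint). Then $\mathrm{Reg}_T\le c_1\big(\iota+\iota'+C^{1/\varepsilon}(\iota+\iota')^{1-1/\varepsilon}+\kappa\big)$, where, with $\log_+x=\max\{1,\log x\}$, $$\iota=\frac{\zeta(\Delta)^{\frac1{\varepsilon-1}}}{\varepsilon-1}\Big(\frac\varepsilon2\Big)^{\frac1{1-\varepsilon}}\log_+\!\Big(\frac{z_{\max}h_1^{\varepsilon-1}T}{\zeta(\Delta)^{\varepsilon/(\varepsilon-1)}+C}\Big),\qquad \iota'=\omega(\Delta)^{\frac12}\Big(\frac32\Big)^{-\frac12}\log_+\!\Big(\frac{w_{\max}h_1^2T}{\omega(\Delta)^{3/2}+C}\Big).$$ -/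

import Mathlib

open MeasureTheory ProbabilityTheory
open scoped Matrix

universe u

noncomputable section

namespace HTLinearBandit

/-! ### The interaction protocol -/

/-- What the learner sees of one round: the played arm and its incurred loss. -/
abbrev Obs (K : ℕ) : Type := Fin K × ℝ

/-- Full outcome of one round: the played arm and the whole loss vector. -/
abbrev Outcome (K : ℕ) : Type := Fin K × (Fin K → ℝ)

/-- The learner's view of a sequence of outcomes. -/
def observe {K t : ℕ} (h : Fin t → Outcome K) : Fin t → Obs K :=
  fun i => ((h i).1, (h i).2 (h i).1)

theorem measurable_observe {K t : ℕ} :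
    Measurable (observe : (Fin t → Outcome K) → Fin t → Obs K) := by
  have key : Measurable (fun o : Outcome K => ((o.1, o.2 o.1) : Obs K)) := by
    refine measurable_fst.prodMk ?_
    exact measurable_from_prod_countable_right (fun a => measurable_pi_apply a)
  exact measurable_pi_lambda _ (fun i => key.comp (measurable_pi_apply i))

/-- A (randomized) bandit algorithm: in the round that follows `t` completed rounds it draws an arm
from a distribution that depends on the `t` past observations. -/
structure Algorithm (K : ℕ) where
  policy : (t : ℕ) → Kernel (Fin t → Obs K) (Fin K)
  markov : ∀ t, IsMarkovKernel (policy t)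

/-- A non-oblivious environment with internal randomization `Seed`: in every round it chooses a
joint distribution of the losses of all arms, depending on its seed and on the past. -/
structure Environment (K : ℕ) where
  Seed : Type u
  mSeed : MeasurableSpace Seed
  prior : Measure Seed
  prior_prob : IsProbabilityMeasure prior
  loss : (t : ℕ) → Kernel (Seed × (Fin t → Outcome K)) (Fin K → ℝ)
  markov : ∀ t, IsMarkovKernel (loss t)

attribute [instance] Algorithm.markov Environment.mSeed Environment.prior_prob Environment.markov

namespace Environment

variable {K d : ℕ}

/-- The mean losses are linear in the arm features. -/
def IsLinear (env : Environment.{u} K) (φ : Fin K → Fin d → ℝ) : Prop :=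
  ∀ t x, ∃ θ : Fin d → ℝ, ∀ a, Integrable (fun l => l a) (env.loss t x) ∧
    ∫ l, l a ∂(env.loss t x) = φ a ⬝ᵥ θ

/-- The `ε`-th raw moment of every loss distribution is at most `σ`. -/
def IsHeavyTailed (env : Environment.{u} K) (ε σ : ℝ) : Prop :=
  ∀ t x a, Integrable (fun l => |l a| ^ ε) (env.loss t x) ∧
    ∫ l, |l a| ^ ε ∂(env.loss t x) ≤ σ

/-- One round: the arm and the loss vector are drawn independently, given the past. -/
def step (env : Environment.{u} K) (alg : Algorithm K) (t : ℕ) :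
    Kernel (env.Seed × (Fin t → Outcome K)) (Outcome K) :=
  ((alg.policy t).comap (fun x => observe x.2) (measurable_observe.comp measurable_snd)) ×ₖ
    (env.loss t)

instance (env : Environment.{u} K) (alg : Algorithm K) (t : ℕ) :
    IsMarkovKernel (env.step alg t) := by
  unfold step; infer_instance

/-- Append the outcome of a new round. -/
def append {S : Type u} {t : ℕ} (x : (S × (Fin t → Outcome K)) × Outcome K) :
    S × (Fin (t + 1) → Outcome K) :=
  (x.1.1, Fin.snoc (α := fun _ => Outcome K) x.1.2 x.2)

theorem measurable_append {S : Type u} [MeasurableSpace S] {t : ℕ} :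
    Measurable (append : (S × (Fin t → Outcome K)) × Outcome K → S × (Fin (t + 1) → Outcome K)) := by
  refine (measurable_fst.comp measurable_fst).prodMk (measurable_pi_lambda _ fun i => ?_)
  refine Fin.lastCases ?_ (fun j => ?_) i
  · simpa using measurable_snd
  · simpa [Function.comp_def] using
      (measurable_pi_apply j).comp (measurable_snd.comp measurable_fst)

/-- Joint law of the seed and of the outcomes of the first `t` rounds. -/
def law (env : Environment.{u} K) (alg : Algorithm K) :
    (t : ℕ) → Measure (env.Seed × (Fin t → Outcome K))
  | 0 => env.prior.map (fun s => (s, Fin.elim0))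
  | t + 1 => ((law env alg t) ⊗ₘ (env.step alg t)).map append

instance (env : Environment.{u} K) (alg : Algorithm K) (t : ℕ) :
    IsProbabilityMeasure (env.law alg t) := by
  induction t with
  | zero => exact Measure.isProbabilityMeasure_map (by fun_prop)
  | succ t ih => exact Measure.isProbabilityMeasure_map measurable_append.aemeasurable

/-- The pseudo-regret after `T` rounds. -/
def regret (env : Environment.{u} K) (alg : Algorithm K) (T : ℕ) : ℝ :=
  ⨆ a : Fin K, ∫ x, (∑ t, (x.2 t).2 (x.2 t).1 - ∑ t, (x.2 t).2 a) ∂(env.law alg T)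

/-- The adversarial regime with a `(Δ, C, T)` self-bounding constraint. -/
def SelfBounding (env : Environment.{u} K) (Δ : Fin K → ℝ) (C : ℝ) (T : ℕ) : Prop :=
  ∀ alg : Algorithm K,
    ∫ x, ∑ t, Δ (x.2 t).1 ∂(env.law alg T) - C ≤ env.regret alg T

end Environment

/-! ### The algorithm -/

/-- The `α`-Tsallis entropy regularizer. -/
def tsallis {K : ℕ} (α : ℝ) (q : Fin K → ℝ) : ℝ := -(1 / α) * ∑ a, (q a ^ α - q a)

/-- Mean feature vector under `p`. -/
def featMean {K d : ℕ} (φ : Fin K → Fin d → ℝ) (p : Fin K → ℝ) : Fin d → ℝ := ∑ a, p a • φ a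

/-- Mean-centered feature vector. -/
def centered {K d : ℕ} (φ : Fin K → Fin d → ℝ) (p : Fin K → ℝ) (a : Fin K) : Fin d → ℝ :=
  φ a - featMean φ p

/-- Covariance matrix of the features under `p`. -/
def featCov {K d : ℕ} (φ : Fin K → Fin d → ℝ) (p : Fin K → ℝ) : Matrix (Fin d) (Fin d) ℝ :=
  ∑ a, p a • Matrix.vecMulVec (centered φ p a) (centered φ p a)

/-- The bilinear form of the inverse covariance matrix, on two centered features. -/
def leverage {K d : ℕ} (φ : Fin K → Fin d → ℝ) (p : Fin K → ℝ) (a b : Fin K) : ℝ :=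
  centered φ p a ⬝ᵥ ((featCov φ p)⁻¹ *ᵥ centered φ p b)

/-- `p₀` maximizes `log det` of the covariance matrix over the simplex (with `log 0 = -∞`). -/
def IsOptimalDesign {K d : ℕ} (φ : Fin K → Fin d → ℝ) (p₀ : Fin K → ℝ) : Prop :=
  p₀ ∈ stdSimplex ℝ (Fin K) ∧
    IsMaxOn (fun p => ENNReal.log (ENNReal.ofReal (featCov φ p).det)) (stdSimplex ℝ (Fin K)) p₀

/-- `min {‖q‖_∞, 1 - ‖q‖_∞}` (the norm of `Fin K → ℝ` is the sup norm). -/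
def qStar {K : ℕ} (q : Fin K → ℝ) : ℝ := min ‖q‖ (1 - ‖q‖)

/-- The inputs of the algorithm. -/
structure Params (K d : ℕ) where
  φ : Fin K → Fin d → ℝ
  ε : ℝ
  σ : ℝ
  α : ℝ
  β₁ : ℝ
  βbar : ℝ
  p₀ : Fin K → ℝ

/-- What the algorithm carries into a round: the sum of the past shifted loss estimates, and the
current inverse learning rate. -/
structure State (K : ℕ) where
  L : Fin K → ℝ
  β : ℝ

namespace Params

variable {K d : ℕ} (P : Params K d)

/-- The exponent of the auxiliary regularizer. -/
def αbar : ℝ := (P.ε - 1) * (1 - P.α)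

/-- The objective of the follow-the-regularized-leader update. -/
def objective (st : State K) (q : Fin K → ℝ) : ℝ :=
  ∑ a, st.L a * q a + st.β * tsallis P.α q + P.βbar * tsallis P.αbar q

/-- `q_t`: a minimizer of the objective over the simplex. -/
def q (st : State K) : Fin K → ℝ :=
  Classical.epsilon fun q =>
    q ∈ stdSimplex ℝ (Fin K) ∧ IsMinOn (P.objective st) (stdSimplex ℝ (Fin K)) q

/-- `γ_t`: the exploration rate. -/
def γ (st : State K) : ℝ :=
  256 * (1 - P.α) ^ (-2 : ℝ) * P.σ ^ (2 / P.ε) * d * st.β ^ (-2 : ℝ) *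
    qStar (P.q st) ^ (2 * (1 - P.α))

/-- `s_{t,a}`: the clipping threshold, the same for all arms. -/
def s (st : State K) : ℝ := (1 - P.α) * st.β * qStar (P.q st) ^ (P.α - 1) / 8

/-- `p_t`: the sampling distribution. -/
def p (st : State K) : Fin K → ℝ := fun a => (1 - P.γ st) * P.q st a + P.γ st * P.p₀ a

/-- The variance-reduced least-squares loss estimate. -/
def lossTilde (st : State K) (o : Obs K) (a : Fin K) : ℝ := leverage P.φ (P.p st) a o.1 * o.2

/-- The clipped loss estimate. -/
def lossHat (st : State K) (o : Obs K) (a : Fin K) : ℝ :=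
  if |P.lossTilde st o a| ≤ P.s st then P.lossTilde st o a else 0

/-- The bonus `b_{t,a}`. -/
def bonus (st : State K) (a : Fin K) : ℝ :=
  P.σ * (∑ b, P.p st b * |leverage P.φ (P.p st) a b| ^ P.ε) * P.s st ^ (1 - P.ε)

/-- `h_t`. -/
def h (st : State K) : ℝ := -tsallis P.α (P.q st)

/-- `z_t`. -/
def z (st : State K) : ℝ :=
  (1 - P.α) ^ (1 - P.ε) * P.σ * qStar (P.q st) ^ ((P.ε - 1) * (1 - P.α)) * (d : ℝ) ^ (P.ε / 2) *
    (1 - ‖P.p st‖) ^ (2 - P.ε)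

/-- `w_t`. -/
def w (st : State K) : ℝ :=
  P.σ ^ (3 / P.ε) * (1 - P.α) ^ (-2 : ℝ) * d * qStar (P.q st) ^ (2 * (1 - P.α))

/-- End of a round: the loss estimate is updated with `ℓ̂_t - b_t`, and the inverse learning rate
by the stability-penalty matching rule. -/
def next (st : State K) (o : Obs K) : State K where
  L := fun a => st.L a + (P.lossHat st o a - P.bonus st a)
  β := st.β + 1 / P.h st * (st.β ^ (1 - P.ε) * P.z st + st.β ^ (-2 : ℝ) * P.w st)

/-- The state with which the algorithm enters the round that follows `t` observations. -/
def state : (t : ℕ) → (Fin t → Obs K) → State K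
  | 0, _ => ⟨0, P.β₁⟩
  | t + 1, o => P.next (state t (Fin.init o)) (o (Fin.last t))

/-- The inverse learning rate of the previous round (`β_0 = 0`). -/
def betaPrev : (t : ℕ) → (Fin t → Obs K) → ℝ
  | 0, _ => 0
  | t + 1, o => (P.state t (Fin.init o)).β

/-- `alg` is the algorithm with these inputs: it samples from `p_t` in every round. -/
def IsRunBy (alg : Algorithm K) : Prop :=
  ∀ t o a, alg.policy t o {a} = ENNReal.ofReal (P.p (P.state t o) a)

/-- The round-wise bound `(β_t - β_{t-1}) h_t + β_t^{1-ε} z_t + β_t^{-2} w_t`. -/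
def roundBound (t : ℕ) (o : Fin t → Obs K) : ℝ :=
  ((P.state t o).β - P.betaPrev t o) * P.h (P.state t o) +
    (P.state t o).β ^ (1 - P.ε) * P.z (P.state t o) +
    (P.state t o).β ^ (-2 : ℝ) * P.w (P.state t o)

/-- Expectation of the sum of the round-wise bounds over `T` rounds. -/
def expectedBound (env : Environment.{u} K) (alg : Algorithm K) (T : ℕ) : ℝ :=
  ∫ x, ∑ t : Fin T, P.roundBound t (fun i => observe x.2 (Fin.castLE t.isLt.le i))
    ∂(env.law alg T)

/-- The state of the first round. -/
def state₁ : State K := ⟨0, P.β₁⟩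

/-- `h_1`. -/
def h₁ : ℝ := P.h P.state₁

/-- `-ψ̄(q_1)`. -/
def hbar : ℝ := -tsallis P.αbar (P.q P.state₁)

/-- The largest possible value of `z_t` in `T` rounds. -/
def zMax (T : ℕ) : ℝ := sSup {r | ∃ t, t < T ∧ ∃ o : Fin t → Obs K, r = P.z (P.state t o)}

/-- The largest possible value of `w_t` in `T` rounds. -/
def wMax (T : ℕ) : ℝ := sSup {r | ∃ t, t < T ∧ ∃ o : Fin t → Obs K, r = P.w (P.state t o)}

/-- The additive term of the regret bounds. -/
def κ (T : ℕ) : ℝ :=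
  P.zMax T * P.β₁ ^ (1 - P.ε) + P.wMax T * P.β₁ ^ (-2 : ℝ) + P.β₁ * P.h₁ + P.βbar * P.hbar

/-- The sum of `Δ_a^{α/(α-1)}` over the arms `a ≠ a*`. -/
def gapSum (Δ : Fin K → ℝ) (astar : Fin K) : ℝ :=
  ∑ a ∈ Finset.univ.erase astar, Δ a ^ (P.α / (P.α - 1))

/-- The constant `ζ(Δ)`. -/
def ζ (Δ : Fin K → ℝ) (astar : Fin K) : ℝ :=
  2 ^ (P.ε - 1) * ((1 - P.α) * P.α) ^ (1 - P.ε) * P.σ *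
    P.gapSum Δ astar ^ ((1 - P.α) * (P.ε - 1)) *
    (⨅ a : {a : Fin K // a ≠ astar}, Δ a) ^ (P.α * (P.ε - 1) - 1) * (d : ℝ) ^ (P.ε / 2)

/-- The constant `ω(Δ)`. -/
def ω (Δ : Fin K → ℝ) (astar : Fin K) : ℝ :=
  (P.α * (1 - P.α)) ^ (-2 : ℝ) * P.σ ^ (3 / P.ε) * P.gapSum Δ astar ^ (2 * (1 - P.α)) * d

/-- `log₊ x = max {1, log x}`. -/
def logPlus (x : ℝ) : ℝ := max 1 (Real.log x)

/-- The leading term `ι` of the regret bound under a self-bounding constraint. -/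
def ι (Δ : Fin K → ℝ) (astar : Fin K) (C : ℝ) (T : ℕ) : ℝ :=
  P.ζ Δ astar ^ (1 / (P.ε - 1)) * (P.ε / 2) ^ (1 / (1 - P.ε)) *
    logPlus (P.zMax T * P.h₁ ^ (P.ε - 1) * T / (P.ζ Δ astar ^ (P.ε / (P.ε - 1)) + C)) / (P.ε - 1)

/-- The term `ι'` of the regret bound under a self-bounding constraint. -/
def ι' (Δ : Fin K → ℝ) (astar : Fin K) (C : ℝ) (T : ℕ) : ℝ :=
  P.ω Δ astar ^ (1 / 2 : ℝ) * (3 / 2 : ℝ) ^ (-1 / 2 : ℝ) *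
    logPlus (P.wMax T * P.h₁ ^ 2 * T / (P.ω Δ astar ^ (3 / 2 : ℝ) + C))

/-- The choice of the inputs. The features span `ℝ^d` affinely, so that covariance matrices
can be inverted; `β₁` is so large that `γ_t ≤ 1/2` in every round. -/
structure IsAdmissible : Prop where
  one_le_d : 1 ≤ d
  affineSpan_eq_top : affineSpan ℝ (Set.range P.φ) = ⊤
  one_lt_ε : 1 < P.ε
  ε_le_two : P.ε ≤ 2
  σ_pos : 0 < P.σ
  half_le_α : 1 / 2 ≤ P.α
  α_lt_one : P.α < 1
  design : IsOptimalDesign P.φ P.p₀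
  β₁_pos : 0 < P.β₁
  β₁_large : 256 * (1 - P.α) ^ (-2 : ℝ) * P.σ ^ (2 / P.ε) * d * P.β₁ ^ (-2 : ℝ) ≤ 1 / 2
  βbar_large : 64 * (1 - P.α) ^ (-3 : ℝ) * (d : ℝ) ^ P.ε * P.β₁ ^ (1 - P.ε) *
    max (P.σ ^ (3 / P.ε)) P.σ ≤ P.βbar

end Params

end HTLinearBandit

end

open HTLinearBandit

/-! The proof reduces the regret to the expected sum of the quantities `incr` = β^(1-ε) z + β^(-2)
w, and then bounds that sum pathwise through the recursion for β.

One round. Clipping at level s makes the estimates bounded but biased. The bonus b dominates the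
bias, and s·b dominates the second moment (`abs_sum_integral_lossHat_sub_le`,
`sum_integral_lossHat_sq_le`). Mixing in the optimal design with weight γ bounds every leverage by
2d/γ (`leverage_mix_le`), and γ is tuned to s so that b ≤ s (`bonus_le`). The shifted estimates are
therefore at most 2s, exactly the range in which the Tsallis regularizer has quadratic stability
(`stability_sum`). Averaged over the arms, the bonuses cost a multiple of β^(1-ε) z. The gain (1 -
‖p‖)^(2-ε) in z comes from centering the features, which makes the row of the heaviest arm a
combination of the other rows (`sum_sum_abs_leverage_rpow_le`). Exploration costs a multiple of
β^(-2) w. Thus the conditional expectation of the regret of a round exceeds what the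
follow-the-regularized-leader inequality pays by at most 512 `incr` (`integral_excess_nonpos`).

Along a path. Telescoping the minimal values of the objective leaves the penalty (β_{t+1} - β_t)
h_{t+1}. By the update rule (β_{t+1} - β_t) h_t is `incr`, so the penalty is at most 6 `incr` once
h_{t+1} ≤ 6 h_t (`h_le_of_step`). That is the role of the auxiliary regularizer: its gradient
absorbs a jump of β, which is of order q_*^(ᾱ-α) because h is at least of order q_*^α. Together
these facts give `regret_le_incr`.

The schedule. Each component of `incr` obeys β_{t+1} ≥ β_t + β_t^(1-r) z_t / h_t, with r = ε or r =
3. If Y is the sum of the β_t^(1-r) z_t, then β ≥ Y/H, so Y^r grows at most linearly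
(`sum_rpow_le`); this is the adversarial bound. For the logarithmic bound, rounds with h β ≥ Λ are
charged to Λ^(1-r) h^(r-1) z, and the remaining rounds to Λ times an increment of log β, after
separating large jumps of β, an initial phase and rounds of small entropy (`sum_increment_le_log`,
`sum_increment_le_logPlus`).

Self-bounding. The gap inequalities `h_rpow_mul_z_le` and `h_sq_mul_w_le` bound h^(r-1) z by a
multiple of ⟨Δ, p⟩, whose expected sum is at most Reg + C. With Λ chosen so that the coefficient of
Reg + C is τ/2 for some τ ≤ 1, that part of the regret is absorbed on the left; `exists_tradeoff`
picks τ to balance τ C against the growth of Λ. -/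

namespace HTLinearBandit

/-! ### Covariance matrices and leverages. -/

section Design

variable {K d : ℕ} {φ : Fin K → Fin d → ℝ} {p : Fin K → ℝ}

theorem featCov_mulVec (φ : Fin K → Fin d → ℝ) (p : Fin K → ℝ) (v : Fin d → ℝ) :
    featCov φ p *ᵥ v = ∑ a, (p a * (centered φ p a ⬝ᵥ v)) • centered φ p a := by
  rw [featCov, Matrix.sum_mulVec]
  refine Finset.sum_congr rfl fun a _ => ?_
  rw [Matrix.smul_mulVec, Matrix.vecMulVec_mulVec, mul_smul]
  simp [op_smul_eq_smul]

theorem dotProduct_featCov_mulVec (φ : Fin K → Fin d → ℝ) (p : Fin K → ℝ) (u v : Fin d → ℝ) :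
    u ⬝ᵥ (featCov φ p *ᵥ v) =
      ∑ a, p a * ((u ⬝ᵥ centered φ p a) * (centered φ p a ⬝ᵥ v)) := by
  rw [featCov_mulVec, dotProduct_sum]
  refine Finset.sum_congr rfl fun a _ => ?_
  rw [dotProduct_smul, smul_eq_mul]; ring

theorem dotProduct_featCov_self (φ : Fin K → Fin d → ℝ) (p : Fin K → ℝ) (u : Fin d → ℝ) :
    u ⬝ᵥ (featCov φ p *ᵥ u) = ∑ a, p a * (u ⬝ᵥ centered φ p a) ^ 2 := by
  rw [dotProduct_featCov_mulVec]
  refine Finset.sum_congr rfl fun a _ => ?_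
  rw [dotProduct_comm (centered φ p a) u]; ring

theorem featCov_isHermitian (φ : Fin K → Fin d → ℝ) (p : Fin K → ℝ) :
    (featCov φ p).IsHermitian := by
  ext i j
  simp only [featCov, Matrix.conjTranspose_apply, Matrix.sum_apply, Matrix.smul_apply,
    Matrix.vecMulVec_apply, star_trivial, smul_eq_mul]
  exact Finset.sum_congr rfl fun a _ => by ring

theorem featCov_posSemidef (hp : ∀ a, 0 ≤ p a) : (featCov φ p).PosSemidef := by
  refine Matrix.PosSemidef.of_dotProduct_mulVec_nonneg (featCov_isHermitian φ p) fun u => ?_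
  rw [star_trivial, dotProduct_featCov_self]
  exact Finset.sum_nonneg fun a _ => mul_nonneg (hp a) (sq_nonneg _)

/-- If u were constant on the features, it would annihilate their vector span, which is everything,
and in particular itself. -/
theorem exists_dotProduct_sub_ne_zero (hφ : affineSpan ℝ (Set.range φ) = ⊤) {u : Fin d → ℝ}
    (hu : u ≠ 0) (c : ℝ) : ∃ a, u ⬝ᵥ φ a ≠ c := by
  by_contra! hc
  have hv : vectorSpan ℝ (Set.range φ) = ⊤ := by
    rw [← direction_affineSpan, hφ, AffineSubspace.direction_top]
  have hle : vectorSpan ℝ (Set.range φ) ≤ LinearMap.ker (dotProductBilin ℝ ℝ u) := by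
    rw [vectorSpan_def, Submodule.span_le]
    rintro _ ⟨_, ⟨a, rfl⟩, _, ⟨b, rfl⟩, rfl⟩
    simp [dotProduct_sub, hc]
  rw [hv] at hle
  have : u ⬝ᵥ u = 0 := by simpa using hle (Submodule.mem_top (x := u))
  exact hu (dotProduct_self_eq_zero.mp this)

theorem two_le_card_of_affineSpan (hd : 1 ≤ d) (hφ : affineSpan ℝ (Set.range φ) = ⊤) : 2 ≤ K := by
  by_contra! hK
  have hu : (fun _ => 1 : Fin d → ℝ) ≠ 0 := fun h => by
    have := congrFun h ⟨0, hd⟩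
    simp at this
  obtain ⟨a, -⟩ := exists_dotProduct_sub_ne_zero hφ hu 0
  obtain ⟨b, hb⟩ := exists_dotProduct_sub_ne_zero hφ hu ((fun _ => 1 : Fin d → ℝ) ⬝ᵥ φ a)
  have : b = a := Fin.ext (by omega)
  exact hb (by rw [this])

theorem featCov_posDef (hφ : affineSpan ℝ (Set.range φ) = ⊤) (hp : ∀ a, 0 < p a) :
    (featCov φ p).PosDef := by
  refine Matrix.PosDef.of_dotProduct_mulVec_pos (featCov_isHermitian φ p) fun u hu => ?_
  rw [star_trivial, dotProduct_featCov_self]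
  obtain ⟨a, ha⟩ := exists_dotProduct_sub_ne_zero hφ hu (u ⬝ᵥ featMean φ p)
  refine Finset.sum_pos' (fun a _ => mul_nonneg (hp a).le (sq_nonneg _))
    ⟨a, Finset.mem_univ _, mul_pos (hp a) (sq_pos_of_ne_zero ?_)⟩
  rwa [centered, dotProduct_sub, sub_ne_zero]

theorem sum_smul_centered (hp : ∑ a, p a = 1) : ∑ a, p a • centered φ p a = 0 := by
  simp only [centered, smul_sub, Finset.sum_sub_distrib, ← Finset.sum_smul, hp, one_smul]
  simp [featMean]

theorem leverage_comm (φ : Fin K → Fin d → ℝ) (p : Fin K → ℝ) (a b : Fin K) :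
    leverage φ p a b = leverage φ p b a := by
  have h : ((featCov φ p)⁻¹)ᵀ = (featCov φ p)⁻¹ := by
    have := (featCov_isHermitian φ p).inv
    rwa [Matrix.IsHermitian, Matrix.conjTranspose_eq_transpose_of_trivial] at this
  rw [leverage, leverage, Matrix.dotProduct_mulVec, ← Matrix.mulVec_transpose, h, dotProduct_comm]

theorem featCov_det_isUnit (hV : (featCov φ p).PosDef) : IsUnit (featCov φ p).det :=
  (Matrix.isUnit_iff_isUnit_det _).mp hV.isUnit

/-- This is V⁻¹V = 1 read as a reproducing identity: the leverages are the kernel that recovers a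
linear function from its p-weighted values. It makes the unclipped estimate unbiased up to
centering. -/
theorem sum_mul_leverage_mul (hV : (featCov φ p).PosDef) (a : Fin K) (θ : Fin d → ℝ) :
    ∑ b, p b * (leverage φ p a b * (centered φ p b ⬝ᵥ θ)) = centered φ p a ⬝ᵥ θ := by
  have h := dotProduct_featCov_mulVec φ p (centered φ p a ᵥ* (featCov φ p)⁻¹) θ
  rw [← Matrix.dotProduct_mulVec, Matrix.mulVec_mulVec,
    Matrix.nonsing_inv_mul _ (featCov_det_isUnit hV), Matrix.one_mulVec] at h
  rw [h]
  refine Finset.sum_congr rfl fun b _ => ?_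
  rw [leverage, Matrix.dotProduct_mulVec]

/-- Centered features average to zero. This cancellation removes the mean of the losses and later
yields the gain from a concentrated p. -/
theorem sum_mul_leverage (hp : ∑ a, p a = 1) (a : Fin K) :
    ∑ b, p b * leverage φ p a b = 0 := by
  have : ∑ b, p b * leverage φ p a b =
      centered φ p a ⬝ᵥ ((featCov φ p)⁻¹ *ᵥ ∑ b, p b • centered φ p b) := by
    rw [Matrix.mulVec_sum, dotProduct_sum]
    refine Finset.sum_congr rfl fun b _ => ?_
    rw [Matrix.mulVec_smul, dotProduct_smul, smul_eq_mul, leverage]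
  rw [this, sum_smul_centered hp, Matrix.mulVec_zero, dotProduct_zero]

theorem sum_mul_leverage_mul_feat (hV : (featCov φ p).PosDef) (hp : ∑ a, p a = 1) (a : Fin K)
    (θ : Fin d → ℝ) :
    ∑ b, p b * (leverage φ p a b * (φ b ⬝ᵥ θ)) = centered φ p a ⬝ᵥ θ := by
  rw [← sum_mul_leverage_mul hV a θ]
  have h : ∑ b, p b * (leverage φ p a b * (featMean φ p ⬝ᵥ θ)) = 0 := by
    simp only [← mul_assoc]
    rw [← Finset.sum_mul, sum_mul_leverage hp, zero_mul]
  rw [← sub_eq_zero, ← h, ← Finset.sum_sub_distrib]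
  refine Finset.sum_congr rfl fun b _ => ?_
  rw [centered, sub_dotProduct]; ring

theorem sum_mul_leverage_sq (hV : (featCov φ p).PosDef) (a : Fin K) :
    ∑ b, p b * leverage φ p a b ^ 2 = leverage φ p a a := by
  have h := sum_mul_leverage_mul hV a ((featCov φ p)⁻¹ *ᵥ centered φ p a)
  rw [leverage, ← h]
  refine Finset.sum_congr rfl fun b _ => ?_
  change _ = p b * (leverage φ p a b * leverage φ p b a)
  rw [leverage_comm φ p b a]; ring

theorem leverage_self_nonneg (hp : ∀ a, 0 ≤ p a) (hV : (featCov φ p).PosDef) (a : Fin K) :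
    0 ≤ leverage φ p a a := by
  rw [← sum_mul_leverage_sq hV a]
  exact Finset.sum_nonneg fun b _ => mul_nonneg (hp b) (sq_nonneg _)

/-- The sum is the trace of V⁻¹V. -/
theorem sum_mul_leverage_self (hV : (featCov φ p).PosDef) :
    ∑ a, p a * leverage φ p a a = d := by
  have h : ((featCov φ p)⁻¹ * featCov φ p).trace = d := by
    rw [Matrix.nonsing_inv_mul _ (featCov_det_isUnit hV)]; simp
  rw [← h]
  conv_rhs => rw [featCov.eq_def φ p]
  rw [Matrix.mul_sum, Matrix.trace_sum, ← featCov]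
  refine Finset.sum_congr rfl fun a _ => ?_
  rw [Matrix.mul_smul, Matrix.trace_smul, Matrix.mul_vecMulVec, Matrix.trace_vecMulVec,
    smul_eq_mul, leverage, dotProduct_comm]

/-- Testing the hypothesis at u = V⁻¹φ̄ gives g² ≤ B g for the leverage g. This lets a comparison of
quadratic forms replace a comparison of inverse matrices. -/
theorem leverage_self_le (hV : (featCov φ p).PosDef) {a : Fin K} {B : ℝ} (hB : 0 ≤ B)
    (h : ∀ u, (u ⬝ᵥ centered φ p a) ^ 2 ≤ B * (u ⬝ᵥ (featCov φ p *ᵥ u))) :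
    leverage φ p a a ≤ B := by
  have h1 := h ((featCov φ p)⁻¹ *ᵥ centered φ p a)
  rw [Matrix.mulVec_mulVec, Matrix.mul_nonsing_inv _ (featCov_det_isUnit hV), Matrix.one_mulVec,
    dotProduct_comm] at h1
  change leverage φ p a a ^ 2 ≤ B * leverage φ p a a at h1
  by_contra! hc
  nlinarith

/-- Cauchy–Schwarz with weights p, applied to the reproducing identity. -/
theorem dotProduct_sq_le (hp : ∀ a, 0 ≤ p a) (hV : (featCov φ p).PosDef) (a : Fin K)
    (u : Fin d → ℝ) :
    (u ⬝ᵥ centered φ p a) ^ 2 ≤ leverage φ p a a * (u ⬝ᵥ (featCov φ p *ᵥ u)) := by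
  have h := sum_mul_leverage_mul hV a u
  rw [dotProduct_comm u, ← h, ← sum_mul_leverage_sq hV a, dotProduct_featCov_self]
  have := Finset.sum_mul_sq_le_sq_mul_sq Finset.univ
    (fun b => √(p b) * leverage φ p a b) (fun b => √(p b) * (u ⬝ᵥ centered φ p b))
  have e1 : ∀ b, √(p b) * leverage φ p a b * (√(p b) * (u ⬝ᵥ centered φ p b)) =
      p b * (leverage φ p a b * (centered φ p b ⬝ᵥ u)) := fun b => by
    rw [dotProduct_comm u]
    linear_combination (leverage φ p a b * centered φ p b ⬝ᵥ u) * (Real.mul_self_sqrt (hp b))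
  simpa only [e1, mul_pow, Real.sq_sqrt (hp _)] using this

end Design

/-! ### Mixtures and optimal designs. -/

section Mixture

variable {K d : ℕ} {φ : Fin K → Fin d → ℝ}

theorem featMean_mix (φ : Fin K → Fin d → ℝ) (q p : Fin K → ℝ) (η : ℝ) :
    featMean φ (fun a => (1 - η) * q a + η * p a) =
      (1 - η) • featMean φ q + η • featMean φ p := by
  simp only [featMean, add_smul, mul_smul, Finset.sum_add_distrib, Finset.smul_sum]

theorem sum_mul_dotProduct_centered {p : Fin K → ℝ} (hp : ∑ a, p a = 1) (u : Fin d → ℝ) :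
    ∑ a, p a * (u ⬝ᵥ centered φ p a) = 0 := by
  have := congrArg (fun v => u ⬝ᵥ v) (sum_smul_centered (φ := φ) hp)
  simpa [dotProduct_sum, dotProduct_smul] using this

/-- The covariance of a mixture, as a quadratic form. -/
theorem dotProduct_featCov_mix {q p : Fin K → ℝ} (hq : ∑ a, q a = 1) (hp : ∑ a, p a = 1) (η : ℝ)
    (u : Fin d → ℝ) :
    u ⬝ᵥ (featCov φ (fun a => (1 - η) * q a + η * p a) *ᵥ u) =
      (1 - η) * (u ⬝ᵥ (featCov φ q *ᵥ u)) + η * (u ⬝ᵥ (featCov φ p *ᵥ u)) +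
        η * (1 - η) * (u ⬝ᵥ (featMean φ p - featMean φ q)) ^ 2 := by
  simp only [dotProduct_featCov_self]
  set m := u ⬝ᵥ (featMean φ p - featMean φ q) with hm
  have h1 : ∀ a, u ⬝ᵥ centered φ (fun a => (1 - η) * q a + η * p a) a =
      u ⬝ᵥ centered φ q a - η * m := fun a => by
    simp only [centered, featMean_mix, hm, dotProduct_sub, dotProduct_add, dotProduct_smul,
      smul_eq_mul]
    ring
  have h2 : ∀ a, u ⬝ᵥ centered φ (fun a => (1 - η) * q a + η * p a) a =
      u ⬝ᵥ centered φ p a + (1 - η) * m := fun a => by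
    simp only [centered, featMean_mix, hm, dotProduct_sub, dotProduct_add, dotProduct_smul,
      smul_eq_mul]
    ring
  have e : ∀ a, ((1 - η) * q a + η * p a) *
      (u ⬝ᵥ centered φ (fun a => (1 - η) * q a + η * p a) a) ^ 2 =
      (1 - η) * (q a * (u ⬝ᵥ centered φ q a) ^ 2 - 2 * η * m * (q a * (u ⬝ᵥ centered φ q a)) +
        η ^ 2 * m ^ 2 * q a) +
      η * (p a * (u ⬝ᵥ centered φ p a) ^ 2 +
        2 * (1 - η) * m * (p a * (u ⬝ᵥ centered φ p a)) + (1 - η) ^ 2 * m ^ 2 * p a) := by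
    intro a
    rw [add_mul]
    nth_rewrite 1 [h1 a]
    rw [h2 a]
    ring
  simp only [e, Finset.sum_add_distrib, ← Finset.mul_sum, Finset.sum_sub_distrib, hp, hq,
    sum_mul_dotProduct_centered hp, sum_mul_dotProduct_centered hq]
  ring

theorem featCov_mix_single {p : Fin K → ℝ} (hp : ∑ a, p a = 1) (η : ℝ) (a : Fin K) :
    featCov φ (fun b => (1 - η) * p b + η * (Pi.single a 1 : Fin K → ℝ) b) =
      (1 - η) • (featCov φ p + η • Matrix.vecMulVec (centered φ p a) (centered φ p a)) := by
  have hs : ∑ b, (Pi.single a 1 : Fin K → ℝ) b = 1 := by simp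
  have hm : featMean φ (Pi.single a 1) = φ a := by
    simp [featMean, Pi.single_apply, ite_smul]
  have hc : centered φ (Pi.single a 1) a = 0 := by simp [centered, hm]
  have h0 : featCov φ (Pi.single a 1) = 0 := by
    rw [featCov]
    refine Finset.sum_eq_zero fun b _ => ?_
    rcases eq_or_ne b a with rfl | hb
    · simp [hc]
    · simp [hb]
  set A := featCov φ (fun b => (1 - η) * p b + η * (Pi.single a 1 : Fin K → ℝ) b) with hA
  set B := (1 - η) • (featCov φ p + η • Matrix.vecMulVec (centered φ p a) (centered φ p a))
    with hB
  have hAs : A.IsHermitian := featCov_isHermitian _ _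
  have hBs : B.IsHermitian := by
    have h := featCov_isHermitian φ p
    ext i j
    have h' := congrFun (congrFun h i) j
    simp only [Matrix.conjTranspose_apply, star_trivial] at h'
    simp only [hB, Matrix.conjTranspose_apply, Matrix.smul_apply, Matrix.add_apply,
      Matrix.vecMulVec_apply, star_trivial, smul_eq_mul, h']
    ring
  have hq : ∀ u, u ⬝ᵥ (A *ᵥ u) = u ⬝ᵥ (B *ᵥ u) := fun u => by
    rw [hA, dotProduct_featCov_mix hp hs, h0, hm, hB]
    simp only [Matrix.smul_mulVec, Matrix.add_mulVec, dotProduct_smul, dotProduct_add,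
      Matrix.vecMulVec_mulVec, smul_eq_mul, Matrix.zero_mulVec, dotProduct_zero,
      op_smul_eq_smul, ← centered.eq_def]
    rw [dotProduct_comm (centered φ p a) u]
    ring
  -- Polarization: symmetric matrices with equal quadratic forms are equal.
  have hpol : ∀ u v, u ⬝ᵥ (A *ᵥ v) = u ⬝ᵥ (B *ᵥ v) := fun u v => by
    have sym : ∀ M : Matrix (Fin d) (Fin d) ℝ, M.IsHermitian → v ⬝ᵥ (M *ᵥ u) = u ⬝ᵥ (M *ᵥ v) :=
      fun M hM => by
        rw [Matrix.dotProduct_mulVec, ← Matrix.mulVec_transpose,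
          ← Matrix.conjTranspose_eq_transpose_of_trivial, hM, dotProduct_comm]
    have h1 := hq (u + v)
    simp only [Matrix.mulVec_add, dotProduct_add, add_dotProduct, hq u, hq v, sym A hAs,
      sym B hBs] at h1
    linarith
  exact Matrix.ext_iff_mulVec.mpr fun v => dotProduct_eq _ _ fun u => by
    rw [dotProduct_comm, hpol, dotProduct_comm]

/-- The uniform distribution has a positive determinant, so a maximizer cannot have log det = -∞. -/
theorem IsOptimalDesign.featCov_posDef {p₀ : Fin K → ℝ} (hd : 1 ≤ d)
    (hφ : affineSpan ℝ (Set.range φ) = ⊤) (h : IsOptimalDesign φ p₀) : (featCov φ p₀).PosDef := by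
  have hK : 2 ≤ K := two_le_card_of_affineSpan hd hφ
  have hK0 : (0 : ℝ) < K := by positivity
  have hu : (fun _ => (K : ℝ)⁻¹ : Fin K → ℝ) ∈ stdSimplex ℝ (Fin K) :=
    ⟨fun _ => by positivity, by simp [hK0.ne']⟩
  have hpos := (HTLinearBandit.featCov_posDef (p := fun _ => (K : ℝ)⁻¹) hφ
    (fun _ => by positivity)).det_pos
  have hle := h.2 hu
  simp only [Set.mem_ofPred_eq, ENNReal.log_le_log_iff] at hle
  rw [(featCov_posSemidef h.1.1).posDef_iff_det_ne_zero]
  intro h0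
  rw [h0, ENNReal.ofReal_zero, nonpos_iff_eq_zero, ENNReal.ofReal_eq_zero] at hle
  linarith

/-- The easy half of the Kiefer–Wolfowitz theorem: moving mass η to the arm a multiplies the
determinant by (1 - η)^d (1 + η g), with g its leverage. Optimality forces this factor to be at most
1, and η → 0 gives g ≤ d. -/
theorem IsOptimalDesign.leverage_le {p₀ : Fin K → ℝ} (hd : 1 ≤ d)
    (hφ : affineSpan ℝ (Set.range φ) = ⊤) (h : IsOptimalDesign φ p₀) (a : Fin K) :
    leverage φ p₀ a a ≤ d := by
  have hV := h.featCov_posDef hd hφ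
  set g := leverage φ p₀ a a with hg
  have key : ∀ η : ℝ, 0 < η → η < 1 → g ≤ d + d * η * g := by
    intro η h0 h1
    have hmem : (fun b => (1 - η) * p₀ b + η * (Pi.single a 1 : Fin K → ℝ) b) ∈
        stdSimplex ℝ (Fin K) := by
      refine ⟨fun b => ?_, ?_⟩
      · have := h.1.1 b
        have : 0 ≤ (Pi.single a 1 : Fin K → ℝ) b := by
          rw [Pi.single_apply]; split_ifs <;> norm_num
        have : 0 ≤ 1 - η := by linarith
        positivity
      · simp [Finset.sum_add_distrib, ← Finset.mul_sum, h.1.2]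
    have hle := h.2 hmem
    simp only [Set.mem_ofPred_eq, ENNReal.log_le_log_iff] at hle
    rw [ENNReal.ofReal_le_ofReal_iff hV.det_pos.le, featCov_mix_single h.1.2, Matrix.det_smul,
      Fintype.card_fin] at hle
    have hdet : (featCov φ p₀ + η • Matrix.vecMulVec (centered φ p₀ a) (centered φ p₀ a)).det =
        (featCov φ p₀).det * (1 + η * g) := by
      have := Matrix.det_add_replicateCol_mul_replicateRow (ι := Unit) hV.det_pos.ne'.isUnit
        (η • centered φ p₀ a) (centered φ p₀ a)
      rw [← Matrix.vecMulVec_eq, Matrix.smul_vecMulVec,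
        Matrix.det_unique (1 + _)] at this
      rw [this, Matrix.add_apply, Matrix.one_apply_eq]
      congr 2
      rw [Matrix.mul_assoc, ← Matrix.replicateCol_mulVec,
        Matrix.replicateRow_mul_replicateCol_apply,
        Matrix.mulVec_smul, dotProduct_smul, smul_eq_mul, hg, leverage]
    rw [hdet] at hle
    -- Bernoulli's inequality replaces a derivative at η = 0.
    have hb : 1 + (d : ℝ) * (-η) ≤ (1 + -η) ^ d := one_add_mul_le_pow (by linarith) d
    have hg0 : 0 ≤ g := leverage_self_nonneg h.1.1 hV a
    have hx : (1 - η) ^ d * (1 + η * g) ≤ 1 := by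
      have := hV.det_pos
      nlinarith
    have hy : (1 - d * η) * (1 + η * g) ≤ 1 := by
      refine le_trans (mul_le_mul_of_nonneg_right ?_ (by positivity)) hx
      have : 1 + -η = 1 - η := by ring
      rw [this] at hb; linarith
    have : η * (g - d - d * η * g) ≤ 0 := by nlinarith
    nlinarith
  refine le_of_forall_pos_le_add fun e he => ?_
  have hg0 : 0 ≤ g := leverage_self_nonneg h.1.1 hV a
  have hd0 : (0 : ℝ) ≤ d := by positivity
  set η := min (1 / 2) (e / (d * g + 1)) with hη
  have h1 : 0 < η := lt_min (by norm_num) (by positivity)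
  have h2 : η < 1 := lt_of_le_of_lt (min_le_left _ _) (by norm_num)
  have h3 : η * (d * g + 1) ≤ e := by
    rw [← le_div_iff₀ (by positivity)]; exact min_le_right _ _
  have := key η h1 h2
  nlinarith

/-- Mixing in an optimal design bounds the leverages. -/
theorem leverage_mix_le {q p₀ : Fin K → ℝ} (hd : 1 ≤ d) (hφ : affineSpan ℝ (Set.range φ) = ⊤)
    (h : IsOptimalDesign φ p₀) (hq : ∀ a, 0 < q a) (hq1 : ∑ a, q a = 1) {γ : ℝ} (h0 : 0 < γ)
    (h1 : γ < 1) (a : Fin K) :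
    leverage φ (fun a => (1 - γ) * q a + γ * p₀ a) a a ≤ 2 * d / γ := by
  have hp : ∀ a, 0 < (1 - γ) * q a + γ * p₀ a := fun a => by
    have := h.1.1 a
    have := hq a
    have : 0 < 1 - γ := by linarith
    positivity
  refine leverage_self_le (HTLinearBandit.featCov_posDef hφ hp) (by positivity) fun u => ?_
  rw [dotProduct_featCov_mix hq1 h.1.2]
  have hx := dotProduct_sq_le h.1.1 (h.featCov_posDef hd hφ) a u
  have hle := h.leverage_le hd hφ a
  have hW : 0 ≤ u ⬝ᵥ (featCov φ q *ᵥ u) := by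
    rw [dotProduct_featCov_self]
    exact Finset.sum_nonneg fun a _ => mul_nonneg (hq a).le (sq_nonneg _)
  have hV0 : 0 ≤ u ⬝ᵥ (featCov φ p₀ *ᵥ u) := by
    rw [dotProduct_featCov_self]
    exact Finset.sum_nonneg fun a _ => mul_nonneg (h.1.1 a) (sq_nonneg _)
  set m := u ⬝ᵥ (featMean φ p₀ - featMean φ q) with hm
  -- Passing from p₀ to the mixture shifts the mean. The between-means term γ(1 - γ)m² of the
  -- mixture covariance pays for that shift, at the price of the factor 2.
  have hc : u ⬝ᵥ centered φ (fun a => (1 - γ) * q a + γ * p₀ a) a =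
      u ⬝ᵥ centered φ p₀ a + (1 - γ) * m := by
    simp only [centered, featMean_mix, hm, dotProduct_sub, dotProduct_add, dotProduct_smul,
      smul_eq_mul]
    ring
  rw [hc]
  set x := u ⬝ᵥ centered φ p₀ a
  set X := u ⬝ᵥ (featCov φ p₀ *ᵥ u)
  have hx' : x ^ 2 ≤ d * X := hx.trans (mul_le_mul_of_nonneg_right hle hV0)
  have hd1 : (1 : ℝ) ≤ d := by exact_mod_cast hd
  have h1' : 0 < 1 - γ := by linarith
  have e : 2 * (d : ℝ) / γ * ((1 - γ) * (u ⬝ᵥ (featCov φ q *ᵥ u)) + γ * X + γ * (1 - γ) * m ^ 2) =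
      2 * d * X + 2 * d * (1 - γ) * m ^ 2 + 2 * d / γ * ((1 - γ) * (u ⬝ᵥ (featCov φ q *ᵥ u))) := by
    field_simp
    ring
  rw [e]
  have : 0 ≤ 2 * d / γ * ((1 - γ) * (u ⬝ᵥ (featCov φ q *ᵥ u))) := by positivity
  have h3 : (x + (1 - γ) * m) ^ 2 ≤ 2 * x ^ 2 + 2 * ((1 - γ) * m) ^ 2 := by
    nlinarith [sq_nonneg (x - (1 - γ) * m)]
  have h4 : ((1 - γ) * m) ^ 2 ≤ d * (1 - γ) * m ^ 2 := by
    have : (1 - γ) ^ 2 ≤ d * (1 - γ) := by nlinarith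
    nlinarith [sq_nonneg m]
  nlinarith

end Mixture

/-! ### Moments of the leverages. -/

section Moments

/-- Hölder with exponent 2/r; it reduces ε-th moments to second moments, which are known exactly. -/
theorem sum_mul_rpow_le {ι : Type*} (s : Finset ι) {w x : ι → ℝ} (hw : ∀ i, 0 ≤ w i)
    (hx : ∀ i, 0 ≤ x i) {r : ℝ} (h0 : 0 < r) (h2 : r ≤ 2) :
    ∑ i ∈ s, w i * x i ^ r ≤ (∑ i ∈ s, w i) ^ (1 - r / 2) * (∑ i ∈ s, w i * x i ^ 2) ^ (r / 2) := by
  have h := Real.inner_le_weight_mul_Lp_of_nonneg s (p := 2 / r) (by rw [le_div_iff₀ h0]; linarith)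
    w (fun i => x i ^ r) hw (fun i => Real.rpow_nonneg (hx i) _)
  have e : ∀ i, (x i ^ r) ^ (2 / r) = x i ^ 2 := fun i => by
    rw [← Real.rpow_mul (hx i), mul_div_cancel₀ _ h0.ne', Real.rpow_two]
  simpa only [inv_div, e] using h

theorem exists_norm_eq {K : ℕ} (hK : 0 < K) {p : Fin K → ℝ} (hp : ∀ a, 0 ≤ p a) :
    ∃ a₀, ‖p‖ = p a₀ ∧ ∀ a, p a ≤ p a₀ := by
  have : Nonempty (Fin K) := ⟨⟨0, hK⟩⟩
  obtain ⟨a₀, h⟩ := Finite.exists_max p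
  refine ⟨a₀, le_antisymm ?_ ?_, h⟩
  · rw [pi_norm_le_iff_of_nonneg (hp a₀)]
    intro a; rw [Real.norm_of_nonneg (hp a)]; exact h a
  · have := norm_le_pi_norm p a₀
    rwa [Real.norm_of_nonneg (hp a₀)] at this

theorem sum_mul_abs_leverage_rpow_le {K d : ℕ} {φ : Fin K → Fin d → ℝ} {p : Fin K → ℝ}
    (hp : ∀ a, 0 ≤ p a) (hp1 : ∑ a, p a = 1) (hV : (featCov φ p).PosDef) {ε : ℝ} (h0 : 0 < ε)
    (h2 : ε ≤ 2) (a : Fin K) :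
    ∑ b, p b * |leverage φ p a b| ^ ε ≤ leverage φ p a a ^ (ε / 2) := by
  have h := sum_mul_rpow_le Finset.univ hp (fun b => abs_nonneg (leverage φ p a b)) h0 h2
  simpa only [hp1, Real.one_rpow, one_mul, sq_abs, sum_mul_leverage_sq hV] using h

/-- The two-sided moment of the leverages, with the gain from the concentration of `p`. -/
theorem sum_sum_abs_leverage_rpow_le {K d : ℕ} {φ : Fin K → Fin d → ℝ} {p : Fin K → ℝ}
    (hK : 0 < K) (hp : ∀ a, 0 ≤ p a) (hp1 : ∑ a, p a = 1) (hV : (featCov φ p).PosDef) {ε : ℝ}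
    (h1 : 1 < ε) (h2 : ε ≤ 2) :
    ∑ a, p a * ∑ b, p b * |leverage φ p a b| ^ ε ≤
      4 * ((d : ℝ) ^ (ε / 2) * (1 - ‖p‖) ^ (2 - ε)) := by
  have h0 : 0 < ε := by linarith
  obtain ⟨a₀, hn, hmax⟩ := exists_norm_eq hK hp
  have hsplit : ∀ f : Fin K → ℝ, ∑ a, f a = f a₀ + ∑ a ∈ Finset.univ.erase a₀, f a := fun f =>
    (Finset.add_sum_erase _ _ (Finset.mem_univ a₀)).symm
  set E := Finset.univ.erase a₀ with hE
  have hm : ∑ a ∈ E, p a = 1 - p a₀ := by have := hsplit p; linarith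
  have hle1 : p a₀ ≤ 1 := by
    have := Finset.sum_nonneg fun a (_ : a ∈ E) => hp a
    linarith
  set L := fun a b => |leverage φ p a b| with hL
  have hLn : ∀ a b, 0 ≤ L a b := fun a b => abs_nonneg _
  have hLc : ∀ a b, L a b = L b a := fun a b => by simp only [hL, leverage_comm φ p a b]
  have hd0 : (0 : ℝ) ≤ (d : ℝ) ^ (ε / 2) := by positivity
  rw [hn]
  have hsq : ∑ a, p a * ∑ b, p b * L a b ^ 2 = d := by
    simp only [hL, sq_abs, sum_mul_leverage_sq hV, sum_mul_leverage_self hV]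
  -- Without a heavy arm, (1 - ‖p‖)^(2-ε) ≥ 1/2 and there is nothing to gain over plain Hölder.
  by_cases hhalf : p a₀ < 1 / 2
  · have hA : ∑ a, p a * ∑ b, p b * L a b ^ ε ≤ (d : ℝ) ^ (ε / 2) := by
      have h := sum_mul_rpow_le (Finset.univ ×ˢ Finset.univ) (w := fun i => p i.1 * p i.2)
        (x := fun i => L i.1 i.2) (fun i => mul_nonneg (hp _) (hp _)) (fun i => hLn _ _) h0 h2
      rw [Finset.sum_product, Finset.sum_product, Finset.sum_product] at h
      simp only [mul_assoc, ← Finset.mul_sum, hp1, mul_one, Real.one_rpow, one_mul, hsq] at h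
      exact h
    have hB : 1 / 2 ≤ (1 - p a₀) ^ (2 - ε) := by
      calc (1 / 2 : ℝ) = (1 / 2) ^ (1 : ℝ) := by rw [Real.rpow_one]
        _ ≤ (1 / 2) ^ (2 - ε) :=
          Real.rpow_le_rpow_of_exponent_ge (by norm_num) (by norm_num) (by linarith)
        _ ≤ _ := Real.rpow_le_rpow (by norm_num) (by linarith) (by linarith)
    nlinarith
  push Not at hhalf
  have hpos : 0 < p a₀ := by linarith
  set S := ∑ a ∈ E, p a * ∑ b ∈ E, p b * L a b ^ ε with hS
  have hS0 : 0 ≤ S := Finset.sum_nonneg fun a _ => mul_nonneg (hp a)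
    (Finset.sum_nonneg fun b _ => mul_nonneg (hp b) (Real.rpow_nonneg (hLn _ _) _))
  -- Away from the heavy arm the product weight has mass (1 - p a₀)², and Hölder raises it to the
  -- power 1 - ε/2.
  have hSle : S ≤ (d : ℝ) ^ (ε / 2) * (1 - p a₀) ^ (2 - ε) := by
    have h := sum_mul_rpow_le (E ×ˢ E) (w := fun i => p i.1 * p i.2)
      (x := fun i => L i.1 i.2) (fun i => mul_nonneg (hp _) (hp _)) (fun i => hLn _ _) h0 h2
    rw [Finset.sum_product, Finset.sum_product, Finset.sum_product] at h
    simp only [mul_assoc, ← Finset.mul_sum, ← Finset.sum_mul, hm] at h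
    refine h.trans ?_
    rw [mul_comm]
    have hq : ∑ a ∈ E, p a * ∑ b ∈ E, p b * L a b ^ 2 ≤ d := by
      rw [← hsq]
      have hin : ∀ a, ∑ b ∈ E, p b * L a b ^ 2 ≤ ∑ b, p b * L a b ^ 2 := fun a =>
        Finset.sum_le_sum_of_subset_of_nonneg (Finset.erase_subset _ _)
          fun b _ _ => mul_nonneg (hp b) (sq_nonneg _)
      refine (Finset.sum_le_sum fun a _ => mul_le_mul_of_nonneg_left (hin a) (hp a)).trans ?_
      exact Finset.sum_le_sum_of_subset_of_nonneg (Finset.erase_subset _ _)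
        fun a _ _ => mul_nonneg (hp a)
          (Finset.sum_nonneg fun b _ => mul_nonneg (hp b) (sq_nonneg _))
    have hq0 : 0 ≤ ∑ a ∈ E, p a * ∑ b ∈ E, p b * L a b ^ 2 :=
      Finset.sum_nonneg fun a _ => mul_nonneg (hp a)
        (Finset.sum_nonneg fun b _ => mul_nonneg (hp b) (sq_nonneg _))
    refine mul_le_mul (Real.rpow_le_rpow hq0 hq (by linarith)) (le_of_eq ?_)
      (Real.rpow_nonneg (mul_self_nonneg _) _) hd0
    rw [← sq, ← Real.rpow_two, ← Real.rpow_mul (by linarith)]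
    congr 1; ring
  -- the row of the heaviest arm is controlled by the other rows
  have hrow : ∀ b, p a₀ * L a₀ b ^ ε ≤ ∑ c ∈ E, p c * L c b ^ ε := by
    intro b
    have hz : p a₀ * L a₀ b ≤ ∑ c ∈ E, p c * L c b := by
      have h := sum_mul_leverage (φ := φ) hp1 b
      rw [hsplit] at h
      have h' : p a₀ * leverage φ p b a₀ = -∑ c ∈ E, p c * leverage φ p b c := by linarith
      calc p a₀ * L a₀ b = |p a₀ * leverage φ p b a₀| := by
            rw [abs_mul, abs_of_nonneg hpos.le, hLc]
        _ ≤ ∑ c ∈ E, |p c * leverage φ p b c| := by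
            rw [h', abs_neg]; exact Finset.abs_sum_le_sum_abs _ _
        _ = ∑ c ∈ E, p c * L c b := by
            refine Finset.sum_congr rfl fun c _ => ?_
            rw [abs_mul, abs_of_nonneg (hp c), hLc]
    have hj := Real.inner_le_weight_mul_Lp_of_nonneg E h1.le p (fun c => L c b) hp
      (fun c => hLn c b)
    rw [hm] at hj
    set R := ∑ c ∈ E, p c * L c b ^ ε with hR
    have hR0 : 0 ≤ R :=
      Finset.sum_nonneg fun c _ => mul_nonneg (hp c) (Real.rpow_nonneg (hLn _ _) _)
    have h1p : 0 ≤ 1 - p a₀ := by linarith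
    have hu := Real.rpow_le_rpow (mul_nonneg hpos.le (hLn a₀ b)) (hz.trans hj) h0.le
    rw [Real.mul_rpow hpos.le (hLn _ _), Real.mul_rpow (Real.rpow_nonneg h1p _)
      (Real.rpow_nonneg hR0 _), ← Real.rpow_mul h1p, ← Real.rpow_mul hR0,
      inv_mul_cancel₀ h0.ne', Real.rpow_one] at hu
    have e1 : (1 - ε⁻¹) * ε = ε - 1 := by field_simp
    rw [e1] at hu
    have e2 : p a₀ ^ ε = p a₀ ^ (ε - 1) * p a₀ := by
      rw [← Real.rpow_add_one hpos.ne']; congr 1; ring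
    -- Here p a₀ ≥ 1/2 is used: the light mass is no larger than the heavy one.
    have h3 : (1 - p a₀) ^ (ε - 1) ≤ p a₀ ^ (ε - 1) :=
      Real.rpow_le_rpow h1p (by linarith) (by linarith)
    have h4 : 0 < p a₀ ^ (ε - 1) := Real.rpow_pos_of_pos hpos _
    have h5 : p a₀ ^ (ε - 1) * (p a₀ * L a₀ b ^ ε) ≤ p a₀ ^ (ε - 1) * R := by
      rw [← mul_assoc, ← e2]
      exact hu.trans (mul_le_mul_of_nonneg_right h3 hR0)
    exact le_of_mul_le_mul_left h5 h4
  have hcol : ∑ b ∈ E, p b * (p a₀ * L a₀ b ^ ε) ≤ S := by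
    have : S = ∑ b ∈ E, p b * ∑ c ∈ E, p c * L c b ^ ε := by
      rw [hS]
      refine Finset.sum_congr rfl fun a _ => ?_
      simp only [hLc a]
    rw [this]
    exact Finset.sum_le_sum fun b _ => mul_le_mul_of_nonneg_left (hrow b) (hp b)
  have hcor : p a₀ * (p a₀ * L a₀ a₀ ^ ε) ≤ S := by
    refine le_trans (mul_le_mul_of_nonneg_left (hrow a₀) hpos.le) (le_trans (le_of_eq ?_) hcol)
    rw [Finset.mul_sum]
    refine Finset.sum_congr rfl fun c _ => ?_
    rw [hLc]; ring
  -- Corner, row, column and remaining block are each at most S, whence the constant 4.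
  have hfin : ∑ a, p a * ∑ b, p b * L a b ^ ε =
      p a₀ * (p a₀ * L a₀ a₀ ^ ε) + 2 * ∑ b ∈ E, p b * (p a₀ * L a₀ b ^ ε) + S := by
    have e1 : ∀ a, ∑ b, p b * L a b ^ ε = p a₀ * L a a₀ ^ ε + ∑ b ∈ E, p b * L a b ^ ε :=
      fun a => hsplit _
    rw [hsplit]
    simp only [e1, mul_add, Finset.sum_add_distrib]
    have e2 : p a₀ * ∑ b ∈ E, p b * L a₀ b ^ ε = ∑ b ∈ E, p b * (p a₀ * L a₀ b ^ ε) := by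
      rw [Finset.mul_sum]; exact Finset.sum_congr rfl fun b _ => by ring
    have e3 : ∑ a ∈ E, p a * (p a₀ * L a a₀ ^ ε) = ∑ b ∈ E, p b * (p a₀ * L a₀ b ^ ε) :=
      Finset.sum_congr rfl fun b _ => by rw [hLc]
    rw [e2, e3]; ring
  change ∑ a, p a * ∑ b, p b * L a b ^ ε ≤ _
  rw [hfin]
  linarith

end Moments

/-! ### Bregman divergences of the Tsallis entropies. -/

section Bregman

/-- The Bregman divergence of `x ↦ -x ^ r / r`. -/
noncomputable def breg (r x y : ℝ) : ℝ := (y ^ r - x ^ r) / r + y ^ (r - 1) * (x - y)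

theorem breg_eq_mul {r x y : ℝ} (hx : 0 ≤ x) (hy : 0 < y) :
    breg r x y = y ^ r / r * (1 + r * (x / y - 1) - (1 + (x / y - 1)) ^ r) + 
      y ^ r * (x / y - 1) * (1 - r / r) := by
  have h1 : (1 + (x / y - 1)) ^ r = x ^ r / y ^ r := by
    rw [← Real.div_rpow hx hy.le]; congr 1; ring
  have h2 : y ^ (r - 1) = y ^ r / y := Real.rpow_sub_one hy.ne' r
  have h3 : y ^ r ≠ 0 := (Real.rpow_pos_of_pos hy r).ne'
  rw [h1, breg, h2]
  field_simp
  ring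

theorem breg_nonneg {r x y : ℝ} (h0 : 0 < r) (h1 : r < 1) (hx : 0 ≤ x) (hy : 0 < y) :
    0 ≤ breg r x y := by
  rw [breg_eq_mul hx hy, div_self h0.ne', sub_self, mul_zero, add_zero]
  refine mul_nonneg (by positivity) (sub_nonneg.mpr ?_)
  refine rpow_one_add_le_one_add_mul_self ?_ h0.le h1.le
  have : 0 ≤ x / y := by positivity
  linarith

theorem breg_pos {r x y : ℝ} (h0 : 0 < r) (h1 : r < 1) (hx : 0 ≤ x) (hy : 0 < y) (hxy : x ≠ y) :
    0 < breg r x y := by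
  rw [breg_eq_mul hx hy, div_self h0.ne', sub_self, mul_zero, add_zero]
  refine mul_pos (by positivity) (sub_pos.mpr ?_)
  refine rpow_one_add_lt_one_add_mul_self ?_ ?_ h0 h1
  · have : 0 ≤ x / y := by positivity
    linarith
  · rw [sub_ne_zero]
    intro h
    exact hxy ((div_eq_one_iff_eq hy.ne').mp h)

end Bregman

/-- The linear part of the entropy cancels between points of equal total mass; the gradient that
remains is -y^(r-1). -/
theorem tsallis_sub {K : ℕ} {r : ℝ} (hr : r ≠ 0) {x y : Fin K → ℝ} (hxy : ∑ a, x a = ∑ a, y a) :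
    tsallis r x - tsallis r y =
      ∑ a, -(y a ^ (r - 1)) * (x a - y a) + ∑ a, breg r (x a) (y a) := by
  have h : tsallis r x - tsallis r y = ∑ a, (y a ^ r - x a ^ r) / r + 
      (∑ a, x a - ∑ a, y a) / r := by
    simp only [tsallis, Finset.sum_sub_distrib, ← Finset.sum_div]
    field_simp
    ring
  rw [h, hxy, sub_self, zero_div, add_zero, ← Finset.sum_add_distrib]
  exact Finset.sum_congr rfl fun a _ => by rw [breg]; ring

theorem continuous_tsallis {K : ℕ} {r : ℝ} (hr : 0 < r) :
    Continuous (tsallis r : (Fin K → ℝ) → ℝ) := by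
  unfold tsallis
  have : ∀ a : Fin K, Continuous fun q : Fin K → ℝ => q a ^ r := fun a =>
    (Real.continuous_rpow_const hr.le).comp (continuous_apply a)
  fun_prop

/-! ### The regularized minimizer: positivity, optimality, uniqueness, continuity. -/

namespace Params

variable {K d : ℕ} {P : Params K d}

/-- The gradient of the objective, up to a constant vector. -/
noncomputable def grad (P : Params K d) (st : State K) (y : Fin K → ℝ) (a : Fin K) : ℝ :=
  st.L a - st.β * y a ^ (P.α - 1) - P.βbar * y a ^ (P.αbar - 1)

namespace IsAdmissible

variable (hP : P.IsAdmissible)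
include hP

theorem α_pos : 0 < P.α := by linarith [hP.half_le_α]

theorem one_sub_α_pos : 0 < 1 - P.α := by linarith [hP.α_lt_one]

theorem αbar_pos : 0 < P.αbar :=
  mul_pos (by linarith [hP.one_lt_ε]) hP.one_sub_α_pos

theorem αbar_le : P.αbar ≤ 1 - P.α := by
  have := hP.one_sub_α_pos
  have := hP.ε_le_two
  unfold αbar
  nlinarith

theorem αbar_le_half : P.αbar ≤ 1 / 2 := by linarith [hP.αbar_le, hP.half_le_α]

theorem d_pos : (0 : ℝ) < d := by exact_mod_cast hP.one_le_d

theorem one_le_d' : (1 : ℝ) ≤ d := by exact_mod_cast hP.one_le_d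

theorem two_le_K : 2 ≤ K := two_le_card_of_affineSpan hP.one_le_d hP.affineSpan_eq_top

theorem K_pos : (0 : ℝ) < K := by
  have := hP.two_le_K
  positivity

theorem βbar_pos : 0 < P.βbar := by
  refine lt_of_lt_of_le ?_ hP.βbar_large
  have := hP.one_sub_α_pos
  have := hP.d_pos
  have := hP.β₁_pos
  have : 0 < max (P.σ ^ (3 / P.ε)) P.σ := lt_max_of_lt_right hP.σ_pos
  positivity

theorem objective_sub (st : State K) {x y : Fin K → ℝ} (hxy : ∑ a, x a = ∑ a, y a) :
    P.objective st x - P.objective st y =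
      ∑ a, P.grad st y a * (x a - y a) + st.β * ∑ a, breg P.α (x a) (y a) +
        P.βbar * ∑ a, breg P.αbar (x a) (y a) := by
  have h1 := tsallis_sub hP.α_pos.ne' hxy
  have h2 := tsallis_sub hP.αbar_pos.ne' hxy
  have h3 : ∑ a, P.grad st y a * (x a - y a) = ∑ a, st.L a * x a - ∑ a, st.L a * y a +
      st.β * ∑ a, -(y a ^ (P.α - 1)) * (x a - y a) +
      P.βbar * ∑ a, -(y a ^ (P.αbar - 1)) * (x a - y a) := by
    rw [Finset.mul_sum, Finset.mul_sum, ← Finset.sum_sub_distrib, ← Finset.sum_add_distrib,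
      ← Finset.sum_add_distrib]
    exact Finset.sum_congr rfl fun a _ => by rw [grad]; ring
  rw [objective, objective, h3]
  linear_combination st.β * h1 + P.βbar * h2

theorem continuous_objective : Continuous fun x : ((Fin K → ℝ) × ℝ) × (Fin K → ℝ) =>
    P.objective ⟨x.1.1, x.1.2⟩ x.2 := by
  unfold objective
  have h1 := (continuous_tsallis (K := K) hP.α_pos).comp
    (continuous_snd (X := (Fin K → ℝ) × ℝ))
  have h2 := (continuous_tsallis (K := K) hP.αbar_pos).comp
    (continuous_snd (X := (Fin K → ℝ) × ℝ))
  simp only [Function.comp_def] at h1 h2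
  fun_prop

/-- Compactness of the simplex supplies a minimizer, so the choice in `Params.q` is not a junk
value. -/
theorem q_spec (st : State K) :
    P.q st ∈ stdSimplex ℝ (Fin K) ∧ IsMinOn (P.objective st) (stdSimplex ℝ (Fin K)) (P.q st) := by
  refine Classical.epsilon_spec (p := fun q =>
    q ∈ stdSimplex ℝ (Fin K) ∧ IsMinOn (P.objective st) (stdSimplex ℝ (Fin K)) q) ?_
  have : Nonempty (Fin K) := ⟨⟨0, by have := hP.two_le_K; omega⟩⟩
  have hc : Continuous (P.objective st) :=
    hP.continuous_objective.comp (continuous_const.prodMk continuous_id : Continuous fun x =>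
      (((st.L, st.β) : (Fin K → ℝ) × ℝ), x))
  exact (isCompact_stdSimplex ℝ (Fin K)).exists_isMinOn
    ⟨_, single_mem_stdSimplex ℝ (Classical.arbitrary (Fin K))⟩ hc.continuousOn

theorem q_nonneg (st : State K) (a : Fin K) : 0 ≤ P.q st a := (hP.q_spec st).1.1 a

theorem q_sum (st : State K) : ∑ a, P.q st a = 1 := (hP.q_spec st).1.2

theorem objective_q_le (st : State K) {x : Fin K → ℝ} (hx : x ∈ stdSimplex ℝ (Fin K)) :
    P.objective st (P.q st) ≤ P.objective st x := (hP.q_spec st).2 hx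

/-- Convexity compares the minimizer with a point on the segment towards u. The gradient is taken at
that interior point, because q could a priori have zero coordinates, where the gradient is singular.
-/
theorem variational {st : State K} (hβ : 0 < st.β) {u : Fin K → ℝ} (hu : ∀ a, 0 < u a)
    (hu1 : ∑ a, u a = 1) {t : ℝ} (h0 : 0 < t) (h1 : t ≤ 1) :
    0 ≤ ∑ a, P.grad st (fun a => (1 - t) * P.q st a + t * u a) a * (u a - P.q st a) := by
  set q := P.q st with hq
  set y : Fin K → ℝ := fun a => (1 - t) * q a + t * u a with hy
  have hypos : ∀ a, 0 < y a := fun a => by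
    have := hP.q_nonneg st a
    have : 0 ≤ 1 - t := by linarith
    have := hu a
    positivity
  have hys : ∑ a, y a = 1 := by
    simp only [hy, Finset.sum_add_distrib, ← Finset.mul_sum, hu1, hq, hP.q_sum]; ring
  have hle := hP.objective_q_le st (x := y) ⟨fun a => (hypos a).le, hys⟩
  have heq := hP.objective_sub st (x := q) (y := y) (by rw [hys, hP.q_sum])
  have hb1 : 0 ≤ ∑ a, breg P.α (q a) (y a) := Finset.sum_nonneg fun a _ =>
    breg_nonneg hP.α_pos hP.α_lt_one (hP.q_nonneg st a) (hypos a)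
  have hb2 : 0 ≤ ∑ a, breg P.αbar (q a) (y a) := Finset.sum_nonneg fun a _ =>
    breg_nonneg hP.αbar_pos (by linarith [hP.αbar_le_half]) (hP.q_nonneg st a) (hypos a)
  have e : ∑ a, P.grad st y a * (q a - y a) = -(t * ∑ a, P.grad st y a * (u a - q a)) := by
    rw [Finset.mul_sum, ← Finset.sum_neg_distrib]
    exact Finset.sum_congr rfl fun a _ => by simp only [hy]; ring
  have := mul_nonneg hβ.le hb1
  have := mul_nonneg hP.βbar_pos.le hb2
  by_contra! hc
  have : t * ∑ a, P.grad st y a * (u a - q a) < 0 := mul_neg_of_pos_of_neg h0 hc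
  linarith

/-- If coordinate a of q vanished, moving slightly towards the uniform distribution would gain an
arbitrarily large slope there, while the slopes of all coordinates are bounded above independently
of the step. -/
theorem q_pos {st : State K} (hβ : 0 < st.β) (a : Fin K) : 0 < P.q st a := by
  refine lt_of_le_of_ne (hP.q_nonneg st a) fun h0 => ?_
  set q := P.q st with hq
  have hK := hP.K_pos
  have hβ' := hP.βbar_pos
  set u : Fin K → ℝ := fun _ => (K : ℝ)⁻¹ with hu
  set M := st.β * (K : ℝ)⁻¹ ^ (P.α - 1) + P.βbar * (K : ℝ)⁻¹ ^ (P.αbar - 1) with hM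
  have hM0 : 0 ≤ M := by positivity
  set W := ∑ a, |st.L a * (u a - q a)| + ∑ a, M * q a with hW
  have hW0 : 0 ≤ W := add_nonneg (Finset.sum_nonneg fun _ _ => abs_nonneg _)
    (Finset.sum_nonneg fun b _ => mul_nonneg hM0 (hP.q_nonneg st b))
  -- N is chosen so that β N / K = β / K + W beats the bound W; t is then the step with t^(α-1) = N.
  set N := 1 + K * W / st.β with hN
  have hN1 : 1 ≤ N := by
    have : 0 ≤ K * W / st.β := by positivity
    linarith
  set t := N ^ (P.α - 1)⁻¹ with ht
  have hα : P.α - 1 < 0 := by linarith [hP.α_lt_one]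
  have ht0 : 0 < t := by positivity
  have ht1 : t ≤ 1 := Real.rpow_le_one_of_one_le_of_nonpos hN1 (inv_nonpos.mpr hα.le)
  have htN : t ^ (P.α - 1) = N := by
    rw [ht, ← Real.rpow_mul (by linarith), inv_mul_cancel₀ hα.ne, Real.rpow_one]
  have hv := hP.variational hβ (u := u) (fun _ => by positivity) (by simp [hu, hK.ne']) ht0 ht1
  rw [← hq] at hv
  set y : Fin K → ℝ := fun a => (1 - t) * q a + t * u a with hy
  have hypos : ∀ b, 0 < y b := fun b => by
    have := hP.q_nonneg st b
    have : 0 ≤ 1 - t := by linarith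
    positivity
  have hterm : ∀ b, P.grad st y b * (u b - q b) ≤
      |st.L b * (u b - q b)| + M * q b := by
    intro b
    have hL := le_abs_self (st.L b * (u b - q b))
    have hsplit : P.grad st y b * (u b - q b) = st.L b * (u b - q b) +
      (st.β * y b ^ (P.α - 1) + P.βbar * y b ^ (P.αbar - 1)) * (q b - u b) := by
      rw [grad]; ring
    have hq0 : 0 ≤ q b := hP.q_nonneg st b
    have hX : 0 ≤ st.β * y b ^ (P.α - 1) + P.βbar * y b ^ (P.αbar - 1) := by
      have := hypos b
      positivity
    have hu0 : 0 < u b := by positivity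
    rcases le_total (q b) (u b) with hle | hle
    · nlinarith [mul_nonneg hM0 hq0]
    · have hyu : u b ≤ y b := by simp only [hy]; nlinarith
      have h1 : y b ^ (P.α - 1) ≤ u b ^ (P.α - 1) :=
        Real.rpow_le_rpow_of_nonpos hu0 hyu hα.le
      have h2 : y b ^ (P.αbar - 1) ≤ u b ^ (P.αbar - 1) :=
        Real.rpow_le_rpow_of_nonpos hu0 hyu (by linarith [hP.αbar_le_half])
      have hXM : st.β * y b ^ (P.α - 1) + P.βbar * y b ^ (P.αbar - 1) ≤ M := by
        rw [hM]; gcongr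
      rw [hsplit]
      nlinarith
  have ha : P.grad st y a * (u a - q a) ≤ |st.L a * (u a - q a)| + M * q a - st.β * N / K := by
    have hqa : q a = 0 := h0.symm
    have hya : y a = t * (K : ℝ)⁻¹ := by simp only [hy, hqa, hu]; ring
    have h1 : N ≤ y a ^ (P.α - 1) := by
      rw [← htN]
      refine Real.rpow_le_rpow_of_nonpos (hypos a) ?_ hα.le
      rw [hya]
      refine mul_le_of_le_one_right ht0.le (inv_le_one_of_one_le₀ ?_)
      exact_mod_cast (by have := hP.two_le_K; omega : 1 ≤ K)
    have h2 : 0 ≤ P.βbar * y a ^ (P.αbar - 1) * (K : ℝ)⁻¹ := by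
      have := hypos a
      positivity
    have h3 : st.β * N * (K : ℝ)⁻¹ ≤ st.β * y a ^ (P.α - 1) * (K : ℝ)⁻¹ := by gcongr
    have hL := le_abs_self (st.L a * (u a - q a))
    have hsplit : P.grad st y a * (u a - q a) = st.L a * (u a - q a) -
        (st.β * y a ^ (P.α - 1) * (K : ℝ)⁻¹ + P.βbar * y a ^ (P.αbar - 1) * (K : ℝ)⁻¹) := by
      rw [grad, hqa]; ring
    rw [hsplit, hqa, div_eq_mul_inv]
    rw [hqa] at hL
    linarith
  have hsum : ∑ b, P.grad st y b * (u b - q b) ≤ W - st.β * N / K := by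
    rw [← Finset.add_sum_erase _ _ (Finset.mem_univ a)]
    have h1 := Finset.sum_le_sum fun b (_ : b ∈ Finset.univ.erase a) => hterm b
    have h2 : W = (|st.L a * (u a - q a)| + M * q a) +
        ∑ b ∈ Finset.univ.erase a, (|st.L b * (u b - q b)| + M * q b) := by
      rw [hW, ← Finset.sum_add_distrib]
      exact (Finset.add_sum_erase _ _ (Finset.mem_univ a)).symm
    linarith
  have hfin : st.β * N / K = st.β / K + W := by
    rw [hN]; field_simp
  have : 0 < st.β / K := by positivity
  linarith

/-- First-order optimality. -/
theorem grad_eq {st : State K} (hβ : 0 < st.β) (a b : Fin K) :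
    P.grad st (P.q st) a = P.grad st (P.q st) b := by
  have key : ∀ u : Fin K → ℝ, (∀ a, 0 < u a) → ∑ a, u a = 1 →
      0 ≤ ∑ a, P.grad st (P.q st) a * (u a - P.q st a) := by
    intro u hu hu1
    have hlim : Filter.Tendsto
        (fun t : ℝ => ∑ a, P.grad st (fun a => (1 - t) * P.q st a + t * u a) a * (u a - P.q st a))
        (nhdsWithin 0 (Set.Ioi 0)) (nhds (∑ a, P.grad st (P.q st) a * (u a - P.q st a))) := by
      refine tendsto_finsetSum _ fun a _ => Filter.Tendsto.mul_const _ ?_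
      have hc : ContinuousAt (fun t : ℝ =>
          P.grad st (fun a => (1 - t) * P.q st a + t * u a) a) 0 := by
        unfold grad
        have hl : ContinuousAt (fun t : ℝ => (1 - t) * P.q st a + t * u a) 0 := by fun_prop
        have hne : (1 - (0 : ℝ)) * P.q st a + 0 * u a ≠ 0 := by
          have := hP.q_pos hβ a
          rw [sub_zero, one_mul, zero_mul, add_zero]; exact this.ne'
        exact (continuousAt_const.sub (continuousAt_const.mul (hl.rpow_const (Or.inl hne)))).sub
          (continuousAt_const.mul (hl.rpow_const (Or.inl hne)))
      have := hc.tendsto.mono_left (nhdsWithin_le_nhds (s := Set.Ioi 0))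
      simpa using this
    refine ge_of_tendsto hlim ?_
    filter_upwards [Ioc_mem_nhdsGT (zero_lt_one' ℝ)] with t ht
    exact hP.variational hβ hu hu1 ht.1 ht.2
  have hle : ∀ a b, P.grad st (P.q st) b ≤ P.grad st (P.q st) a := by
    intro a b
    rcases eq_or_ne a b with rfl | hab
    · exact le_rfl
    -- Half the mass of b is moved to a; the point stays in the interior.
    set δ := P.q st b / 2 with hδ
    have hδ0 : 0 < δ := by have := hP.q_pos hβ b; positivity
    have h := key (fun c => P.q st c + (if c = a then δ else 0) - (if c = b then δ else 0)) ?_ ?_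
    · have e : ∀ c, P.grad st (P.q st) c *
          (P.q st c + (if c = a then δ else 0) - (if c = b then δ else 0) - P.q st c) =
          (if c = a then P.grad st (P.q st) c * δ else 0) -
            (if c = b then P.grad st (P.q st) c * δ else 0) := fun c => by
        split_ifs <;> ring
      simp only [e, Finset.sum_sub_distrib, Finset.sum_ite_eq', Finset.mem_univ, if_true] at h
      nlinarith
    · intro c
      have := hP.q_pos hβ c
      rcases eq_or_ne c b with rfl | hc
      · rw [if_neg hab.symm, if_pos rfl]; linarith
      · rw [if_neg hc]; split_ifs <;> linarith
    · simp [Finset.sum_add_distrib, Finset.sum_sub_distrib, hP.q_sum]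
  exact le_antisymm (hle b a) (hle a b)

/-- The gradient at the minimizer is constant over the arms, so the linear term vanishes on the
simplex and the gap is exactly a sum of divergences. This gives uniqueness and the curvature for the
regret analysis. -/
theorem objective_sub_q {st : State K} (hβ : 0 < st.β) {x : Fin K → ℝ} (hx : ∑ a, x a = 1) :
    P.objective st x = P.objective st (P.q st) + st.β * ∑ a, breg P.α (x a) (P.q st a) +
        P.βbar * ∑ a, breg P.αbar (x a) (P.q st a) := by
  have h := hP.objective_sub st (x := x) (y := P.q st) (by rw [hx, hP.q_sum])
  have h0 : ∑ a, P.grad st (P.q st) a * (x a - P.q st a) = 0 := by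
    let b : Fin K := ⟨0, by have := hP.two_le_K; omega⟩
    have : ∀ a, P.grad st (P.q st) a = P.grad st (P.q st) b := fun a => hP.grad_eq hβ a b
    simp only [this, ← Finset.mul_sum, Finset.sum_sub_distrib, hx, hP.q_sum, sub_self, mul_zero]
  linarith

theorem q_unique {st : State K} (hβ : 0 < st.β) {x : Fin K → ℝ} (hx : x ∈ stdSimplex ℝ (Fin K))
    (hmin : ∀ y ∈ stdSimplex ℝ (Fin K), P.objective st x ≤ P.objective st y) : x = P.q st := by
  have h := hP.objective_sub_q hβ hx.2
  have h1 := hmin _ (hP.q_spec st).1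
  have hb1 : ∀ a, 0 ≤ breg P.α (x a) (P.q st a) := fun a =>
    breg_nonneg hP.α_pos hP.α_lt_one (hx.1 a) (hP.q_pos hβ a)
  have hb2 : 0 ≤ ∑ a, breg P.αbar (x a) (P.q st a) := Finset.sum_nonneg fun a _ =>
    breg_nonneg hP.αbar_pos (by linarith [hP.αbar_le_half]) (hx.1 a) (hP.q_pos hβ a)
  have h2 := mul_nonneg hP.βbar_pos.le hb2
  have h3 := Finset.sum_nonneg fun a (_ : a ∈ Finset.univ) => hb1 a
  have h4 : ∑ a, breg P.α (x a) (P.q st a) = 0 := by nlinarith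
  rw [Finset.sum_eq_zero_iff_of_nonneg fun a _ => hb1 a] at h4
  ext a
  by_contra hne
  exact (breg_pos hP.α_pos hP.α_lt_one (hx.1 a) (hP.q_pos hβ a) hne).ne' (h4 a (Finset.mem_univ a))

/-- A cluster point of minimizers is a minimizer, and the minimizer is unique. The maximum with β₁
makes the statement global while keeping β positive. -/
theorem continuous_q : Continuous fun x : (Fin K → ℝ) × ℝ => P.q ⟨x.1, max x.2 P.β₁⟩ := by
  rw [continuous_iff_continuousAt]
  intro a
  refine (isCompact_stdSimplex ℝ (Fin K)).tendsto_nhds_of_unique_mapClusterPt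
    (Filter.Eventually.of_forall fun x => (hP.q_spec _).1) fun y hy hcl => ?_
  rw [mapClusterPt_iff_ultrafilter] at hcl
  obtain ⟨U, hU, hUy⟩ := hcl
  refine hP.q_unique (lt_max_of_lt_right hP.β₁_pos) hy fun z hz => ?_
  have hst : Filter.Tendsto (fun x : (Fin K → ℝ) × ℝ => (x.1, max x.2 P.β₁)) U
      (nhds (a.1, max a.2 P.β₁)) := by
    have : Continuous fun x : (Fin K → ℝ) × ℝ => (x.1, max x.2 P.β₁) := by fun_prop
    exact (this.tendsto a).mono_left hU
  have h1 := (hP.continuous_objective.tendsto ((a.1, max a.2 P.β₁), y)).comp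
    (hst.prodMk_nhds hUy)
  have h2 := (hP.continuous_objective.tendsto ((a.1, max a.2 P.β₁), z)).comp
    (hst.prodMk_nhds (tendsto_const_nhds (x := z)))
  exact le_of_tendsto_of_tendsto' h1 h2 fun x => hP.objective_q_le _ hz

end IsAdmissible

end Params

/-! ### Stability of the Tsallis regularizer. -/

section Stability

theorem sub_two_mul_sq_le_log {m : ℝ} (hm : -(1 / 2) ≤ m) : m - 2 * m ^ 2 ≤ Real.log (1 + m) := by
  have h0 : 0 < 1 + m := by linarith
  refine le_trans ?_ (Real.one_sub_inv_le_log_of_pos h0)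
  have : 1 - (1 + m)⁻¹ - (m - 2 * m ^ 2) = m ^ 2 * (1 + 2 * m) / (1 + m) := by
    field_simp; ring
  have h2 : 0 ≤ m ^ 2 * (1 + 2 * m) / (1 + m) := by
    have : 0 ≤ 1 + 2 * m := by linarith
    positivity
  linarith

/-- Young's inequality applied to u^α = ((1+m)u)^α ((1+m)^(-r))^(1-α), with r = α/(1-α), computes
the convex conjugate exactly; expanding (1+m)^(-r) to second order gives the quadratic bound. The
restriction on m keeps r m bounded even as α → 1. -/
theorem stability_unit {α u m : ℝ} (hα : 1 / 2 ≤ α) (h1 : α < 1) (hu : 0 ≤ u)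
    (hm : |m| ≤ (1 - α) / 2) :
    m * (1 - u) - breg α u 1 ≤ 9 / 4 * m ^ 2 / (1 - α) := by
  have h0 : 0 < α := by linarith
  have ha : 0 < 1 - α := by linarith
  obtain ⟨hm1, hm2⟩ := abs_le.mp hm
  have hv : 0 < 1 + m := by linarith
  set r := α / (1 - α) with hr
  have hr0 : 0 < r := by positivity
  have hrm : |r * m| ≤ α / 2 := by
    rw [abs_mul, abs_of_pos hr0]
    calc r * |m| ≤ r * ((1 - α) / 2) := by gcongr
      _ = α / 2 := by rw [hr]; field_simp
  have hyoung : u ^ α ≤ α * ((1 + m) * u) + (1 - α) * (1 + m) ^ (-r) := by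
    have h := Real.geom_mean_le_arith_mean2_weighted h0.le ha.le
      (mul_nonneg hv.le hu) (Real.rpow_nonneg hv.le (-r)) (by ring)
    rwa [Real.mul_rpow hv.le hu, ← Real.rpow_mul hv.le,
      show -r * (1 - α) = -α by rw [hr]; field_simp, mul_right_comm, ← Real.rpow_add hv,
      add_neg_cancel, Real.rpow_zero, one_mul] at h
  have hexp : (1 + m) ^ (-r) ≤ 1 + (-(r * m) + 2 * r * m ^ 2) + 9 / 4 * (r * m) ^ 2 := by
    rw [Real.rpow_def_of_pos hv]
    have hl := sub_two_mul_sq_le_log (m := m) (by linarith)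
    set y := -(r * m) + 2 * r * m ^ 2 with hy
    have h2 : Real.log (1 + m) * -r ≤ y := by rw [hy]; nlinarith
    have hyabs : |y| ≤ 3 / 2 * |r * m| := by
      have : y = r * m * (-1 + 2 * m) := by rw [hy]; ring
      rw [this, abs_mul, mul_comm]
      refine mul_le_mul_of_nonneg_right ?_ (abs_nonneg _)
      rw [abs_le]; constructor <;> linarith
    have h3 := (abs_le.mp (Real.abs_exp_sub_one_sub_id_le (x := y) (by linarith))).2
    have h4 : y ^ 2 ≤ 9 / 4 * (r * m) ^ 2 := by
      have := sq_le_sq' (by linarith [abs_nonneg y, abs_nonneg (r * m)]) hyabs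
      rw [sq_abs, mul_pow, sq_abs] at this
      linarith
    have := Real.exp_le_exp.mpr h2
    linarith
  have hb : breg α u 1 = (1 - u ^ α) / α + (u - 1) := by simp [breg]
  have hmain : u ^ α / α ≤ (1 + m) * u + (1 / r) * (1 + m) ^ (-r) := by
    rw [div_le_iff₀ h0]
    have : (1 / r) * α = 1 - α := by rw [hr]; field_simp
    calc u ^ α ≤ _ := hyoung
      _ = ((1 + m) * u) * α + (1 / r * α) * (1 + m) ^ (-r) := by rw [this]; ring
      _ = _ := by ring
  have h5 : (1 / r) * (1 + m) ^ (-r) ≤ 1 / r - m + 2 * m ^ 2 + 9 / 4 * r * m ^ 2 := by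
    calc (1 / r) * (1 + m) ^ (-r) ≤
        (1 / r) * (1 + (-(r * m) + 2 * r * m ^ 2) + 9 / 4 * (r * m) ^ 2) := by gcongr
      _ = _ := by field_simp; ring
  have h6 : 1 / r = 1 / α - 1 := by rw [hr]; field_simp
  have h7 : 2 * m ^ 2 + 9 / 4 * r * m ^ 2 ≤ 9 / 4 * m ^ 2 / (1 - α) := by
    rw [le_div_iff₀ ha]
    have : r * (1 - α) = α := by rw [hr]; field_simp
    have h8 : (2 * m ^ 2 + 9 / 4 * r * m ^ 2) * (1 - α) =
      2 * m ^ 2 * (1 - α) + 9 / 4 * m ^ 2 * (r * (1 - α)) := by ring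
    rw [h8, this]
    nlinarith [sq_nonneg m]
  rw [hb, sub_div]
  nlinarith

theorem breg_eq_rpow_mul {r x y : ℝ} (hx : 0 ≤ x) (hy : 0 < y) :
    breg r x y = y ^ r * breg r (x / y) 1 := by
  have h1 : y ^ (r - 1) = y ^ r / y := Real.rpow_sub_one hy.ne' r
  have h3 : y ^ r ≠ 0 := (Real.rpow_pos_of_pos hy r).ne'
  rw [breg, breg, h1, Real.div_rpow hx hy.le, Real.one_rpow, Real.one_rpow]
  field_simp

/-- The stability of one coordinate. -/
theorem stability_coord {α β x y l : ℝ} (h0 : 1 / 2 ≤ α) (h1 : α < 1) (hβ : 0 < β) (hx : 0 ≤ x)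
    (hy : 0 < y) (hl : |l| ≤ (1 - α) * β * y ^ (α - 1) / 2) :
    l * (y - x) - β * breg α x y ≤ 9 / 4 * (y ^ (2 - α) * l ^ 2) / (β * (1 - α)) := by
  have hya : 0 < y ^ α := Real.rpow_pos_of_pos hy _
  have e1 : y ^ (α - 1) = y ^ α / y := Real.rpow_sub_one hy.ne' _
  have e2 : y ^ (2 - α) = y ^ 2 / y ^ α := by rw [Real.rpow_sub hy, Real.rpow_two]
  have ha : 0 < 1 - α := by linarith
  -- Homogeneity of the divergence rescales the problem to y = 1.
  set m := l * y / (β * y ^ α) with hm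
  have hmb : |m| ≤ (1 - α) / 2 := by
    rw [hm, abs_div, abs_mul, abs_of_pos hy, abs_of_pos (mul_pos hβ hya),
      div_le_iff₀ (mul_pos hβ hya)]
    rw [e1] at hl
    calc |l| * y ≤ (1 - α) * β * (y ^ α / y) / 2 * y := by gcongr
      _ = _ := by field_simp
  have h := stability_unit h0 h1 (div_nonneg hx hy.le) hmb
  have h2 := mul_le_mul_of_nonneg_left h (mul_pos hβ hya).le
  rw [breg_eq_rpow_mul hx hy, e2]
  have e3 : β * y ^ α * (m * (1 - x / y) - breg α (x / y) 1) =
      l * (y - x) - β * (y ^ α * breg α (x / y) 1) := by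
    rw [hm]; field_simp
  have e4 : β * y ^ α * (9 / 4 * m ^ 2 / (1 - α)) =
      9 / 4 * (y ^ 2 / y ^ α * l ^ 2) / (β * (1 - α)) := by
    rw [hm]; field_simp
  linarith

theorem le_one_sub_of_ne {K : ℕ} {q : Fin K → ℝ} (hq : ∀ a, 0 ≤ q a) (hq1 : ∑ a, q a = 1)
    {a b : Fin K} (hab : a ≠ b) : q a ≤ 1 - q b := by
  rw [← hq1, ← Finset.add_sum_erase _ _ (Finset.mem_univ b), add_sub_cancel_left]
  exact Finset.single_le_sum (fun c _ => hq c) (Finset.mem_erase.mpr ⟨hab, Finset.mem_univ a⟩)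

theorem le_qStar {K : ℕ} {q : Fin K → ℝ} (hq : ∀ a, 0 ≤ q a) (hq1 : ∑ a, q a = 1)
    {a a₀ : Fin K} (h : ‖q‖ = q a₀) (hmax : ∀ a, q a ≤ q a₀) (ha : a ≠ a₀) :
    q a ≤ qStar q := by
  rw [qStar, h]
  exact le_min (hmax a) (le_one_sub_of_ne hq hq1 ha)

theorem qStar_pos {K : ℕ} {q : Fin K → ℝ} (hK : 2 ≤ K) (hq : ∀ a, 0 < q a)
    (hq1 : ∑ a, q a = 1) : 0 < qStar q := by
  obtain ⟨a₀, hn, hmax⟩ := exists_norm_eq (by omega) fun a => (hq a).le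
  have : Nontrivial (Fin K) := Fin.nontrivial_iff_two_le.mpr hK
  obtain ⟨b, hb⟩ := exists_ne a₀
  exact (hq b).trans_le (le_qStar (fun a => (hq a).le) hq1 hn hmax hb)

theorem qStar_le_half {K : ℕ} (q : Fin K → ℝ) : qStar q ≤ 1 / 2 := by
  rw [qStar]
  rcases le_total ‖q‖ (1 / 2) with h | h
  · exact (min_le_left _ _).trans h
  · exact (min_le_right _ _).trans (by linarith)

/-- The stability term of follow-the-regularized-leader with the Tsallis entropy. -/
theorem stability_sum {K : ℕ} (hK : 2 ≤ K) {α β : ℝ} (h0 : 1 / 2 ≤ α) (h1 : α < 1) (hβ : 0 < β)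
    {q x g : Fin K → ℝ} (hq : ∀ a, 0 < q a) (hq1 : ∑ a, q a = 1) (hx : ∀ a, 0 ≤ x a)
    (hx1 : ∑ a, x a = 1) (hg : ∀ a, |g a| ≤ (1 - α) * β * qStar q ^ (α - 1) / 4) :
    ∑ a, g a * (q a - x a) - β * ∑ a, breg α (x a) (q a) ≤
      9 / 2 * qStar q ^ (1 - α) / (β * (1 - α)) * ∑ a, q a * g a ^ 2 := by
  have hqn : ∀ a, 0 ≤ q a := fun a => (hq a).le
  obtain ⟨a₀, hn, hmax⟩ := exists_norm_eq (by omega) hqn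
  have hs := qStar_pos hK hq hq1
  set S := qStar q with hS
  have ha : 0 < 1 - α := by linarith
  have hSp : 0 < S ^ (α - 1) := Real.rpow_pos_of_pos hs _
  have hc : 0 < (1 - α) * β := by positivity
  have hpow : ∀ a, q a ≤ S → S ^ (α - 1) ≤ q a ^ (α - 1) := fun a h =>
    Real.rpow_le_rpow_of_nonpos (hq a) h (by linarith)
  have hpow2 : ∀ a, q a ≤ S → ∀ l : ℝ, 9 / 4 * (q a ^ (2 - α) * l ^ 2) / (β * (1 - α)) ≤
      9 / 4 * S ^ (1 - α) / (β * (1 - α)) * (q a * l ^ 2) := fun a h l => by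
    have e : q a ^ (2 - α) = q a ^ (1 - α) * q a := by
      rw [← Real.rpow_add_one (hq a).ne']; congr 1; ring
    have h2 : q a ^ (1 - α) ≤ S ^ (1 - α) := Real.rpow_le_rpow (hqn a) h ha.le
    have h3 : q a ^ (2 - α) * l ^ 2 ≤ S ^ (1 - α) * (q a * l ^ 2) := by
      rw [e, mul_assoc]
      exact mul_le_mul_of_nonneg_right h2 (mul_nonneg (hqn a) (sq_nonneg l))
    calc 9 / 4 * (q a ^ (2 - α) * l ^ 2) / (β * (1 - α)) ≤
        9 / 4 * (S ^ (1 - α) * (q a * l ^ 2)) / (β * (1 - α)) := by gcongr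
      _ = _ := by ring
  have hcst : 0 ≤ 9 / 4 * S ^ (1 - α) / (β * (1 - α)) := by positivity
  have e9 : 9 / 2 * S ^ (1 - α) / (β * (1 - α)) = 2 * (9 / 4 * S ^ (1 - α) / (β * (1 - α))) := by
    ring
  rw [e9]
  set c := 9 / 4 * S ^ (1 - α) / (β * (1 - α)) with hcdef
  by_cases hhalf : q a₀ ≤ 1 / 2
  · have hall : ∀ a, q a ≤ S := fun a => by
      refine (hmax a).trans ?_
      rw [hS, qStar, hn]
      exact le_min le_rfl (by linarith)
    rw [Finset.mul_sum, ← Finset.sum_sub_distrib, Finset.mul_sum]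
    refine Finset.sum_le_sum fun a _ => ?_
    have h := stability_coord h0 h1 hβ (hx a) (hq a) (l := g a) ?_
    · have h2 := hpow2 a (hall a) (g a)
      have : 0 ≤ c * (q a * g a ^ 2) := mul_nonneg hcst (mul_nonneg (hqn a) (sq_nonneg _))
      linarith
    · refine (hg a).trans ?_
      have := mul_le_mul_of_nonneg_left (hpow a (hall a)) hc.le
      have : 0 ≤ (1 - α) * β * S ^ (α - 1) := by positivity
      linarith
  · push Not at hhalf
    -- A constant shift does not change the pairing with q - x. After subtracting g a₀, the heavy
    -- coordinate contributes nothing positive and all the others satisfy q a ≤ q_*; the denominator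
    -- 4 in the hypothesis leaves room for the difference.
    set g' := fun a => g a - g a₀ with hg'
    have hsh : ∑ a, g a * (q a - x a) = ∑ a, g' a * (q a - x a) := by
      simp only [hg', sub_mul, Finset.sum_sub_distrib, ← Finset.mul_sum, hq1, hx1, sub_self,
        mul_zero, sub_zero]
    have hterm : ∀ a, g' a * (q a - x a) - β * breg α (x a) (q a) ≤
        if a = a₀ then 0 else c * (q a * (2 * g a ^ 2 + 2 * g a₀ ^ 2)) := by
      intro a
      split_ifs with haa
      · have := mul_nonneg hβ.le (breg_nonneg (by linarith) h1 (hx a) (hq a))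
        simp only [hg', haa, sub_self, zero_mul, zero_sub] at *
        linarith
      · have hle : q a ≤ S := le_qStar hqn hq1 hn hmax haa
        refine (stability_coord h0 h1 hβ (hx a) (hq a) (l := g' a) ?_).trans
          ((hpow2 a hle (g' a)).trans ?_)
        · have t1 := abs_sub (g a) (g a₀)
          have t2 := hg a
          have t3 := hg a₀
          have := mul_le_mul_of_nonneg_left (hpow a hle) hc.le
          simp only [hg']
          linarith
        · refine mul_le_mul_of_nonneg_left (mul_le_mul_of_nonneg_left ?_ (hqn a)) hcst
          simp only [hg']
          nlinarith [sq_nonneg (g a + g a₀)]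
    rw [hsh, Finset.mul_sum, ← Finset.sum_sub_distrib]
    refine (Finset.sum_le_sum fun a _ => hterm a).trans ?_
    have hsp : ∀ f : Fin K → ℝ, ∑ a, f a = f a₀ + ∑ a ∈ Finset.univ.erase a₀, f a := fun f =>
      (Finset.add_sum_erase _ _ (Finset.mem_univ a₀)).symm
    rw [hsp, if_pos rfl, zero_add, Finset.sum_congr rfl fun a ha =>
      if_neg (Finset.ne_of_mem_erase ha), ← Finset.mul_sum, mul_right_comm, mul_comm _ c]
    refine mul_le_mul_of_nonneg_left ?_ hcst
    have hq2 := hsp q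
    rw [hsp fun a => q a * g a ^ 2]
    have e : ∑ a ∈ Finset.univ.erase a₀, q a * (2 * g a ^ 2 + 2 * g a₀ ^ 2) =
        2 * ∑ a ∈ Finset.univ.erase a₀, q a * g a ^ 2 +
          2 * g a₀ ^ 2 * ∑ a ∈ Finset.univ.erase a₀, q a := by
      rw [Finset.mul_sum, Finset.mul_sum, ← Finset.sum_add_distrib]
      exact Finset.sum_congr rfl fun a _ => by ring
    rw [e]
    -- The shift costs 2 g(a₀)² (1 - q a₀), which is covered by the heavy arm's own term since q a₀
    -- > 1/2.
    nlinarith [sq_nonneg (g a₀)]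

end Stability

/-! ### Growth and lower bounds of the entropy. -/

section Entropy

/-- One coordinate of the negative Tsallis regularizer. -/
noncomputable def ent (r x : ℝ) : ℝ := (x ^ r - x) / r

theorem neg_tsallis {K : ℕ} (r : ℝ) (q : Fin K → ℝ) : -tsallis r q = ∑ a, ent r (q a) := by
  simp only [tsallis, ent, Finset.mul_sum, ← Finset.sum_neg_distrib]
  exact Finset.sum_congr rfl fun a _ => by ring

variable {r : ℝ}

theorem ent_nonneg (h0 : 0 < r) (h1 : r < 1) {x : ℝ} (hx : 0 ≤ x) (hx1 : x ≤ 1) :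
    0 ≤ ent r x := by
  refine div_nonneg (sub_nonneg.mpr ?_) h0.le
  rcases hx.eq_or_lt with rfl | hx
  · rw [Real.zero_rpow h0.ne']
  · simpa using Real.rpow_le_rpow_of_exponent_ge hx hx1 h1.le

theorem concaveOn_ent (h0 : 0 < r) (h1 : r < 1) : ConcaveOn ℝ (Set.Ici 0) (ent r) := by
  have h := ((Real.concaveOn_rpow h0.le h1.le).sub (convexOn_id (convex_Ici 0))).smul
    (inv_nonneg.mpr h0.le)
  have e : ent r = fun x => r⁻¹ • (x ^ r - x) := by
    ext x
    rw [ent, div_eq_inv_mul, smul_eq_mul]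
  rw [e]
  exact h

/-- The function is concave and vanishes at 0 and 1. If y ≤ x, then x lies between y and 1, and x ≤
1/2 costs a factor 2; if y ≥ x, then x lies between 0 and y, which costs y/x ≤ C. -/
theorem ent_le_mul_ent (h0 : 0 < r) (h1 : r < 1) {x y C : ℝ} (hC : 2 ≤ C) (hx : 0 < x)
    (hx2 : x ≤ 1 / 2) (hy : 0 ≤ y) (hy1 : y ≤ 1) (hyx : y ≤ C * x) : ent r y ≤ C * ent r x := by
  have hc := (concaveOn_ent h0 h1).2
  have hE := ent_nonneg h0 h1 hy hy1
  rcases le_total y x with h | h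
  · have h1y : 0 < 1 - y := by linarith
    have := hc (Set.mem_Ici.mpr hy) (Set.mem_Ici.mpr zero_le_one)
      (show 0 ≤ (1 - x) / (1 - y) from div_nonneg (by linarith) h1y.le)
      (show 0 ≤ (x - y) / (1 - y) from div_nonneg (by linarith) h1y.le) (by field_simp; ring)
    have e1 : ent r 1 = 0 := by simp [ent]
    have e2 : ((1 - x) / (1 - y)) • y + ((x - y) / (1 - y)) • (1 : ℝ) = x := by
      simp only [smul_eq_mul]; field_simp; ring
    rw [e1, e2, smul_zero, add_zero, smul_eq_mul] at this
    have h2 : 1 / 2 ≤ (1 - x) / (1 - y) := by rw [le_div_iff₀ h1y]; linarith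
    have h3 : ent r y ≤ 2 * ent r x := by nlinarith
    have h4 : 0 ≤ ent r x := by linarith
    nlinarith
  · have hy0 : 0 < y := by linarith
    have := hc (Set.mem_Ici.mpr hy) (Set.mem_Ici.mpr le_rfl)
      (show 0 ≤ x / y by positivity)
      (show 0 ≤ 1 - x / y by rw [sub_nonneg, div_le_one hy0]; exact h) (by ring)
    have e1 : ent r 0 = 0 := by simp [ent, Real.zero_rpow h0.ne']
    have e2 : (x / y) • y + (1 - x / y) • (0 : ℝ) = x := by
      simp only [smul_eq_mul]; field_simp; ring
    rw [e1, e2, smul_zero, add_zero, smul_eq_mul, div_mul_eq_mul_div, div_le_iff₀ hy0] at this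
    have h2 : 0 ≤ ent r x := ent_nonneg h0 h1 hx.le (by linarith)
    nlinarith

theorem ent_le_one_sub (h0 : 0 < r) (h1 : r < 1) {z : ℝ} (hz : 0 ≤ z) :
    ent r z ≤ (1 - r) / r * (1 - z) := by
  have h := rpow_one_add_le_one_add_mul_self (s := z - 1) (by linarith) h0.le h1.le
  rw [add_sub_cancel] at h
  rw [ent, div_mul_eq_mul_div]
  gcongr
  linarith

theorem half_rpow_le {u : ℝ} (h0 : 0 ≤ u) (h1 : u ≤ 1) : (1 / 2 : ℝ) ^ u ≤ 1 - u / 2 := by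
  have h := rpow_one_add_le_one_add_mul_self (s := -(1 / 2)) (by norm_num) h0 h1
  norm_num at h ⊢
  linarith

theorem rpow_le_ent (h0 : 0 < r) (h1 : r < 1) {x : ℝ} (hx : 0 < x) (hx2 : x ≤ 1 / 2) :
    (1 - r) / (2 * r) * x ^ r ≤ ent r x := by
  have h2 : x ^ (1 - r) ≤ 1 - (1 - r) / 2 :=
    (Real.rpow_le_rpow hx.le hx2 (by linarith)).trans (half_rpow_le (by linarith) (by linarith))
  have h3 : x = x ^ r * x ^ (1 - r) := by rw [← Real.rpow_add hx]; simp
  have h4 := Real.rpow_pos_of_pos hx r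
  have h5 : (1 - r) / 2 * x ^ r ≤ x ^ r - x := by
    nth_rewrite 3 [h3]; nlinarith
  have e : (1 - r) / (2 * r) * x ^ r = ((1 - r) / 2 * x ^ r) / r := by field_simp
  rw [e, ent]
  gcongr

theorem mul_le_ent (h0 : 0 < r) (h1 : r < 1) {x : ℝ} (hx : 0 < x) (hx2 : x ≤ 1 / 2) :
    (1 - r) / (2 * r) * x ≤ ent r x := by
  refine le_trans (mul_le_mul_of_nonneg_left ?_ ?_) (rpow_le_ent h0 h1 hx hx2)
  · simpa using Real.rpow_le_rpow_of_exponent_ge hx (by linarith) h1.le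
  · exact div_nonneg (by linarith) (by linarith)

/-- Subadditivity of x ↦ x^r for r < 1. -/
theorem sum_rpow_ge {ι : Type*} (s : Finset ι) {x : ι → ℝ} (hx : ∀ i, 0 ≤ x i) (h0 : 0 < r)
    (h1 : r < 1) : (∑ i ∈ s, x i) ^ r ≤ ∑ i ∈ s, x i ^ r := by
  set m := ∑ i ∈ s, x i with hm
  have hm0 : 0 ≤ m := Finset.sum_nonneg fun i _ => hx i
  rcases hm0.eq_or_lt with h | h
  · rw [← h, Real.zero_rpow h0.ne']
    exact Finset.sum_nonneg fun i _ => Real.rpow_nonneg (hx i) _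
  · have e : m ^ r = ∑ i ∈ s, m ^ r * (x i / m) := by
      rw [← Finset.mul_sum, ← Finset.sum_div, ← hm, div_self h.ne', mul_one]
    rw [e]
    refine Finset.sum_le_sum fun i hi => ?_
    have hi1 : x i / m ≤ 1 := by
      rw [div_le_one h]; exact Finset.single_le_sum (fun i _ => hx i) hi
    have hi0 : 0 ≤ x i / m := div_nonneg (hx i) h.le
    have h2 : x i / m ≤ (x i / m) ^ r := by
      rcases hi0.eq_or_lt with h' | h'
      · rw [← h', Real.zero_rpow h0.ne']
      · simpa using Real.rpow_le_rpow_of_exponent_ge h' hi1 h1.le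
    calc m ^ r * (x i / m) ≤ m ^ r * (x i / m) ^ r := by gcongr
      _ = x i ^ r := by rw [← Real.mul_rpow h.le hi0, mul_div_cancel₀ _ h.ne']

variable {K : ℕ}

theorem le_half_of_ne {q : Fin K → ℝ} (hq : ∀ a, 0 ≤ q a) (hq1 : ∑ a, q a = 1) {a a₀ : Fin K}
    (hmax : ∀ a, q a ≤ q a₀) (ha : a ≠ a₀) : q a ≤ 1 / 2 := by
  have := hmax a
  have := le_one_sub_of_ne hq hq1 ha
  linarith

/-- Every arm but the heaviest has mass at most 1/2, where the entropy is comparable to q^r.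
Subadditivity then recombines these arms into (1 - ‖q‖)^r ≥ q_*^r. -/
theorem entropy_ge (h0 : 0 < r) (h1 : r < 1) (hK : 0 < K) {q : Fin K → ℝ} (hq : ∀ a, 0 < q a)
    (hq1 : ∑ a, q a = 1) : (1 - r) / (2 * r) * qStar q ^ r ≤ -tsallis r q := by
  have hqn : ∀ a, 0 ≤ q a := fun a => (hq a).le
  obtain ⟨a₀, hn, hmax⟩ := exists_norm_eq hK hqn
  have hle1 : ∀ a, q a ≤ 1 := fun a => by
    rw [← hq1]; exact Finset.single_le_sum (fun c _ => hqn c) (Finset.mem_univ a)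
  have hm : ∑ a ∈ Finset.univ.erase a₀, q a = 1 - q a₀ := by
    rw [← hq1, ← Finset.add_sum_erase _ _ (Finset.mem_univ a₀)]; ring
  have hc : 0 ≤ (1 - r) / (2 * r) := div_nonneg (by linarith) (by linarith)
  rw [neg_tsallis, ← Finset.add_sum_erase _ _ (Finset.mem_univ a₀)]
  have hS : qStar q ≤ 1 - q a₀ := by rw [qStar, hn]; exact min_le_right _ _
  have hS0 : 0 ≤ qStar q := by
    rw [qStar, hn]; exact le_min (hqn _) (by linarith [hle1 a₀])
  calc (1 - r) / (2 * r) * qStar q ^ r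
      ≤ (1 - r) / (2 * r) * (∑ a ∈ Finset.univ.erase a₀, q a) ^ r := by
        rw [hm]; gcongr
    _ ≤ (1 - r) / (2 * r) * ∑ a ∈ Finset.univ.erase a₀, q a ^ r := by
        gcongr; exact sum_rpow_ge _ hqn h0 h1
    _ ≤ ∑ a ∈ Finset.univ.erase a₀, ent r (q a) := by
        rw [Finset.mul_sum]
        exact Finset.sum_le_sum fun a ha => rpow_le_ent h0 h1 (hq a)
          (le_half_of_ne hqn hq1 hmax (Finset.ne_of_mem_erase ha))
    _ ≤ _ := le_add_of_nonneg_left (ent_nonneg h0 h1 (hqn _) (hle1 _))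

/-- The heaviest arm needs no hypothesis, because its new entropy is at most a multiple of its
missing mass 1 - x a₀, which is the mass of the other arms. -/
theorem entropy_growth (h0 : 0 < r) (h1 : r < 1) {q x : Fin K → ℝ} (hq : ∀ a, 0 < q a)
    (hq1 : ∑ a, q a = 1) (hx : ∀ a, 0 ≤ x a) (hx1 : ∑ a, x a = 1) {a₀ : Fin K}
    (hmax : ∀ a, q a ≤ q a₀) {C : ℝ} (hC : 2 ≤ C) (h : ∀ a, a ≠ a₀ → x a ≤ C * q a) :
    -tsallis r x ≤ 3 * C * -tsallis r q := by
  have hqn : ∀ a, 0 ≤ q a := fun a => (hq a).le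
  have hle1 : ∀ {y : Fin K → ℝ}, (∀ a, 0 ≤ y a) → ∑ a, y a = 1 → ∀ a, y a ≤ 1 := by
    intro y hy hy1 a
    rw [← hy1]; exact Finset.single_le_sum (fun c _ => hy c) (Finset.mem_univ a)
  have hm : ∑ a ∈ Finset.univ.erase a₀, x a = 1 - x a₀ := by
    rw [← hx1, ← Finset.add_sum_erase _ _ (Finset.mem_univ a₀)]; ring
  have hc : 0 ≤ (1 - r) / r := div_nonneg (by linarith) (by linarith)
  have hhalf : ∀ a ∈ Finset.univ.erase a₀, q a ≤ 1 / 2 := fun a ha =>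
    le_half_of_ne hqn hq1 hmax (Finset.ne_of_mem_erase ha)
  rw [neg_tsallis, neg_tsallis, ← Finset.add_sum_erase _ _ (Finset.mem_univ a₀),
    ← Finset.add_sum_erase _ (fun a => ent r (q a)) (Finset.mem_univ a₀)]
  have hA : ∑ a ∈ Finset.univ.erase a₀, ent r (x a) ≤
      C * ∑ a ∈ Finset.univ.erase a₀, ent r (q a) := by
    rw [Finset.mul_sum]
    exact Finset.sum_le_sum fun a ha => ent_le_mul_ent h0 h1 hC (hq a) (hhalf a ha) (hx a)
      (hle1 hx hx1 a) (h a (Finset.ne_of_mem_erase ha))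
  have hB : ent r (x a₀) ≤ 2 * C * ∑ a ∈ Finset.univ.erase a₀, ent r (q a) := by
    refine (ent_le_one_sub h0 h1 (hx a₀)).trans ?_
    rw [← hm, Finset.mul_sum, Finset.mul_sum]
    refine Finset.sum_le_sum fun a ha => ?_
    have h2 := mul_le_ent h0 h1 (hq a) (hhalf a ha)
    have e : (1 - r) / r = 2 * ((1 - r) / (2 * r)) := by field_simp
    calc (1 - r) / r * x a ≤ (1 - r) / r * (C * q a) := by
          gcongr; exact h a (Finset.ne_of_mem_erase ha)
      _ = 2 * C * ((1 - r) / (2 * r) * q a) := by rw [e]; ring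
      _ ≤ _ := by gcongr
  have hC' : 0 ≤ 3 * C * ent r (q a₀) :=
    mul_nonneg (by linarith) (ent_nonneg h0 h1 (hqn _) (hle1 hqn hq1 _))
  linarith

end Entropy

/-! ### Stability of the entropy across one update. -/

namespace Params.IsAdmissible

variable {K d : ℕ} {P : Params K d} (hP : P.IsAdmissible)
include hP

/-- The entropy of the iterates grows by at most a constant factor. -/
theorem h_le_of_step {st st' : State K} (hβ : 0 < st.β) (hβ' : st.β ≤ st'.β)
    (hδ : st'.β - st.β ≤ 1 / 16 * P.βbar * qStar (P.q st) ^ (P.αbar - P.α))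
    (hg : ∀ a, |st'.L a - st.L a| ≤ (1 - P.α) * st.β * qStar (P.q st) ^ (P.α - 1) / 4) :
    P.h st' ≤ 6 * P.h st := by
  set q := P.q st with hqdef
  set x := P.q st' with hxdef
  have hβ1 : 0 < st'.β := by linarith
  have hq : ∀ a, 0 < q a := hP.q_pos hβ
  have hx : ∀ a, 0 < x a := hP.q_pos hβ1
  have hq1 : ∑ a, q a = 1 := hP.q_sum st
  have hx1 : ∑ a, x a = 1 := hP.q_sum st'
  have hqn : ∀ a, 0 ≤ q a := fun a => (hq a).le
  have hα0 := hP.α_pos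
  have hα1 := hP.one_sub_α_pos
  have hbb := hP.βbar_pos
  have hab := hP.αbar_le_half
  obtain ⟨a₀, hn, hmax⟩ := exists_norm_eq (by have := hP.two_le_K; omega) hqn
  have hs := qStar_pos hP.two_le_K hq hq1
  set S := qStar q with hS
  set s := (1 - P.α) * st.β * S ^ (P.α - 1) / 4 with hsdef
  -- the multipliers are compared
  set G := fun (st : State K) a => st.β * P.q st a ^ (P.α - 1) + P.βbar * P.q st a ^ (P.αbar - 1)
    with hG
  obtain ⟨μ, hμ⟩ : ∃ μ, ∀ a, G st' a = G st a + (st'.L a - st.L a) + μ := by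
    refine ⟨P.grad st q a₀ - P.grad st' x a₀, fun a => ?_⟩
    rw [← hP.grad_eq hβ a a₀, ← hP.grad_eq hβ1 a a₀]
    simp only [hG, grad]
    ring
  -- If the multiplier fell by more than s, every coordinate would increase, contradicting the
  -- common total mass.
  have hμs : -s ≤ μ := by
    by_contra! hc
    have hlt : ∀ a, q a < x a := by
      intro a
      by_contra! hle
      have h1 : q a ^ (P.α - 1) ≤ x a ^ (P.α - 1) :=
        Real.rpow_le_rpow_of_nonpos (hx a) hle (by linarith)
      have h2 : q a ^ (P.αbar - 1) ≤ x a ^ (P.αbar - 1) :=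
        Real.rpow_le_rpow_of_nonpos (hx a) hle (by linarith)
      have h3 : G st a ≤ G st' a := by
        have := hq a
        simp only [hG, ← hqdef, ← hxdef]
        gcongr
      have h4 := (abs_le.mp (hg a)).2
      have := hμ a
      linarith
    have := Finset.sum_lt_sum_of_nonempty (s := Finset.univ) ⟨a₀, Finset.mem_univ _⟩
      fun a _ => hlt a
    rw [hq1, hx1] at this
    exact lt_irrefl _ this
  -- Doubling a coordinate would lower the α-part of the gradient by at least (1 - α)/2 · β X, which
  -- already pays for the loss shift 2s, and the auxiliary part by at least β̄ Y / 4. The growth of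
  -- β restores at most β̄ Y / 16, so optimality fails.
  have hmain : ∀ a, a ≠ a₀ → x a ≤ 2 * q a := by
    intro a ha
    by_contra! hlt
    have hqa := hq a
    have hle : q a ≤ S := le_qStar hqn hq1 hn hmax ha
    have h2q : 0 < 2 * q a := by positivity
    have h1 : x a ^ (P.α - 1) ≤ (2 * q a) ^ (P.α - 1) :=
      Real.rpow_le_rpow_of_nonpos h2q hlt.le (by linarith)
    have h2 : x a ^ (P.αbar - 1) ≤ (2 * q a) ^ (P.αbar - 1) :=
      Real.rpow_le_rpow_of_nonpos h2q hlt.le (by linarith)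
    have hinv : ∀ e : ℝ, (2 * q a) ^ (e - 1) = (1 / 2) ^ (1 - e) * q a ^ (e - 1) := fun e => by
      rw [Real.mul_rpow two_pos.le (hqn a), one_div, Real.inv_rpow two_pos.le,
        ← Real.rpow_neg two_pos.le, neg_sub]
    set X := q a ^ (P.α - 1) with hX
    set Y := q a ^ (P.αbar - 1) with hY
    have hX0 : 0 < X := Real.rpow_pos_of_pos hqa _
    have hY0 : 0 < Y := Real.rpow_pos_of_pos hqa _
    have h3 : (2 * q a) ^ (P.α - 1) ≤ (1 - (1 - P.α) / 2) * X := by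
      rw [hinv]
      exact mul_le_mul_of_nonneg_right (half_rpow_le hα1.le (by linarith)) hX0.le
    have h4 : (2 * q a) ^ (P.αbar - 1) ≤ 3 / 4 * Y := by
      rw [hinv]
      refine mul_le_mul_of_nonneg_right ?_ hY0.le
      have := half_rpow_le (u := 1 - P.αbar) (by linarith) (by linarith [hP.αbar_pos])
      linarith
    have h5 : S ^ (P.α - 1) ≤ X := Real.rpow_le_rpow_of_nonpos hqa hle (by linarith)
    have h6 : S ^ (P.αbar - P.α) * X ≤ Y := by
      have : S ^ (P.αbar - P.α) ≤ q a ^ (P.αbar - P.α) :=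
        Real.rpow_le_rpow_of_nonpos hqa hle (by linarith [hP.half_le_α])
      calc S ^ (P.αbar - P.α) * X ≤ q a ^ (P.αbar - P.α) * X := by gcongr
        _ = Y := by rw [hX, hY, ← Real.rpow_add hqa]; congr 1; ring
    have hlow := hμ a
    have hga := (abs_le.mp (hg a)).1
    have hlow2 : st.β * X + P.βbar * Y - 2 * s ≤ st'.β * x a ^ (P.α - 1) +
        P.βbar * x a ^ (P.αbar - 1) := by
      simp only [hG, ← hqdef, ← hxdef, ← hX, ← hY] at hlow
      linarith
    have hs2 : 2 * s ≤ st.β * ((1 - P.α) / 2 * X) := by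
      have : (1 - P.α) * st.β * S ^ (P.α - 1) ≤ (1 - P.α) * st.β * X := by gcongr
      rw [hsdef]; linarith
    have hup1 : st.β * x a ^ (P.α - 1) ≤ st.β * ((1 - (1 - P.α) / 2) * X) := by
      have := h1.trans h3
      gcongr
    have hup2 : (st'.β - st.β) * x a ^ (P.α - 1) ≤ 1 / 16 * P.βbar * Y := by
      have hxX : x a ^ (P.α - 1) ≤ X := by
        refine (h1.trans h3).trans ?_
        nlinarith
      calc (st'.β - st.β) * x a ^ (P.α - 1) ≤ (st'.β - st.β) * X :=
            mul_le_mul_of_nonneg_left hxX (by linarith)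
        _ ≤ 1 / 16 * P.βbar * S ^ (P.αbar - P.α) * X := by gcongr
        _ = 1 / 16 * P.βbar * (S ^ (P.αbar - P.α) * X) := by ring
        _ ≤ _ := by gcongr
    have hup3 : P.βbar * x a ^ (P.αbar - 1) ≤ P.βbar * (3 / 4 * Y) := by
      have := h2.trans h4
      gcongr
    have hbY : 0 < P.βbar * Y := by positivity
    have e : st'.β * x a ^ (P.α - 1) = st.β * x a ^ (P.α - 1) +
      (st'.β - st.β) * x a ^ (P.α - 1) := by ring
    rw [e] at hlow2
    linarith
  have := entropy_growth hα0 hP.α_lt_one hq hq1 (fun a => (hx a).le) hx1 hmax le_rfl hmain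
  norm_num at this
  simpa [h] using this

end Params.IsAdmissible

theorem one_sub_norm_pos {K : ℕ} {p : Fin K → ℝ} (hK : 2 ≤ K) (hp : ∀ a, 0 < p a)
    (hp1 : ∑ a, p a = 1) : 0 < 1 - ‖p‖ := by
  have h := qStar_pos hK hp hp1
  exact h.trans_le (min_le_right _ _)

/-! ### Estimates within one round. -/

namespace Params.IsAdmissible

variable {K d : ℕ} {P : Params K d} (hP : P.IsAdmissible)
include hP

theorem ε_pos : 0 < P.ε := by linarith [hP.one_lt_ε]

theorem ε_sub_one_pos : 0 < P.ε - 1 := by linarith [hP.one_lt_ε]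

section OneRound

variable {st : State K} (hβ : P.β₁ ≤ st.β)
include hβ

theorem β_pos : 0 < st.β := hP.β₁_pos.trans_le hβ

theorem qS_pos : 0 < qStar (P.q st) :=
  qStar_pos hP.two_le_K (hP.q_pos (hP.β_pos hβ)) (hP.q_sum st)

omit hβ hP in
theorem qS_le_one : qStar (P.q st) ≤ 1 := (qStar_le_half _).trans (by norm_num)

theorem s_pos : 0 < P.s st := by
  have := hP.qS_pos hβ
  have := hP.one_sub_α_pos
  have := hP.β_pos hβ
  unfold s
  positivity

/-- The powers of β, 1 - α and q_* cancel. Consequently the leverage bound 2d/γ is at most s² /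
σ^(2/ε), which is what the bonus needs. -/
theorem γ_mul_s_sq : P.γ st * P.s st ^ 2 = 4 * P.σ ^ (2 / P.ε) * d := by
  have hS := hP.qS_pos hβ
  have hu := hP.one_sub_α_pos
  have hb := hP.β_pos hβ
  have e1 : qStar (P.q st) ^ (2 * (1 - P.α)) * (qStar (P.q st) ^ (P.α - 1)) ^ 2 = 1 := by
    rw [← Real.rpow_two, ← Real.rpow_mul hS.le, ← Real.rpow_add hS]
    ring_nf
    exact Real.rpow_zero _
  have e2 : (1 - P.α) ^ (-2 : ℝ) * (1 - P.α) ^ 2 = 1 := by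
    rw [← Real.rpow_two, ← Real.rpow_add hu]; norm_num
  have e3 : st.β ^ (-2 : ℝ) * st.β ^ 2 = 1 := by
    rw [← Real.rpow_two, ← Real.rpow_add hb]; norm_num
  calc P.γ st * P.s st ^ 2 = 4 * P.σ ^ (2 / P.ε) * d * ((1 - P.α) ^ (-2 : ℝ) * (1 - P.α) ^ 2) *
        (st.β ^ (-2 : ℝ) * st.β ^ 2) *
        (qStar (P.q st) ^ (2 * (1 - P.α)) * (qStar (P.q st) ^ (P.α - 1)) ^ 2) := by
        rw [γ, s]; ring
    _ = _ := by rw [e1, e2, e3]; ring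

theorem γ_pos : 0 < P.γ st := by
  have := hP.qS_pos hβ
  have := hP.one_sub_α_pos
  have := hP.β_pos hβ
  have := hP.σ_pos
  have := hP.d_pos
  unfold γ
  positivity

theorem γ_le_half : P.γ st ≤ 1 / 2 := by
  have hS := hP.qS_pos hβ
  have hu := hP.one_sub_α_pos
  have hb := hP.β_pos hβ
  have hσ := hP.σ_pos
  have hd := hP.d_pos
  refine le_trans ?_ hP.β₁_large
  have h1 : st.β ^ (-2 : ℝ) ≤ P.β₁ ^ (-2 : ℝ) :=
    Real.rpow_le_rpow_of_nonpos hP.β₁_pos hβ (by norm_num)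
  have h2 : qStar (P.q st) ^ (2 * (1 - P.α)) ≤ 1 :=
    Real.rpow_le_one hS.le qS_le_one (by linarith)
  unfold γ
  calc _ ≤ 256 * (1 - P.α) ^ (-2 : ℝ) * P.σ ^ (2 / P.ε) * d * P.β₁ ^ (-2 : ℝ) * 1 := by
        have := hP.β₁_pos
        gcongr
    _ = _ := mul_one _

omit hβ in
theorem p₀_nonneg (a : Fin K) : 0 ≤ P.p₀ a := hP.design.1.1 a

theorem q_le_two_mul_p (a : Fin K) : P.q st a ≤ 2 * P.p st a := by
  have h1 := hP.γ_le_half hβ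
  have h2 := hP.q_nonneg st a
  have h3 := mul_nonneg (hP.γ_pos hβ).le (hP.p₀_nonneg a)
  rw [p]
  nlinarith

theorem p_pos (a : Fin K) : 0 < P.p st a := by
  have := hP.q_le_two_mul_p hβ a
  have := hP.q_pos (hP.β_pos hβ) a
  linarith

omit hβ in
theorem p_sum (st : State K) : ∑ a, P.p st a = 1 := by
  simp only [p, Finset.sum_add_distrib, ← Finset.mul_sum, hP.q_sum, hP.design.1.2]; ring

theorem featCov_posDef : (featCov P.φ (P.p st)).PosDef :=
  HTLinearBandit.featCov_posDef hP.affineSpan_eq_top (hP.p_pos hβ)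

theorem bonus_nonneg (a : Fin K) : 0 ≤ P.bonus st a := by
  have := hP.σ_pos
  have := (hP.s_pos hβ).le
  refine mul_nonneg (mul_nonneg hP.σ_pos.le (Finset.sum_nonneg fun b _ => ?_)) (by positivity)
  exact mul_nonneg (hP.p_pos hβ b).le (by positivity)

/-- The ε-th moment of a row of leverages is at most its diagonal entry to the power ε/2, hence at
most s^ε / σ; multiplied by σ s^(1-ε), this is s. -/
theorem bonus_le (a : Fin K) : P.bonus st a ≤ P.s st := by
  have hs := hP.s_pos hβ
  have hσ := hP.σ_pos
  have hd := hP.d_pos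
  have hγ := hP.γ_pos hβ
  have hε := hP.ε_pos
  have h1 := sum_mul_abs_leverage_rpow_le (fun a => (hP.p_pos hβ a).le) (hP.p_sum st)
    (hP.featCov_posDef hβ) hε hP.ε_le_two a
  have h2 : leverage P.φ (P.p st) a a ≤ 2 * d / P.γ st :=
    leverage_mix_le hP.one_le_d hP.affineSpan_eq_top hP.design (hP.q_pos (hP.β_pos hβ))
      (hP.q_sum st) hγ (by linarith [hP.γ_le_half hβ]) a
  have h3 : 2 * d / P.γ st ≤ P.s st ^ 2 / P.σ ^ (2 / P.ε) := by
    have e := hP.γ_mul_s_sq hβ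
    have hσ2 : 0 < P.σ ^ (2 / P.ε) := Real.rpow_pos_of_pos hσ _
    rw [div_le_div_iff₀ hγ hσ2]
    nlinarith
  have h4 := Real.rpow_le_rpow (leverage_self_nonneg (fun a => (hP.p_pos hβ a).le)
    (hP.featCov_posDef hβ) a) (h2.trans h3) (by linarith : 0 ≤ P.ε / 2)
  have e4 : (P.s st ^ 2 / P.σ ^ (2 / P.ε)) ^ (P.ε / 2) = P.s st ^ P.ε / P.σ := by
    rw [Real.div_rpow (by positivity) (by positivity), ← Real.rpow_two, ← Real.rpow_mul hs.le,
      ← Real.rpow_mul hσ.le]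
    have e5 : 2 * (P.ε / 2) = P.ε := by ring
    have e6 : 2 / P.ε * (P.ε / 2) = 1 := by field_simp
    rw [e5, e6, Real.rpow_one]
  rw [e4] at h4
  rw [bonus]
  calc _ ≤ P.σ * (P.s st ^ P.ε / P.σ) * P.s st ^ (1 - P.ε) := by
        have := h1.trans h4
        gcongr
    _ = P.s st ^ P.ε * P.s st ^ (1 - P.ε) := by field_simp
    _ = P.s st := by rw [← Real.rpow_add hs]; simp

theorem abs_lossHat_le (o : Obs K) (a : Fin K) : |P.lossHat st o a| ≤ P.s st := by
  rw [lossHat]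
  split_ifs with h
  · exact h
  · simpa using (hP.s_pos hβ).le

theorem abs_lossHat_sub_bonus_le (o : Obs K) (a : Fin K) :
    |P.lossHat st o a - P.bonus st a| ≤ 2 * P.s st := by
  have h1 := abs_sub (P.lossHat st o a) (P.bonus st a)
  rw [abs_of_nonneg (hP.bonus_nonneg hβ a)] at h1
  linarith [hP.abs_lossHat_le hβ o a, hP.bonus_le hβ a]

theorem h_ge : (1 - P.α) / 2 * qStar (P.q st) ^ P.α ≤ P.h st := by
  have h := entropy_ge hP.α_pos hP.α_lt_one (by have := hP.two_le_K; omega)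
    (hP.q_pos (hP.β_pos hβ)) (hP.q_sum st)
  refine le_trans (mul_le_mul_of_nonneg_right ?_ (Real.rpow_nonneg (hP.qS_pos hβ).le _)) h
  have := hP.one_sub_α_pos
  have := hP.α_pos
  have := hP.α_lt_one
  exact div_le_div_of_nonneg_left (by linarith) (by linarith) (by linarith)

theorem h_pos : 0 < P.h st := by
  refine lt_of_lt_of_le ?_ (hP.h_ge hβ)
  have := hP.one_sub_α_pos
  have := hP.qS_pos hβ
  positivity

theorem one_sub_norm_p_pos : 0 < 1 - ‖P.p st‖ :=
  one_sub_norm_pos hP.two_le_K (hP.p_pos hβ) (hP.p_sum st)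

theorem z_pos : 0 < P.z st := by
  have := hP.qS_pos hβ
  have := hP.one_sub_α_pos
  have := hP.σ_pos
  have := hP.d_pos
  have := hP.one_sub_norm_p_pos hβ
  unfold z
  positivity

theorem w_pos : 0 < P.w st := by
  have := hP.qS_pos hβ
  have := hP.one_sub_α_pos
  have := hP.σ_pos
  have := hP.d_pos
  unfold w
  positivity

theorem one_sub_norm_rpow_le_one : (1 - ‖P.p st‖) ^ (2 - P.ε) ≤ 1 :=
  Real.rpow_le_one (hP.one_sub_norm_p_pos hβ).le (by linarith [norm_nonneg (P.p st)])
    (by linarith [hP.ε_le_two])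

theorem z_le : P.z st ≤ (1 - P.α) ^ (1 - P.ε) * P.σ * qStar (P.q st) ^ P.αbar *
    (d : ℝ) ^ (P.ε / 2) := by
  have := hP.qS_pos hβ
  have := hP.one_sub_α_pos
  have := hP.σ_pos
  have := hP.d_pos
  rw [z]
  exact mul_le_of_le_one_right (by positivity) (hP.one_sub_norm_rpow_le_one hβ)

theorem z_le' : P.z st ≤ (1 - P.α) ^ (1 - P.ε) * P.σ * (d : ℝ) ^ (P.ε / 2) := by
  have := hP.qS_pos hβ
  have := hP.one_sub_α_pos
  have := hP.σ_pos
  have := hP.d_pos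
  refine (hP.z_le hβ).trans ?_
  have h2 : qStar (P.q st) ^ P.αbar ≤ 1 :=
    Real.rpow_le_one (hP.qS_pos hβ).le qS_le_one hP.αbar_pos.le
  calc _ ≤ (1 - P.α) ^ (1 - P.ε) * P.σ * 1 * (d : ℝ) ^ (P.ε / 2) := by gcongr
    _ = _ := by rw [mul_one]

theorem w_le : P.w st ≤ P.σ ^ (3 / P.ε) * (1 - P.α) ^ (-2 : ℝ) * d := by
  have := hP.one_sub_α_pos
  have := hP.σ_pos
  have := hP.d_pos
  have := hP.qS_pos hβ
  rw [w]
  exact mul_le_of_le_one_right (by positivity)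
    (Real.rpow_le_one (hP.qS_pos hβ).le qS_le_one (by linarith))

/-- The increment of the inverse learning rate, times the entropy. -/
theorem increment_nonneg : 0 ≤ st.β ^ (1 - P.ε) * P.z st + st.β ^ (-2 : ℝ) * P.w st := by
  have := hP.z_pos hβ
  have := hP.w_pos hβ
  have := hP.β_pos hβ
  positivity

theorem next_β_sub (o : Obs K) : ((P.next st o).β - st.β) * P.h st =
    st.β ^ (1 - P.ε) * P.z st + st.β ^ (-2 : ℝ) * P.w st := by
  have := (hP.h_pos hβ).ne'
  rw [next]; field_simp; ring

theorem β_le_next (o : Obs K) : st.β ≤ (P.next st o).β := by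
  have h1 := hP.next_β_sub hβ o
  have h2 := hP.increment_nonneg hβ
  have h3 := hP.h_pos hβ
  by_contra! hc
  nlinarith

omit hβ in
-- A scale comparison hidden in the lower bound on β₁. It makes the w-part of the first increment no
-- larger in order than the z-part.
theorem rpow_σ_le_β₁ : P.σ ^ (1 / P.ε) ≤ P.β₁ := by
  have hσ := hP.σ_pos
  have hb := hP.β₁_pos
  have hu := hP.one_sub_α_pos
  have hd := hP.one_le_d'
  have h := hP.β₁_large
  have h1 : 1 ≤ (1 - P.α) ^ (-2 : ℝ) :=
    Real.one_le_rpow_of_pos_of_le_one_of_nonpos hu (by linarith [hP.α_pos]) (by norm_num)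
  have e1 : P.β₁ ^ (-2 : ℝ) * P.β₁ ^ 2 = 1 := by
    rw [← Real.rpow_two, ← Real.rpow_add hb]; norm_num
  have e2 : P.σ ^ (2 / P.ε) = (P.σ ^ (1 / P.ε)) ^ 2 := by
    rw [← Real.rpow_two, ← Real.rpow_mul hσ.le]; congr 1; ring
  have hB : 0 < P.β₁ ^ (-2 : ℝ) := by positivity
  have hX : 0 < P.σ ^ (2 / P.ε) := by positivity
  have h2 : P.σ ^ (2 / P.ε) * P.β₁ ^ (-2 : ℝ) ≤ 1 := by
    have h3 : 1 ≤ (1 - P.α) ^ (-2 : ℝ) * d := by nlinarith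
    have h4 := mul_le_mul_of_nonneg_right h3 (mul_pos hX hB).le
    nlinarith
  have h5 : P.σ ^ (2 / P.ε) ≤ P.β₁ ^ 2 := by
    have := mul_le_mul_of_nonneg_right h2 (sq_nonneg P.β₁)
    rw [mul_assoc, e1] at this
    linarith
  rw [e2] at h5
  exact (pow_le_pow_iff_left₀ (by positivity) hb.le two_ne_zero).mp h5

omit hβ in
theorem β₁_rpow_mul_le : P.β₁ ^ (-2 : ℝ) * P.σ ^ (3 / P.ε) ≤ P.β₁ ^ (1 - P.ε) * P.σ := by
  have hσ := hP.σ_pos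
  have hb := hP.β₁_pos
  have hε := hP.ε_pos
  have h := Real.rpow_le_rpow_of_nonpos (Real.rpow_pos_of_pos hσ (1 / P.ε)) hP.rpow_σ_le_β₁
    (by linarith [hP.ε_le_two] : P.ε - 3 ≤ 0)
  rw [← Real.rpow_mul hσ.le] at h
  have e : P.β₁ ^ (-2 : ℝ) = P.β₁ ^ (1 - P.ε) * P.β₁ ^ (P.ε - 3) := by
    rw [← Real.rpow_add hb]; congr 1; ring
  have e2 : P.σ ^ (1 / P.ε * (P.ε - 3)) * P.σ ^ (3 / P.ε) = P.σ := by
    rw [← Real.rpow_add hσ]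
    have : 1 / P.ε * (P.ε - 3) + 3 / P.ε = 1 := by field_simp; ring
    rw [this, Real.rpow_one]
  calc P.β₁ ^ (-2 : ℝ) * P.σ ^ (3 / P.ε) ≤
      P.β₁ ^ (1 - P.ε) * P.σ ^ (1 / P.ε * (P.ε - 3)) * P.σ ^ (3 / P.ε) := by rw [e]; gcongr
    _ = _ := by rw [mul_assoc, e2]

/-- Since ᾱ ≤ 2(1 - α) and q_* ≤ 1, both components carry the factor q_*^ᾱ. -/
theorem increment_le : st.β ^ (1 - P.ε) * P.z st + st.β ^ (-2 : ℝ) * P.w st ≤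
    2 * ((1 - P.α) ^ (-2 : ℝ) * (d : ℝ) ^ P.ε * (P.β₁ ^ (1 - P.ε) * P.σ) *
      qStar (P.q st) ^ P.αbar) := by
  have hS := hP.qS_pos hβ
  have hu := hP.one_sub_α_pos
  have hu1 : 1 - P.α ≤ 1 := by linarith [hP.α_pos]
  have hσ := hP.σ_pos
  have hd := hP.one_le_d'
  have hd0 := hP.d_pos
  have hb := hP.β₁_pos
  have hε := hP.one_lt_ε
  have hε2 := hP.ε_le_two
  have hb' := hP.β_pos hβ
  have h1 : st.β ^ (1 - P.ε) ≤ P.β₁ ^ (1 - P.ε) :=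
    Real.rpow_le_rpow_of_nonpos hb hβ (by linarith)
  have h2 : st.β ^ (-2 : ℝ) ≤ P.β₁ ^ (-2 : ℝ) :=
    Real.rpow_le_rpow_of_nonpos hb hβ (by norm_num)
  have h3 : (1 - P.α) ^ (1 - P.ε) ≤ (1 - P.α) ^ (-2 : ℝ) :=
    Real.rpow_le_rpow_of_exponent_ge hu hu1 (by linarith)
  have h4 : (d : ℝ) ^ (P.ε / 2) ≤ (d : ℝ) ^ P.ε :=
    Real.rpow_le_rpow_of_exponent_le hd (by linarith)
  have h5 : (d : ℝ) ≤ (d : ℝ) ^ P.ε := by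
    simpa using Real.rpow_le_rpow_of_exponent_le hd hε.le
  have h6 : qStar (P.q st) ^ (2 * (1 - P.α)) ≤ qStar (P.q st) ^ P.αbar :=
    Real.rpow_le_rpow_of_exponent_ge hS qS_le_one (by linarith [hP.αbar_le])
  have hz : st.β ^ (1 - P.ε) * P.z st ≤ (1 - P.α) ^ (-2 : ℝ) * (d : ℝ) ^ P.ε *
      (P.β₁ ^ (1 - P.ε) * P.σ) * qStar (P.q st) ^ P.αbar := by
    calc st.β ^ (1 - P.ε) * P.z st ≤ P.β₁ ^ (1 - P.ε) *
          ((1 - P.α) ^ (-2 : ℝ) * P.σ * qStar (P.q st) ^ P.αbar * (d : ℝ) ^ P.ε) := by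
          refine mul_le_mul h1 ((hP.z_le hβ).trans ?_) (hP.z_pos hβ).le (by positivity)
          gcongr
      _ = _ := by ring
  have hw : st.β ^ (-2 : ℝ) * P.w st ≤ (1 - P.α) ^ (-2 : ℝ) * (d : ℝ) ^ P.ε *
      (P.β₁ ^ (1 - P.ε) * P.σ) * qStar (P.q st) ^ P.αbar := by
    have h7 := hP.β₁_rpow_mul_le
    calc st.β ^ (-2 : ℝ) * P.w st ≤ P.β₁ ^ (-2 : ℝ) *
          (P.σ ^ (3 / P.ε) * (1 - P.α) ^ (-2 : ℝ) * (d : ℝ) ^ P.ε * qStar (P.q st) ^ P.αbar) := by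
          refine mul_le_mul h2 ?_ (hP.w_pos hβ).le (by positivity)
          rw [w]
          gcongr
      _ = (P.β₁ ^ (-2 : ℝ) * P.σ ^ (3 / P.ε)) * ((1 - P.α) ^ (-2 : ℝ) * (d : ℝ) ^ P.ε *
          qStar (P.q st) ^ P.αbar) := by ring
      _ ≤ (P.β₁ ^ (1 - P.ε) * P.σ) * ((1 - P.α) ^ (-2 : ℝ) * (d : ℝ) ^ P.ε *
          qStar (P.q st) ^ P.αbar) := by gcongr
      _ = _ := by ring
  linarith

/-- Dividing q_*^ᾱ by the entropy, which is at least of order q_*^α, leaves q_*^(ᾱ-α). This is the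
scale that the auxiliary regularizer with exponent ᾱ can absorb, and β̄ is large enough for the
factor 1/16. -/
theorem next_β_sub_le (o : Obs K) :
    (P.next st o).β - st.β ≤ 1 / 16 * P.βbar * qStar (P.q st) ^ (P.αbar - P.α) := by
  have hS := hP.qS_pos hβ
  have hu := hP.one_sub_α_pos
  have hσ := hP.σ_pos
  have hd0 := hP.d_pos
  have hb := hP.β₁_pos
  have hlow : 0 < (1 - P.α) / 2 * qStar (P.q st) ^ P.α := by positivity
  have h0 := sub_nonneg.mpr (hP.β_le_next hβ o)
  have h1 : ((P.next st o).β - st.β) * ((1 - P.α) / 2 * qStar (P.q st) ^ P.α) ≤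
      2 * ((1 - P.α) ^ (-2 : ℝ) * (d : ℝ) ^ P.ε * (P.β₁ ^ (1 - P.ε) * P.σ) *
      qStar (P.q st) ^ P.αbar) :=
    (mul_le_mul_of_nonneg_left (hP.h_ge hβ) h0).trans
      ((hP.next_β_sub hβ o).le.trans (hP.increment_le hβ))
  have e1 : qStar (P.q st) ^ P.αbar =
      qStar (P.q st) ^ (P.αbar - P.α) * qStar (P.q st) ^ P.α := by
    rw [← Real.rpow_add hS]; congr 1; ring
  have e2 : (1 - P.α) ^ (-2 : ℝ) = (1 - P.α) ^ (-3 : ℝ) * (1 - P.α) := by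
    rw [← Real.rpow_add_one hu.ne']; norm_num
  have h2 : (P.next st o).β - st.β ≤ 4 * ((1 - P.α) ^ (-3 : ℝ) * (d : ℝ) ^ P.ε *
      P.β₁ ^ (1 - P.ε) * P.σ) * qStar (P.q st) ^ (P.αbar - P.α) := by
    refine le_of_mul_le_mul_right (h1.trans (le_of_eq ?_)) hlow
    rw [e1, e2]; ring
  refine h2.trans ?_
  have h3 : 64 * ((1 - P.α) ^ (-3 : ℝ) * (d : ℝ) ^ P.ε * P.β₁ ^ (1 - P.ε) * P.σ) ≤ P.βbar := by
    refine le_trans ?_ hP.βbar_large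
    calc _ = 64 * (1 - P.α) ^ (-3 : ℝ) * (d : ℝ) ^ P.ε * P.β₁ ^ (1 - P.ε) * P.σ := by ring
      _ ≤ _ := by gcongr; exact le_max_right _ _
  have : 4 * ((1 - P.α) ^ (-3 : ℝ) * (d : ℝ) ^ P.ε * P.β₁ ^ (1 - P.ε) * P.σ) ≤
    1 / 16 * P.βbar := by linarith
  gcongr

theorem h_next_le (o : Obs K) : P.h (P.next st o) ≤ 6 * P.h st := by
  refine hP.h_le_of_step (hP.β_pos hβ) (hP.β_le_next hβ o) (hP.next_β_sub_le hβ o) fun a => ?_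
  have h1 : (P.next st o).L a - st.L a = P.lossHat st o a - P.bonus st a := by
    rw [next]; ring
  rw [h1]
  refine (hP.abs_lossHat_sub_bonus_le hβ o a).trans (le_of_eq ?_)
  rw [s]; ring

/-- The bonuses cost at most the stability term `β ^ (1 - ε) z`. -/
theorem sum_q_mul_bonus_le :
    ∑ a, P.q st a * P.bonus st a ≤ 64 * (st.β ^ (1 - P.ε) * P.z st) := by
  have hS := hP.qS_pos hβ
  have hu := hP.one_sub_α_pos
  have hσ := hP.σ_pos
  have hd0 := hP.d_pos
  have hs := hP.s_pos hβ
  have hb := hP.β_pos hβ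
  have hε := hP.one_lt_ε
  have hn := hP.one_sub_norm_p_pos hβ
  have h1 := sum_sum_abs_leverage_rpow_le (by have := hP.two_le_K; omega)
    (fun a => (hP.p_pos hβ a).le) (hP.p_sum st) (hP.featCov_posDef hβ) hε hP.ε_le_two
  have h2 : ∑ a, P.q st a * P.bonus st a ≤ 2 * (P.σ * P.s st ^ (1 - P.ε)) *
      ∑ a, P.p st a * ∑ b, P.p st b * |leverage P.φ (P.p st) a b| ^ P.ε := by
    rw [Finset.mul_sum]
    refine Finset.sum_le_sum fun a _ => ?_
    calc P.q st a * P.bonus st a ≤ 2 * P.p st a * P.bonus st a :=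
          mul_le_mul_of_nonneg_right (hP.q_le_two_mul_p hβ a) (hP.bonus_nonneg hβ a)
      _ = _ := by rw [bonus]; ring
  have e1 : P.s st ^ (1 - P.ε) = (1 / 8) ^ (1 - P.ε) * ((1 - P.α) ^ (1 - P.ε) *
      st.β ^ (1 - P.ε) * qStar (P.q st) ^ ((P.ε - 1) * (1 - P.α))) := by
    rw [s, div_eq_mul_one_div, Real.mul_rpow (by positivity) (by norm_num),
      Real.mul_rpow (by positivity) (by positivity), Real.mul_rpow hu.le hb.le,
      ← Real.rpow_mul hS.le]
    rw [show (P.α - 1) * (1 - P.ε) = (P.ε - 1) * (1 - P.α) by ring]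
    ring
  -- The 8 comes from the denominator in s; with the 2 from q ≤ 2p and the 4 from the leverage
  -- moments it makes 64.
  have h8 : (1 / 8 : ℝ) ^ (1 - P.ε) ≤ 8 := by
    have := Real.rpow_le_rpow_of_exponent_ge (x := (1 / 8 : ℝ)) (by norm_num) (by norm_num)
      (by linarith [hP.ε_le_two] : (-1 : ℝ) ≤ 1 - P.ε)
    rw [Real.rpow_neg_one] at this
    norm_num at this ⊢
    linarith
  refine h2.trans ((mul_le_mul_of_nonneg_left h1 (by positivity)).trans ?_)
  rw [e1]
  calc _ = 8 * (1 / 8) ^ (1 - P.ε) * (st.β ^ (1 - P.ε) * P.z st) := by rw [z]; ring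
    _ ≤ 8 * 8 * (st.β ^ (1 - P.ε) * P.z st) := by
        have := (hP.z_pos hβ).le
        gcongr
    _ = _ := by ring

omit hβ in
/-- The exploration costs at most the term `β ^ (-2) w`. -/
theorem γ_mul_rpow_eq (st : State K) :
    P.γ st * P.σ ^ (1 / P.ε) = 256 * (st.β ^ (-2 : ℝ) * P.w st) := by
  have e : P.σ ^ (3 / P.ε) = P.σ ^ (2 / P.ε) * P.σ ^ (1 / P.ε) := by
    rw [← Real.rpow_add hP.σ_pos]; congr 1; ring
  rw [γ, w, e]; ring

end OneRound

theorem β₁_le_state : ∀ (t : ℕ) (o : Fin t → Obs K), P.β₁ ≤ (P.state t o).β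
  | 0, _ => le_rfl
  | t + 1, o => (β₁_le_state t (Fin.init o)).trans
      (hP.β_le_next (β₁_le_state t (Fin.init o)) _)

end Params.IsAdmissible

/-! ### Maximal entropy and the first iterate. -/

theorem sum_rpow_le_card {K : ℕ} {q : Fin K → ℝ} {r : ℝ} (h0 : 0 < r) (h1 : r < 1)
    (hq : ∀ a, 0 ≤ q a) (hq1 : ∑ a, q a = 1) : ∑ a, q a ^ r ≤ (K : ℝ) ^ (1 - r) := by
  have h := Real.inner_le_weight_mul_Lp_of_nonneg Finset.univ (p := r⁻¹)
    ((one_le_inv₀ h0).mpr h1.le) (fun _ : Fin K => 1) (fun a => q a ^ r)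
    (fun _ => zero_le_one) (fun a => Real.rpow_nonneg (hq a) _)
  have e : ∀ a, (q a ^ r) ^ r⁻¹ = q a := fun a => by
    rw [← Real.rpow_mul (hq a), mul_inv_cancel₀ h0.ne', Real.rpow_one]
  simpa [e, hq1] using h

theorem neg_tsallis_le {K : ℕ} {q : Fin K → ℝ} {r : ℝ} (h0 : 0 < r) (h1 : r < 1)
    (hq : ∀ a, 0 ≤ q a) (hq1 : ∑ a, q a = 1) :
    -tsallis r q ≤ 1 / r * ((K : ℝ) ^ (1 - r) - 1) := by
  have h := sum_rpow_le_card h0 h1 hq hq1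
  rw [tsallis, Finset.sum_sub_distrib, hq1, neg_mul, neg_neg]
  gcongr

theorem neg_tsallis_uniform {K : ℕ} (hK : 0 < K) (r : ℝ) :
    -tsallis r (fun _ : Fin K => (K : ℝ)⁻¹) = 1 / r * ((K : ℝ) ^ (1 - r) - 1) := by
  have hK' : (0 : ℝ) < K := by exact_mod_cast hK
  rw [tsallis, neg_mul, neg_neg]
  simp only [Finset.sum_const, Finset.card_univ, Fintype.card_fin, nsmul_eq_mul]
  rw [mul_sub, mul_inv_cancel₀ hK'.ne', Real.inv_rpow hK'.le, ← Real.rpow_neg hK'.le, mul_comm (K : ℝ),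
    ← Real.rpow_add_one hK'.ne', neg_add_eq_sub]

namespace Params

variable {K d : ℕ} {P : Params K d}

namespace IsAdmissible

variable (hP : P.IsAdmissible)
include hP

/-- With zero losses only the two entropies remain, and the uniform distribution maximizes both.
Hence h₁ is also the largest entropy that can ever occur. -/
theorem q_state₁ : P.q P.state₁ = fun _ => (K : ℝ)⁻¹ := by
  have hK := hP.K_pos
  refine (hP.q_unique (x := fun _ => (K : ℝ)⁻¹) hP.β₁_pos
    ⟨fun _ => by positivity, by simp [hK.ne']⟩ fun y hy => ?_).symm
  have h1 := neg_tsallis_le hP.α_pos hP.α_lt_one hy.1 hy.2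
  have h2 := neg_tsallis_le hP.αbar_pos (by linarith [hP.αbar_le_half]) hy.1 hy.2
  rw [← neg_tsallis_uniform (by have := hP.two_le_K; omega)] at h1 h2
  have h3 := mul_le_mul_of_nonneg_left (neg_le_neg_iff.mp h1) hP.β₁_pos.le
  have h4 := mul_le_mul_of_nonneg_left (neg_le_neg_iff.mp h2) hP.βbar_pos.le
  simp only [objective, state₁, Pi.zero_apply, zero_mul, Finset.sum_const_zero]
  linarith

theorem h_le_h₁ (st : State K) : P.h st ≤ P.h₁ := by
  rw [h₁, h, h, hP.q_state₁, neg_tsallis_uniform (by have := hP.two_le_K; omega)]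
  exact neg_tsallis_le hP.α_pos hP.α_lt_one (hP.q_nonneg st) (hP.q_sum st)

theorem h₁_le : P.h₁ ≤ 1 / P.α * (K : ℝ) ^ (1 - P.α) := by
  have h := neg_tsallis_le hP.α_pos hP.α_lt_one (hP.q_nonneg P.state₁) (hP.q_sum P.state₁)
  have := hP.α_pos
  refine h.trans ?_
  gcongr
  linarith

theorem hbar_le : P.hbar ≤ 1 / P.αbar * (K : ℝ) ^ (1 - P.αbar) := by
  have h := neg_tsallis_le hP.αbar_pos (by linarith [hP.αbar_le_half]) (hP.q_nonneg P.state₁)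
    (hP.q_sum P.state₁)
  have := hP.αbar_pos
  refine h.trans ?_
  gcongr
  linarith

theorem h₁_pos : 0 < P.h₁ := hP.h_pos (st := P.state₁) le_rfl

theorem hbar_nonneg : 0 ≤ P.hbar := by
  rw [hbar, neg_tsallis]
  refine Finset.sum_nonneg fun a _ =>
    ent_nonneg hP.αbar_pos (by linarith [hP.αbar_le_half]) (hP.q_nonneg _ a) ?_
  rw [← hP.q_sum P.state₁]
  exact Finset.single_le_sum (fun c _ => hP.q_nonneg _ c) (Finset.mem_univ a)

/-! ### Entropy, z and w in terms of the expected gap. -/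

section Gaps

variable {Δ : Fin K → ℝ} {astar : Fin K} (hΔ : ∀ a, 0 ≤ Δ a) (hpos : ∀ a, a ≠ astar → 0 < Δ a)
include hΔ hpos

omit hΔ in
theorem gapSum_pos : 0 < P.gapSum Δ astar := by
  have : Nontrivial (Fin K) := Fin.nontrivial_iff_two_le.mpr hP.two_le_K
  obtain ⟨b, hb⟩ := exists_ne astar
  exact Finset.sum_pos (fun a ha => Real.rpow_pos_of_pos (hpos a (Finset.ne_of_mem_erase ha)) _)
    ⟨b, Finset.mem_erase.mpr ⟨hb, Finset.mem_univ b⟩⟩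

omit hΔ in
theorem gapMin_pos : 0 < ⨅ a : {a : Fin K // a ≠ astar}, Δ a := by
  have : Nontrivial (Fin K) := Fin.nontrivial_iff_two_le.mpr hP.two_le_K
  obtain ⟨b, hb⟩ := exists_ne astar
  have : Nonempty {a : Fin K // a ≠ astar} := ⟨⟨b, hb⟩⟩
  obtain ⟨a, ha⟩ := exists_eq_ciInf_of_finite (f := fun a : {a : Fin K // a ≠ astar} => Δ a)
  rw [← ha]
  exact hpos a a.2

omit hΔ in
theorem ζ_pos : 0 < P.ζ Δ astar := by
  have := hP.gapSum_pos hpos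
  have := hP.gapMin_pos hpos
  have := hP.α_pos
  have := hP.one_sub_α_pos
  have := hP.σ_pos
  have := hP.d_pos
  unfold ζ
  positivity

omit hΔ in
theorem ω_pos : 0 < P.ω Δ astar := by
  have := hP.gapSum_pos hpos
  have := hP.α_pos
  have := hP.one_sub_α_pos
  have := hP.σ_pos
  have := hP.d_pos
  unfold ω
  positivity

omit hP hpos in
-- The mass off a* is at least 1 - ‖x‖, whether or not a* is the heaviest arm.
theorem gapMin_mul_le {x : Fin K → ℝ} (hx : ∀ a, 0 ≤ x a) (hx1 : ∑ a, x a = 1) :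
    (⨅ a : {a : Fin K // a ≠ astar}, Δ a) * (1 - ‖x‖) ≤ ∑ a, Δ a * x a := by
  set m := ⨅ a : {a : Fin K // a ≠ astar}, Δ a
  have hm0 : 0 ≤ m := Real.iInf_nonneg fun a => hΔ a
  have hle : ∀ a, a ≠ astar → m ≤ Δ a := fun a ha =>
    ciInf_le (Set.finite_range _).bddBelow (⟨a, ha⟩ : {a : Fin K // a ≠ astar})
  have hn : x astar ≤ ‖x‖ := by
    have := norm_le_pi_norm x astar
    rwa [Real.norm_of_nonneg (hx astar)] at this
  have e : 1 - x astar = ∑ a ∈ Finset.univ.erase astar, x a := by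
    rw [← hx1, ← Finset.add_sum_erase _ _ (Finset.mem_univ astar)]; ring
  calc m * (1 - ‖x‖) ≤ m * (1 - x astar) := by gcongr
    _ ≤ ∑ a ∈ Finset.univ.erase astar, Δ a * x a := by
        rw [e, Finset.mul_sum]
        exact Finset.sum_le_sum fun a ha =>
          mul_le_mul_of_nonneg_right (hle a (Finset.ne_of_mem_erase ha)) (hx a)
    _ ≤ _ := Finset.sum_le_sum_of_subset_of_nonneg (Finset.erase_subset _ _)
        fun a _ _ => mul_nonneg (hΔ a) (hx a)

/-- The entropy is controlled by the expected gap. -/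
theorem h_le_gapSum (st : State K) : P.h st ≤
    1 / P.α * (P.gapSum Δ astar ^ (1 - P.α) * (∑ a, Δ a * P.q st a) ^ P.α) := by
  set q := P.q st with hq
  have hq0 : ∀ a, 0 ≤ q a := hP.q_nonneg st
  have hq1 : ∑ a, q a = 1 := hP.q_sum st
  have hα := hP.α_pos
  have hα1 := hP.one_sub_α_pos
  -- These weights turn Hölder with exponent 1/α into a bound by Δ a * q a, since w^(1 - 1/α) = Δ.
  set w := fun a => Δ a ^ (P.α / (P.α - 1)) with hw
  have hw0 : ∀ a, 0 ≤ w a := fun a => Real.rpow_nonneg (hΔ a) _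
  have hH := Real.inner_le_weight_mul_Lp_of_nonneg (Finset.univ.erase astar) (p := P.α⁻¹)
    ((one_le_inv₀ hα).mpr hP.α_lt_one.le) w (fun a => q a ^ P.α / w a) hw0
    (fun a => div_nonneg (Real.rpow_nonneg (hq0 a) _) (hw0 a))
  have e1 : ∀ a ∈ Finset.univ.erase astar, w a * (q a ^ P.α / w a) = q a ^ P.α := fun a ha => by
    have := Real.rpow_pos_of_pos (hpos a (Finset.ne_of_mem_erase ha)) (P.α / (P.α - 1))
    exact mul_div_cancel₀ _ this.ne'
  have e2 : ∀ a ∈ Finset.univ.erase astar, w a * (q a ^ P.α / w a) ^ P.α⁻¹ = Δ a * q a := by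
    intro a ha
    have hD := hpos a (Finset.ne_of_mem_erase ha)
    have hwa : 0 < w a := Real.rpow_pos_of_pos hD _
    rw [Real.div_rpow (Real.rpow_nonneg (hq0 a) _) hwa.le, ← Real.rpow_mul (hq0 a),
      mul_inv_cancel₀ hα.ne', Real.rpow_one]
    have e3 : w a ^ P.α⁻¹ = w a / Δ a := by
      rw [hw, ← Real.rpow_mul hD.le, ← Real.rpow_sub_one hD.ne']
      congr 1
      have : P.α - 1 ≠ 0 := by linarith
      field_simp
      ring
    rw [e3]
    field_simp
  rw [Finset.sum_congr rfl e1, Finset.sum_congr rfl e2, inv_inv] at hH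
  have hsub : ∑ a ∈ Finset.univ.erase astar, Δ a * q a ≤ ∑ a, Δ a * q a :=
    Finset.sum_le_sum_of_subset_of_nonneg (Finset.erase_subset _ _)
      fun a _ _ => mul_nonneg (hΔ a) (hq0 a)
  have hnn : 0 ≤ ∑ a ∈ Finset.univ.erase astar, Δ a * q a :=
    Finset.sum_nonneg fun a _ => mul_nonneg (hΔ a) (hq0 a)
  have hS := (hP.gapSum_pos hpos).le
  -- The arm a* has no gap to pay with; its term is cancelled by -∑ q = -1.
  have hle1 : q astar ^ P.α ≤ 1 := by
    refine Real.rpow_le_one (hq0 _) ?_ hα.le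
    rw [← hq1]; exact Finset.single_le_sum (fun c _ => hq0 c) (Finset.mem_univ astar)
  rw [h, tsallis, neg_mul, neg_neg, Finset.sum_sub_distrib, ← hq, hq1,
    ← Finset.add_sum_erase _ _ (Finset.mem_univ astar)]
  have h2 := Real.rpow_le_rpow hnn hsub hα.le
  have h3 : ∑ a ∈ Finset.univ.erase astar, q a ^ P.α ≤
      P.gapSum Δ astar ^ (1 - P.α) * (∑ a, Δ a * q a) ^ P.α :=
    hH.trans (mul_le_mul_of_nonneg_left h2 (Real.rpow_nonneg hS _))
  gcongr
  linarith

variable {st : State K} (hβ : P.β₁ ≤ st.β)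
include hβ

omit hpos in
theorem gap_q_le : ∑ a, Δ a * P.q st a ≤ 2 * ∑ a, Δ a * P.p st a := by
  rw [Finset.mul_sum]
  refine Finset.sum_le_sum fun a _ => ?_
  have := mul_le_mul_of_nonneg_left (hP.q_le_two_mul_p hβ a) (hΔ a)
  linarith

theorem gap_p_pos : 0 < ∑ a, Δ a * P.p st a := by
  refine lt_of_lt_of_le (mul_pos (hP.gapMin_pos hpos) (hP.one_sub_norm_p_pos hβ))
    (gapMin_mul_le hΔ (fun a => (hP.p_pos hβ a).le) (hP.p_sum st))

/-- The entropy contributes the gap D to the power α(ε-1), q_* to the power (ε-1)(1-α), and 1 - ‖p‖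
to the power 2 - ε. The exponents add up to one, so the bound is linear in D; the factor 2^(ε-1)
comes from q ≤ 2p. -/
theorem h_rpow_mul_z_le :
    P.h st ^ (P.ε - 1) * P.z st ≤ P.ζ Δ astar * ∑ a, Δ a * P.p st a := by
  set D := ∑ a, Δ a * P.p st a with hD
  have hD0 : 0 < D := hP.gap_p_pos hΔ hpos hβ
  have hm := hP.gapMin_pos hpos
  have hS := hP.gapSum_pos hpos
  have hmp := gapMin_mul_le (astar := astar) hΔ (fun a => (hP.p_pos hβ a).le) (hP.p_sum st)
  have hmq := gapMin_mul_le (astar := astar) hΔ (hP.q_nonneg st) (hP.q_sum st)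
  set m := ⨅ a : {a : Fin K // a ≠ astar}, Δ a with hmdef
  set S := P.gapSum Δ astar with hSdef
  have hα := hP.α_pos
  have hu := hP.one_sub_α_pos
  have hσ := hP.σ_pos
  have hd := hP.d_pos
  have hε := hP.ε_sub_one_pos
  have hε2 := hP.ε_le_two
  have hqS := hP.qS_pos hβ
  have hn := hP.one_sub_norm_p_pos hβ
  have hq2 := hP.gap_q_le hΔ hβ
  have hqn : 0 ≤ ∑ a, Δ a * P.q st a :=
    Finset.sum_nonneg fun a _ => mul_nonneg (hΔ a) (hP.q_nonneg st a)
  have h1 : P.h st ≤ 1 / P.α * (S ^ (1 - P.α) * (2 * D) ^ P.α) := by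
    refine (hP.h_le_gapSum hΔ hpos st).trans ?_
    gcongr
  have h2 : qStar (P.q st) ≤ 2 * D / m := by
    rw [le_div_iff₀ hm]
    have : qStar (P.q st) ≤ 1 - ‖P.q st‖ := min_le_right _ _
    nlinarith
  have h3 : 1 - ‖P.p st‖ ≤ D / m := by
    rw [le_div_iff₀ hm]; linarith
  have h4 : P.h st ^ (P.ε - 1) ≤ (1 / P.α * (S ^ (1 - P.α) * (2 * D) ^ P.α)) ^ (P.ε - 1) :=
    Real.rpow_le_rpow (hP.h_pos hβ).le h1 hε.le
  have h5 : qStar (P.q st) ^ ((P.ε - 1) * (1 - P.α)) ≤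
      (2 * D / m) ^ ((P.ε - 1) * (1 - P.α)) := Real.rpow_le_rpow hqS.le h2 (by positivity)
  have h6 : (1 - ‖P.p st‖) ^ (2 - P.ε) ≤ (D / m) ^ (2 - P.ε) :=
    Real.rpow_le_rpow hn.le h3 (by linarith)
  have h7 : P.z st ≤ (1 - P.α) ^ (1 - P.ε) * P.σ * (2 * D / m) ^ ((P.ε - 1) * (1 - P.α)) *
      (d : ℝ) ^ (P.ε / 2) * (D / m) ^ (2 - P.ε) := by
    unfold z
    gcongr
  refine (mul_le_mul h4 h7 (hP.z_pos hβ).le (by positivity)).trans (le_of_eq ?_)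
  have e1 : (1 / P.α * (S ^ (1 - P.α) * (2 * D) ^ P.α)) ^ (P.ε - 1) =
      P.α ^ (1 - P.ε) * S ^ ((1 - P.α) * (P.ε - 1)) *
        (2 ^ (P.α * (P.ε - 1)) * D ^ (P.α * (P.ε - 1))) := by
    rw [Real.mul_rpow (by positivity) (by positivity), Real.mul_rpow (by positivity) (by positivity),
      ← Real.rpow_mul hS.le, ← Real.rpow_mul (by positivity), one_div, Real.inv_rpow hα.le,
      ← Real.rpow_neg hα.le, Real.mul_rpow two_pos.le hD0.le, neg_sub]
    ring
  have e2 : (2 * D / m) ^ ((P.ε - 1) * (1 - P.α)) = 2 ^ ((P.ε - 1) * (1 - P.α)) *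
      D ^ ((P.ε - 1) * (1 - P.α)) * m ^ (-((P.ε - 1) * (1 - P.α))) := by
    rw [Real.div_rpow (by positivity) hm.le, Real.mul_rpow two_pos.le hD0.le, Real.rpow_neg hm.le,
      div_eq_mul_inv]
  have e3 : (D / m) ^ (2 - P.ε) = D ^ (2 - P.ε) * m ^ (-(2 - P.ε)) := by
    rw [Real.div_rpow hD0.le hm.le, Real.rpow_neg hm.le, div_eq_mul_inv]
  have e4 : (2 : ℝ) ^ (P.ε - 1) = 2 ^ (P.α * (P.ε - 1)) * 2 ^ ((P.ε - 1) * (1 - P.α)) := by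
    rw [← Real.rpow_add two_pos]; congr 1; ring
  have e5 : D = D ^ (P.α * (P.ε - 1)) * D ^ ((P.ε - 1) * (1 - P.α)) * D ^ (2 - P.ε) := by
    rw [← Real.rpow_add hD0, ← Real.rpow_add hD0]
    ring_nf
    rw [Real.rpow_one]
  have e6 : m ^ (P.α * (P.ε - 1) - 1) =
      m ^ (-((P.ε - 1) * (1 - P.α))) * m ^ (-(2 - P.ε)) := by
    rw [← Real.rpow_add hm]; congr 1; ring
  have e7 : ((1 - P.α) * P.α) ^ (1 - P.ε) = (1 - P.α) ^ (1 - P.ε) * P.α ^ (1 - P.ε) :=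
    Real.mul_rpow hu.le hα.le
  rw [ζ, ← hmdef, ← hSdef, e1, e2, e3, e4, e6, e7]
  conv_rhs => rw [e5]
  ring

/-- Since 2α ≥ 1 and the gap Q of q is at most 1, Q^(2α) ≤ Q ≤ 2D. The power of q_* in w is not
needed. -/
theorem h_sq_mul_w_le (hΔ1 : ∀ a, Δ a ≤ 1) :
    P.h st ^ 2 * P.w st ≤ 2 * P.ω Δ astar * ∑ a, Δ a * P.p st a := by
  set D := ∑ a, Δ a * P.p st a with hD
  set Q := ∑ a, Δ a * P.q st a with hQ
  have hS := hP.gapSum_pos hpos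
  have hα := hP.α_pos
  have hu := hP.one_sub_α_pos
  have hσ := hP.σ_pos
  have hd := hP.d_pos
  have hqS := hP.qS_pos hβ
  have hq2 : Q ≤ 2 * D := hP.gap_q_le hΔ hβ
  have hqn : 0 ≤ Q := Finset.sum_nonneg fun a _ => mul_nonneg (hΔ a) (hP.q_nonneg st a)
  have hq1 : Q ≤ 1 := by
    rw [← hP.q_sum st]
    exact Finset.sum_le_sum fun a _ => mul_le_of_le_one_left (hP.q_nonneg st a) (hΔ1 a)
  have h1 := hP.h_le_gapSum hΔ hpos st
  rw [← hQ] at h1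
  have h2 : P.h st ^ 2 ≤ (1 / P.α * (P.gapSum Δ astar ^ (1 - P.α) * Q ^ P.α)) ^ 2 :=
    pow_le_pow_left₀ (hP.h_pos hβ).le h1 2
  have hQ2 : (Q ^ P.α) ^ 2 ≤ 2 * D := by
    refine le_trans ?_ hq2
    rw [← Real.rpow_two, ← Real.rpow_mul hqn]
    simpa using Real.rpow_le_rpow_of_exponent_ge_of_imp hqn hq1
      (by linarith [hP.half_le_α] : 1 ≤ P.α * 2) (fun _ h => by linarith)
  have e1 : (P.gapSum Δ astar ^ (1 - P.α)) ^ 2 = P.gapSum Δ astar ^ (2 * (1 - P.α)) := by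
    rw [← Real.rpow_two, ← Real.rpow_mul hS.le, mul_comm]
  have e2 : (P.α * (1 - P.α)) ^ (-2 : ℝ) = (1 / P.α) ^ 2 * (1 - P.α) ^ (-2 : ℝ) := by
    rw [Real.mul_rpow hα.le hu.le, Real.rpow_neg hα.le, Real.rpow_two, one_div, inv_pow]
  calc P.h st ^ 2 * P.w st ≤ (1 / P.α * (P.gapSum Δ astar ^ (1 - P.α) * Q ^ P.α)) ^ 2 *
        (P.σ ^ (3 / P.ε) * (1 - P.α) ^ (-2 : ℝ) * d) :=
        mul_le_mul h2 (hP.w_le hβ) (hP.w_pos hβ).le (by positivity)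
    _ = P.ω Δ astar * (Q ^ P.α) ^ 2 := by
        rw [mul_pow, mul_pow, e1, ω, e2]; ring
    _ ≤ P.ω Δ astar * (2 * D) := by
        have := hP.ω_pos hpos
        gcongr
    _ = _ := by ring

end Gaps

/-! ### The maxima of z and w. -/

section Max

variable {T : ℕ}

/-- The uniform bound on z is needed, as `sSup` of an unbounded set of reals would be 0. -/
theorem z_le_zMax {t : ℕ} (o : Fin t → Obs K) (ht : t < T) : P.z (P.state t o) ≤ P.zMax T := by
  refine le_csSup ⟨(1 - P.α) ^ (1 - P.ε) * P.σ * (d : ℝ) ^ (P.ε / 2), ?_⟩ ⟨t, ht, o, rfl⟩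
  rintro _ ⟨t, -, o, rfl⟩
  exact hP.z_le' (hP.β₁_le_state t o)

theorem w_le_wMax {t : ℕ} (o : Fin t → Obs K) (ht : t < T) : P.w (P.state t o) ≤ P.wMax T := by
  refine le_csSup ⟨P.σ ^ (3 / P.ε) * (1 - P.α) ^ (-2 : ℝ) * d, ?_⟩ ⟨t, ht, o, rfl⟩
  rintro _ ⟨t, -, o, rfl⟩
  exact hP.w_le (hP.β₁_le_state t o)

variable (hT : 1 ≤ T)
include hT

theorem zMax_pos : 0 < P.zMax T :=
  (hP.z_pos (hP.β₁_le_state 0 Fin.elim0)).trans_le (hP.z_le_zMax Fin.elim0 hT)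

theorem wMax_pos : 0 < P.wMax T :=
  (hP.w_pos (hP.β₁_le_state 0 Fin.elim0)).trans_le (hP.w_le_wMax Fin.elim0 hT)

theorem zMax_le : P.zMax T ≤ (1 - P.α) ^ (1 - P.ε) * P.σ * (d : ℝ) ^ (P.ε / 2) := by
  refine csSup_le ⟨_, 0, hT, Fin.elim0, rfl⟩ ?_
  rintro _ ⟨t, -, o, rfl⟩
  exact hP.z_le' (hP.β₁_le_state t o)

theorem wMax_le : P.wMax T ≤ P.σ ^ (3 / P.ε) * (1 - P.α) ^ (-2 : ℝ) * d := by
  refine csSup_le ⟨_, 0, hT, Fin.elim0, rfl⟩ ?_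
  rintro _ ⟨t, -, o, rfl⟩
  exact hP.w_le (hP.β₁_le_state t o)

theorem h₁_mul_zMax_le : P.h₁ ^ (1 - 1 / P.ε) * P.zMax T ^ (1 / P.ε) ≤
    (P.α * (1 - P.α)) ^ (1 / P.ε - 1) * P.σ ^ (1 / P.ε) * (d : ℝ) ^ (1 / 2 : ℝ) *
      (K : ℝ) ^ ((1 - P.α) * (1 - 1 / P.ε)) := by
  have hα := hP.α_pos
  have hu := hP.one_sub_α_pos
  have hσ := hP.σ_pos
  have hd := hP.d_pos
  have hε := hP.ε_pos
  have hK := hP.K_pos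
  have hexp : 0 ≤ 1 - 1 / P.ε := by
    rw [sub_nonneg, div_le_one hε]; exact hP.one_lt_ε.le
  have h1 := Real.rpow_le_rpow hP.h₁_pos.le hP.h₁_le hexp
  have h2 := Real.rpow_le_rpow (hP.zMax_pos hT).le (hP.zMax_le hT) (by positivity : 0 ≤ 1 / P.ε)
  refine (mul_le_mul h1 h2 (Real.rpow_nonneg (hP.zMax_pos hT).le _) (by positivity)).trans
    (le_of_eq ?_)
  rw [Real.mul_rpow (by positivity) (by positivity), Real.mul_rpow (by positivity) (by positivity),
    Real.mul_rpow (by positivity) (by positivity), Real.mul_rpow hα.le hu.le,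
    ← Real.rpow_mul hK.le, ← Real.rpow_mul hu.le, ← Real.rpow_mul hd.le, one_div P.α,
    Real.inv_rpow hα.le, ← Real.rpow_neg hα.le, neg_sub]
  have e1 : (1 - P.ε) * (1 / P.ε) = 1 / P.ε - 1 := by field_simp
  have e2 : P.ε / 2 * (1 / P.ε) = 1 / 2 := by field_simp
  rw [e1, e2]
  ring

theorem h₁_mul_wMax_le : P.h₁ ^ (2 / 3 : ℝ) * P.wMax T ^ (1 / 3 : ℝ) ≤
    (P.α * (1 - P.α)) ^ (-2 / 3 : ℝ) * P.σ ^ (1 / P.ε) * (d : ℝ) ^ (1 / 3 : ℝ) *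
      (K : ℝ) ^ (2 * (1 - P.α) / 3) := by
  have hα := hP.α_pos
  have hu := hP.one_sub_α_pos
  have hσ := hP.σ_pos
  have hd := hP.d_pos
  have hK := hP.K_pos
  have h1 := Real.rpow_le_rpow hP.h₁_pos.le hP.h₁_le (by norm_num : (0 : ℝ) ≤ 2 / 3)
  have h2 := Real.rpow_le_rpow (hP.wMax_pos hT).le (hP.wMax_le hT)
    (by norm_num : (0 : ℝ) ≤ 1 / 3)
  refine (mul_le_mul h1 h2 (Real.rpow_nonneg (hP.wMax_pos hT).le _) (by positivity)).trans
    (le_of_eq ?_)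
  rw [Real.mul_rpow (by positivity) (by positivity), Real.mul_rpow (by positivity) (by positivity),
    Real.mul_rpow (by positivity) (by positivity), Real.mul_rpow hα.le hu.le,
    ← Real.rpow_mul hK.le, ← Real.rpow_mul hu.le, ← Real.rpow_mul hσ.le, one_div P.α,
    Real.inv_rpow hα.le, ← Real.rpow_neg hα.le]
  have e1 : (-2 : ℝ) * (1 / 3) = -2 / 3 := by norm_num
  have e2 : -(2 / 3 : ℝ) = -2 / 3 := by norm_num
  have e3 : 3 / P.ε * (1 / 3) = 1 / P.ε := by ring
  have e4 : (1 - P.α) * (2 / 3) = 2 * (1 - P.α) / 3 := by ring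
  rw [e1, e2, e3, e4]
  ring

end Max

end IsAdmissible

end Params

/-! ### Measurability and boundedness of the state. -/

theorem continuous_featMean {K d : ℕ} (φ : Fin K → Fin d → ℝ) : Continuous (featMean φ) := by
  unfold featMean; fun_prop

theorem continuous_centered {K d : ℕ} (φ : Fin K → Fin d → ℝ) (a : Fin K) :
    Continuous fun p => centered φ p a := by
  unfold centered
  exact continuous_const.sub (continuous_featMean φ)

theorem continuous_featCov {K d : ℕ} (φ : Fin K → Fin d → ℝ) : Continuous (featCov φ) := by
  have e : featCov φ = fun p => ∑ a, p a • Matrix.vecMulVec (centered φ p a) (centered φ p a) := rfl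
  rw [e]
  refine continuous_finsetSum _ fun a _ => (continuous_apply a).smul ?_
  exact (continuous_centered φ a).matrix_vecMulVec (continuous_centered φ a)

/-- Cramer's rule writes the inverse as det⁻¹ times the adjugate, so measurability holds also across
singular covariances. -/
theorem measurable_leverage {K d : ℕ} (φ : Fin K → Fin d → ℝ) (a b : Fin K) :
    Measurable fun p => leverage φ p a b := by
  simp only [leverage, Matrix.inv_def, Ring.inverse_eq_inv', Matrix.smul_mulVec, dotProduct_smul,
    smul_eq_mul]
  refine (continuous_featCov φ).matrix_det.measurable.inv.mul (Continuous.measurable ?_)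
  exact (continuous_centered φ a).dotProduct
    ((continuous_featCov φ).matrix_adjugate.matrix_mulVec (continuous_centered φ b))

theorem measurable_leverage_prod {K d : ℕ} (φ : Fin K → Fin d → ℝ) (a : Fin K) :
    Measurable fun x : (Fin K → ℝ) × Fin K => leverage φ x.1 a x.2 :=
  measurable_from_prod_countable_left fun b => measurable_leverage φ a b

theorem continuous_qStar {K : ℕ} : Continuous (qStar : (Fin K → ℝ) → ℝ) := by
  unfold qStar; fun_prop

namespace Params

variable {K d : ℕ} {P : Params K d}

/-- A random state that depends measurably on the outcome and has a valid learning rate. -/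
structure MeasurableState {Ω : Type*} [MeasurableSpace Ω] (P : Params K d) (F : Ω → State K) :
    Prop where
  measurable_L : Measurable fun ω => (F ω).L
  measurable_β : Measurable fun ω => (F ω).β
  le_β : ∀ ω, P.β₁ ≤ (F ω).β

namespace MeasurableState

variable {Ω : Type*} [MeasurableSpace Ω] {F : Ω → State K} (hF : P.MeasurableState F)
  (hP : P.IsAdmissible)
include hF

theorem comp {Ω' : Type*} [MeasurableSpace Ω'] {f : Ω' → Ω} (hf : Measurable f) :
    P.MeasurableState (F ∘ f) :=
  ⟨hF.measurable_L.comp hf, hF.measurable_β.comp hf, fun _ => hF.le_β _⟩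

include hP

theorem q : Measurable fun ω => P.q (F ω) := by
  have h := hP.continuous_q.measurable.comp (hF.measurable_L.prodMk hF.measurable_β)
  have e : ∀ ω, (⟨(F ω).L, max (F ω).β P.β₁⟩ : State K) = F ω := fun ω => by
    rw [max_eq_left (hF.le_β ω)]
  simpa only [Function.comp_def, e] using h

theorem qS : Measurable fun ω => qStar (P.q (F ω)) :=
  continuous_qStar.measurable.comp (hF.q hP)

theorem γ : Measurable fun ω => P.γ (F ω) := by
  have := hF.qS hP
  have := hF.measurable_β
  unfold Params.γ
  fun_prop

theorem s : Measurable fun ω => P.s (F ω) := by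
  have := hF.qS hP
  have := hF.measurable_β
  unfold Params.s
  fun_prop

theorem p : Measurable fun ω => P.p (F ω) := by
  have := hF.γ hP
  have := hF.q hP
  unfold Params.p
  fun_prop

theorem bonus (a : Fin K) : Measurable fun ω => P.bonus (F ω) a := by
  have h1 := hF.s hP
  have h2 := hF.p hP
  have h3 : ∀ b, Measurable fun ω => leverage P.φ (P.p (F ω)) a b := fun b =>
    (measurable_leverage P.φ a b).comp h2
  have h4 : ∀ b, Measurable fun ω => |leverage P.φ (P.p (F ω)) a b| := fun b => (h3 b).abs
  unfold Params.bonus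
  fun_prop

theorem lossHat {o : Ω → Obs K} (ho : Measurable o) (a : Fin K) :
    Measurable fun ω => P.lossHat (F ω) (o ω) a := by
  have h1 := hF.s hP
  have h2 : Measurable fun ω => P.lossTilde (F ω) (o ω) a := by
    have := (measurable_leverage_prod P.φ a).comp ((hF.p hP).prodMk (measurable_fst.comp ho))
    exact this.mul (measurable_snd.comp ho)
  unfold Params.lossHat
  exact Measurable.ite (measurableSet_le h2.abs h1) h2 measurable_const

theorem tsallis {r : ℝ} : Measurable fun ω => tsallis r (P.q (F ω)) := by
  have h := hF.q hP
  have h' : ∀ a, Measurable fun ω => P.q (F ω) a := fun a => (measurable_pi_apply a).comp h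
  unfold HTLinearBandit.tsallis
  fun_prop

theorem h : Measurable fun ω => P.h (F ω) := (hF.tsallis hP).neg

theorem z : Measurable fun ω => P.z (F ω) := by
  have := hF.qS hP
  have := (hF.p hP).norm
  unfold Params.z
  fun_prop

theorem w : Measurable fun ω => P.w (F ω) := by
  have := hF.qS hP
  unfold Params.w
  fun_prop

theorem next {o : Ω → Obs K} (ho : Measurable o) :
    P.MeasurableState fun ω => P.next (F ω) (o ω) where
  measurable_L := measurable_pi_lambda _ fun a =>
    ((measurable_pi_apply a).comp hF.measurable_L).add
      ((hF.lossHat hP ho a).sub (hF.bonus hP a))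
  measurable_β := by
    have := hF.measurable_β
    have := hF.h hP
    have := hF.z hP
    have := hF.w hP
    simp only [Params.next]
    fun_prop
  le_β ω := (hF.le_β ω).trans (hP.β_le_next (hF.le_β ω) _)

end MeasurableState

theorem measurable_init {α : Type*} [MeasurableSpace α] {t : ℕ} :
    Measurable fun o : Fin (t + 1) → α => (Fin.init o : Fin t → α) :=
  measurable_pi_lambda _ fun _ => measurable_pi_apply _

namespace IsAdmissible

variable (hP : P.IsAdmissible)
include hP

theorem measurableState : ∀ t, P.MeasurableState (P.state t)
  | 0 => ⟨measurable_const, measurable_const, hP.β₁_le_state 0⟩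
  | t + 1 => ((measurableState t).comp measurable_init).next hP
      (measurable_pi_apply (Fin.last t))

/-- The kernel that samples from `p_t`. -/
noncomputable def policy (t : ℕ) : Kernel (Fin t → Obs K) (Fin K) where
  toFun o := ∑ a, ENNReal.ofReal (P.p (P.state t o) a) • Measure.dirac a
  measurable' := by
    refine Measure.measurable_of_measurable_coe _ fun s hs => ?_
    simp only [Measure.coe_finsetSum, Finset.sum_apply, Measure.smul_apply, smul_eq_mul]
    refine Finset.measurable_sum _ fun a _ => Measurable.mul_const ?_ _
    exact ((measurable_pi_apply a).comp ((hP.measurableState t).p hP)).ennreal_ofReal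

theorem exists_isRunBy : ∃ alg : Algorithm K, P.IsRunBy alg := by
  have key : ∀ t o a, hP.policy t o {a} = ENNReal.ofReal (P.p (P.state t o) a) := by
    intro t o a
    change (∑ b, ENNReal.ofReal (P.p (P.state t o) b) • Measure.dirac b) {a} = _
    simp [Set.indicator_apply, eq_comm]
  refine ⟨⟨hP.policy, fun t => ⟨fun o => ⟨?_⟩⟩⟩, key⟩
  rw [← Finset.coe_univ, ← sum_measure_singleton]
  simp only [key]
  rw [← ENNReal.ofReal_sum_of_nonneg fun a _ => (hP.p_pos (hP.β₁_le_state t o) a).le, hP.p_sum,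
    ENNReal.ofReal_one]

/-- A continuous positive function on a compact ball is bounded below. -/
theorem exists_qStar_lower_bound (B : ℝ) : ∃ η, 0 < η ∧ ∀ st : State K, P.β₁ ≤ st.β →
    ‖(st.L, st.β)‖ ≤ B → η ≤ qStar (P.q st) := by
  rcases (Metric.closedBall (0 : (Fin K → ℝ) × ℝ) B).eq_empty_or_nonempty with hne | hne
  · refine ⟨1, one_pos, fun st _ h => ?_⟩
    have : (st.L, st.β) ∈ Metric.closedBall (0 : (Fin K → ℝ) × ℝ) B := by simpa using h
    rw [hne] at this
    exact this.elim
  · obtain ⟨x, -, hx⟩ := (isCompact_closedBall (0 : (Fin K → ℝ) × ℝ) B).exists_isMinOn hne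
      (continuous_qStar.comp hP.continuous_q).continuousOn
    refine ⟨_, hP.qS_pos (st := ⟨x.1, max x.2 P.β₁⟩) (le_max_right _ _), fun st hβ h => ?_⟩
    have := hx (show (st.L, st.β) ∈ Metric.closedBall (0 : (Fin K → ℝ) × ℝ) B by simpa using h)
    simpa [max_eq_left hβ] using this

/-- Losses are unbounded, but clipped estimates are not. By induction the states of a fixed round
are bounded over all histories, with no uniformity in t; this is used only for integrability. -/
theorem exists_state_bound : ∀ t, ∃ B, ∀ o : Fin t → Obs K,
    ‖((P.state t o).L, (P.state t o).β)‖ ≤ B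
  | 0 => ⟨‖((P.state₁).L, (P.state₁).β)‖, fun _ => le_rfl⟩
  | t + 1 => by
    obtain ⟨B, hB⟩ := exists_state_bound t
    obtain ⟨η, hη, hq⟩ := hP.exists_qStar_lower_bound B
    have hu := hP.one_sub_α_pos
    refine ⟨B + 2 * ((1 - P.α) * B * η ^ (P.α - 1) / 8) +
      1 / 16 * P.βbar * η ^ (P.αbar - P.α), fun o => ?_⟩
    set st := P.state t (Fin.init o) with hst
    have hβ : P.β₁ ≤ st.β := hP.β₁_le_state t _
    have hβ0 := hP.β_pos hβ
    have hqS := hq st hβ (hB _)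
    have hBst : ‖(st.L, st.β)‖ ≤ B := hB _
    rw [Prod.norm_mk, max_le_iff] at hBst
    have hβB : st.β ≤ B := (le_abs_self _).trans hBst.2
    have hB0 : 0 ≤ B := hβ0.le.trans hβB
    have hs : P.s st ≤ (1 - P.α) * B * η ^ (P.α - 1) / 8 := by
      have := Real.rpow_le_rpow_of_nonpos hη hqS (by linarith : P.α - 1 ≤ 0)
      have := hη.trans_le hqS
      unfold s
      gcongr
    have hs0 := hP.s_pos hβ
    have hδ : (P.next st (o (Fin.last t))).β - st.β ≤
        1 / 16 * P.βbar * η ^ (P.αbar - P.α) := by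
      have := Real.rpow_le_rpow_of_nonpos hη hqS
        (by linarith [hP.αbar_le, hP.half_le_α] : P.αbar - P.α ≤ 0)
      have := hP.βbar_pos
      refine (hP.next_β_sub_le hβ _).trans ?_
      gcongr
    have hδ0 := hP.β_le_next hβ (o (Fin.last t))
    have hR : 0 ≤ 1 / 16 * P.βbar * η ^ (P.αbar - P.α) := by linarith
    change ‖((P.next st (o (Fin.last t))).L, (P.next st (o (Fin.last t))).β)‖ ≤ _
    rw [Prod.norm_mk, max_le_iff]
    constructor
    · rw [pi_norm_le_iff_of_nonneg (by linarith)]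
      intro a
      have h1 := hP.abs_lossHat_sub_bonus_le hβ (o (Fin.last t)) a
      have h2 := norm_le_pi_norm st.L a
      have h3 := norm_add_le (st.L a) (P.lossHat st (o (Fin.last t)) a - P.bonus st a)
      simp only [next]
      rw [Real.norm_eq_abs (_ - _)] at h3
      linarith [hBst.1]
    · rw [Real.norm_of_nonneg (by linarith)]
      linarith

theorem exists_s_bound (t : ℕ) : ∃ M, ∀ o : Fin t → Obs K, P.s (P.state t o) ≤ M := by
  obtain ⟨B, hB⟩ := hP.exists_state_bound t
  obtain ⟨η, hη, hq⟩ := hP.exists_qStar_lower_bound B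
  refine ⟨(1 - P.α) * B * η ^ (P.α - 1) / 8, fun o => ?_⟩
  have hβ := hP.β₁_le_state t o
  have hu := hP.one_sub_α_pos
  have h1 := Real.rpow_le_rpow_of_nonpos hη (hq _ hβ (hB o)) (by linarith : P.α - 1 ≤ 0)
  have h2 := hB o
  rw [Prod.norm_mk, max_le_iff] at h2
  have h3 : (P.state t o).β ≤ B := (le_abs_self _).trans h2.2
  have h4 := hP.β_pos hβ
  have h5 : 0 ≤ B := h4.le.trans h3
  have h6 := hP.qS_pos hβ
  unfold s
  gcongr

end IsAdmissible

end Params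

/-! ### Pathwise regret of follow-the-regularized-leader. -/

namespace Params

variable {K d : ℕ} {P : Params K d}

/-- The states along an infinite sequence of observations. -/
noncomputable def traj (P : Params K d) (o : ℕ → Obs K) (t : ℕ) : State K :=
  P.state t fun i => o i

theorem traj_succ (o : ℕ → Obs K) (t : ℕ) : P.traj o (t + 1) = P.next (P.traj o t) (o t) := rfl

/-- The shifted loss estimate of a round. -/
noncomputable def est (P : Params K d) (st : State K) (o : Obs K) (a : Fin K) : ℝ :=
  P.lossHat st o a - P.bonus st a

/-- The bound on the stability term of a round. -/
noncomputable def stab (P : Params K d) (st : State K) (o : Obs K) : ℝ :=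
  9 / 2 * qStar (P.q st) ^ (1 - P.α) / (st.β * (1 - P.α)) *
    ∑ a, P.q st a * P.est st o a ^ 2

/-- The increment of `β` times the entropy: `β ^ (1 - ε) z + β ^ (-2) w`. -/
noncomputable def incr (P : Params K d) (st : State K) : ℝ :=
  st.β ^ (1 - P.ε) * P.z st + st.β ^ (-2 : ℝ) * P.w st

theorem tsallis_single {r : ℝ} (hr : r ≠ 0) (a : Fin K) :
    tsallis r (Pi.single a 1 : Fin K → ℝ) = 0 := by
  rw [tsallis, Finset.sum_eq_zero, mul_zero]
  intro b _
  rcases eq_or_ne b a with rfl | h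
  · simp
  · simp [h, Real.zero_rpow hr]

namespace IsAdmissible

variable (hP : P.IsAdmissible)
include hP

theorem β₁_le_traj (o : ℕ → Obs K) (t : ℕ) : P.β₁ ≤ (P.traj o t).β := hP.β₁_le_state t _

theorem incr_nonneg {st : State K} (hβ : P.β₁ ≤ st.β) : 0 ≤ P.incr st := hP.increment_nonneg hβ

/-- The minimal value of the objective is the potential. Its increase is controlled by the
divergence at the old minimizer, and raising β costs the entropy of the new iterate. -/
theorem ftrl_step {st : State K} (hβ : P.β₁ ≤ st.β) (o : Obs K) :
    ∑ a, P.q st a * P.est st o a - P.stab st o + P.objective st (P.q st) ≤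
      P.objective (P.next st o) (P.q (P.next st o)) +
        ((P.next st o).β - st.β) * P.h (P.next st o) := by
  set st' := P.next st o with hst'
  have hβ0 := hP.β_pos hβ
  have hβ1 : P.β₁ ≤ st'.β := hβ.trans (hP.β_le_next hβ o)
  have hu := hP.one_sub_α_pos
  have hq' : ∀ a, 0 ≤ P.q st' a := hP.q_nonneg st'
  have h1 := hP.objective_sub_q hβ0 (hP.q_sum st')
  have h2 := stability_sum hP.two_le_K hP.half_le_α hP.α_lt_one hβ0 (hP.q_pos hβ0) (hP.q_sum st)
    hq' (hP.q_sum st') (g := P.est st o) fun a => by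
      refine (hP.abs_lossHat_sub_bonus_le hβ o a).trans (le_of_eq ?_)
      rw [s]; ring
  have hb : 0 ≤ P.βbar * ∑ a, breg P.αbar (P.q st' a) (P.q st a) :=
    mul_nonneg hP.βbar_pos.le (Finset.sum_nonneg fun a _ => breg_nonneg hP.αbar_pos
      (by linarith [hP.αbar_le_half]) (hq' a) (hP.q_pos hβ0 a))
  have h3 : P.objective st' (P.q st') = P.objective st (P.q st') +
      ∑ a, P.est st o a * P.q st' a - (st'.β - st.β) * P.h st' := by
    have : ∑ a, st'.L a * P.q st' a = ∑ a, st.L a * P.q st' a +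
        ∑ a, P.est st o a * P.q st' a := by
      rw [← Finset.sum_add_distrib]
      exact Finset.sum_congr rfl fun a _ => by rw [hst', next, est]; ring
    rw [objective, objective, this, h]
    ring
  have h4 : ∑ a, P.est st o a * (P.q st a - P.q st' a) =
      ∑ a, P.q st a * P.est st o a - ∑ a, P.est st o a * P.q st' a := by
    rw [← Finset.sum_sub_distrib]
    exact Finset.sum_congr rfl fun a _ => by ring
  rw [h4] at h2
  change _ ≤ P.stab st o at h2
  linarith

/-- The comparator is a vertex, where both entropies vanish, so no smoothing of the comparator is
needed. The factor 6 replaces h_{t+1} by h_t. -/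
theorem ftrl_regret (o : ℕ → Obs K) (a : Fin K) (T : ℕ) :
    ∑ t ∈ Finset.range T, (∑ b, P.q (P.traj o t) b * P.est (P.traj o t) (o t) b -
        P.est (P.traj o t) (o t) a - P.stab (P.traj o t) (o t)) ≤
      P.β₁ * P.h₁ + P.βbar * P.hbar + 6 * ∑ t ∈ Finset.range T, P.incr (P.traj o t) := by
  have key : ∀ T, ∑ t ∈ Finset.range T, (∑ b, P.q (P.traj o t) b * P.est (P.traj o t) (o t) b -
      P.stab (P.traj o t) (o t)) ≤ P.objective (P.traj o T) (P.q (P.traj o T)) +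
        P.β₁ * P.h₁ + P.βbar * P.hbar + 6 * ∑ t ∈ Finset.range T, P.incr (P.traj o t) := by
    intro T
    induction T with
    | zero =>
      have : P.traj o 0 = P.state₁ := rfl
      simp only [Finset.range_zero, Finset.sum_empty, mul_zero, add_zero, this, h₁, h, hbar,
        objective]
      simp [state₁]
    | succ T ih =>
      have hβ := hP.β₁_le_traj o T
      have h1 := hP.ftrl_step hβ (o T)
      have h2 := hP.h_next_le hβ (o T)
      have h3 := hP.next_β_sub hβ (o T)
      have h4 := hP.β_le_next hβ (o T)
      have h5 : ((P.next (P.traj o T) (o T)).β - (P.traj o T).β) *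
          P.h (P.next (P.traj o T) (o T)) ≤ 6 * P.incr (P.traj o T) := by
        rw [incr, ← h3]
        nlinarith
      rw [Finset.sum_range_succ, Finset.sum_range_succ, traj_succ]
      linarith
  have hL : ∀ T, (P.traj o T).L a = ∑ t ∈ Finset.range T, P.est (P.traj o t) (o t) a := by
    intro T
    induction T with
    | zero => rfl
    | succ T ih => rw [Finset.sum_range_succ, ← ih, traj_succ]; rfl
  have hle := hP.objective_q_le (P.traj o T) (single_mem_stdSimplex ℝ a)
  have hobj : P.objective (P.traj o T) (Pi.single a 1) = (P.traj o T).L a := by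
    rw [objective, tsallis_single hP.α_pos.ne', tsallis_single hP.αbar_pos.ne']
    simp [Pi.single_apply]
  have h1 := key T
  have e : ∑ t ∈ Finset.range T, (∑ b, P.q (P.traj o t) b * P.est (P.traj o t) (o t) b -
        P.est (P.traj o t) (o t) a - P.stab (P.traj o t) (o t)) =
      ∑ t ∈ Finset.range T, (∑ b, P.q (P.traj o t) b * P.est (P.traj o t) (o t) b -
        P.stab (P.traj o t) (o t)) - (P.traj o T).L a := by
    rw [hL, ← Finset.sum_sub_distrib]
    exact Finset.sum_congr rfl fun t _ => by ring
  rw [e]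
  linarith

omit hP in
-- The convention β_0 = 0 makes the first round contribute β₁ h₁; the case distinction avoids the
-- truncated subtraction 0 - 1.
theorem roundBound_traj (o : ℕ → Obs K) (t : ℕ) : P.roundBound t (fun i => o i) =
    (if t = 0 then P.β₁ * P.h₁ else
      ((P.traj o t).β - (P.traj o (t - 1)).β) * P.h (P.traj o t)) + P.incr (P.traj o t) := by
  cases t with
  | zero =>
    simp only [roundBound, betaPrev, incr, if_true, sub_zero]
    change P.β₁ * P.h₁ + _ + _ = _
    rw [add_assoc]; rfl
  | succ t =>
    rw [if_neg (Nat.succ_ne_zero t), incr, ← add_assoc]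
    rfl

theorem incr_le_roundBound (o : ℕ → Obs K) (t : ℕ) :
    P.incr (P.traj o t) + (if t = 0 then P.β₁ * P.h₁ else 0) ≤ P.roundBound t (fun i => o i) := by
  rw [roundBound_traj]
  rcases t with - | t
  · simp [add_comm]
  · have hβ := hP.β₁_le_traj o t
    have h1 := hP.β_le_next hβ (o t)
    have h2 := (hP.h_pos (hP.β₁_le_traj o (t + 1))).le
    simp only [Nat.succ_ne_zero, if_false, Nat.add_sub_cancel, add_zero]
    rw [traj_succ] at h2 ⊢
    nlinarith

theorem sum_incr_le_sum_roundBound (o : ℕ → Obs K) {T : ℕ} (hT : 1 ≤ T) :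
    P.β₁ * P.h₁ + ∑ t ∈ Finset.range T, P.incr (P.traj o t) ≤
      ∑ t ∈ Finset.range T, P.roundBound t (fun i => o i) := by
  have h := Finset.sum_le_sum fun t (_ : t ∈ Finset.range T) => hP.incr_le_roundBound o t
  rw [Finset.sum_add_distrib, Finset.sum_ite_eq' (Finset.range T) 0 fun _ => P.β₁ * P.h₁,
    if_pos (Finset.mem_range.mpr hT)] at h
  linarith

theorem roundBound_succ_le (o : ℕ → Obs K) (t : ℕ) : P.roundBound (t + 1) (fun i => o i) ≤
    6 * P.incr (P.traj o t) + P.incr (P.traj o (t + 1)) := by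
  have hβ := hP.β₁_le_traj o t
  have h1 := hP.β_le_next hβ (o t)
  have h2 := hP.h_next_le hβ (o t)
  have h3 := hP.next_β_sub hβ (o t)
  rw [roundBound_traj, if_neg (Nat.succ_ne_zero t), Nat.add_sub_cancel]
  have : ((P.traj o (t + 1)).β - (P.traj o t).β) * P.h (P.traj o (t + 1)) ≤
      6 * P.incr (P.traj o t) := by
    rw [traj_succ, incr, ← h3]
    nlinarith
  linarith

/-- Supplies the dominating function for the expected round-wise bound; without integrability that
integral would be 0 by convention. -/
theorem sum_roundBound_le (o : ℕ → Obs K) (T : ℕ) :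
    ∑ t ∈ Finset.range T, P.roundBound t (fun i => o i) ≤
      P.β₁ * P.h₁ + 7 * ∑ t ∈ Finset.range T, P.incr (P.traj o t) := by
  have h₁n := mul_nonneg hP.β₁_pos.le hP.h₁_pos.le
  have key : ∀ T, ∑ t ∈ Finset.range (T + 1), P.roundBound t (fun i => o i) ≤
      P.β₁ * P.h₁ + 6 * ∑ t ∈ Finset.range T, P.incr (P.traj o t) +
        ∑ t ∈ Finset.range (T + 1), P.incr (P.traj o t) := by
    intro T
    induction T with
    | zero => simp [roundBound_traj]
    | succ T ih =>
      rw [Finset.sum_range_succ, Finset.sum_range_succ _ (T + 1),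
        Finset.sum_range_succ (fun t => P.incr (P.traj o t)) T]
      rw [Finset.sum_range_succ (fun t => P.incr (P.traj o t)) T] at ih
      have := hP.roundBound_succ_le o T
      linarith
  rcases T with - | T
  · simpa using h₁n
  · have h := key T
    have := hP.incr_nonneg (hP.β₁_le_traj o T)
    rw [Finset.sum_range_succ (fun t => P.incr (P.traj o t)) T] at h ⊢
    linarith

theorem incr_le (o : ℕ → Obs K) {t T : ℕ} (ht : t < T) : P.incr (P.traj o t) ≤
    P.zMax T * P.β₁ ^ (1 - P.ε) + P.wMax T * P.β₁ ^ (-2 : ℝ) := by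
  have hβ := hP.β₁_le_traj o t
  have hb := hP.β₁_pos
  have h1 : (P.traj o t).β ^ (1 - P.ε) ≤ P.β₁ ^ (1 - P.ε) :=
    Real.rpow_le_rpow_of_nonpos hb hβ (by linarith [hP.one_lt_ε])
  have h2 : (P.traj o t).β ^ (-2 : ℝ) ≤ P.β₁ ^ (-2 : ℝ) :=
    Real.rpow_le_rpow_of_nonpos hb hβ (by norm_num)
  have h3 : P.z (P.traj o t) ≤ P.zMax T := hP.z_le_zMax _ ht
  have h4 : P.w (P.traj o t) ≤ P.wMax T := hP.w_le_wMax _ ht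
  have h5 := hP.z_pos hβ
  have h6 := hP.w_pos hβ
  have h7 := hP.β_pos hβ
  have h8 := h5.trans_le h3
  have h9 := h6.trans_le h4
  rw [incr, mul_comm _ (P.z _), mul_comm _ (P.w _)]
  gcongr

end IsAdmissible

end Params

/-! ### The conditional expectation of one round. -/

section Product

variable {K : ℕ} {π : Measure (Fin K)} [IsProbabilityMeasure π] {ν : Measure (Fin K → ℝ)}
  [IsProbabilityMeasure ν]

theorem integrable_prod_fin {F : Outcome K → ℝ} (hF : Measurable F)
    (hi : ∀ a, Integrable (fun l => F (a, l)) ν) : Integrable F (π.prod ν) := by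
  rw [integrable_prod_iff hF.aestronglyMeasurable]
  exact ⟨Filter.Eventually.of_forall hi, Integrable.of_finite⟩

theorem integral_prod_fin {F : Outcome K → ℝ} (hF : Measurable F)
    (hi : ∀ a, Integrable (fun l => F (a, l)) ν) :
    ∫ o, F o ∂(π.prod ν) = ∑ a, π.real {a} * ∫ l, F (a, l) ∂ν := by
  rw [integral_prod _ (integrable_prod_fin hF hi), integral_fintype Integrable.of_finite]
  simp only [smul_eq_mul]

end Product

section Clipping

/-- A clipped value exceeds s, so |y| = |y|^ε |y|^(1-ε) ≤ |y|^ε s^(1-ε). -/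
theorem abs_sub_clip_le {ε s y : ℝ} (hε : 1 ≤ ε) (hs : 0 < s) :
    |(if |y| ≤ s then y else 0) - y| ≤ |y| ^ ε * s ^ (1 - ε) := by
  split_ifs with h
  · rw [sub_self, abs_zero]; positivity
  · push Not at h
    have hy : 0 < |y| := hs.trans h
    rw [zero_sub, abs_neg]
    have h1 : |y| ^ (1 - ε) ≤ s ^ (1 - ε) := Real.rpow_le_rpow_of_nonpos hs h.le (by linarith)
    calc |y| = |y| ^ ε * |y| ^ (1 - ε) := by rw [← Real.rpow_add hy]; simp
      _ ≤ _ := by gcongr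

/-- Below the threshold y² ≤ |y|^ε s^(2-ε). Written with s^(1-ε) * s, the second moment becomes s
times the quantity that bounds the bias. -/
theorem clip_sq_le {ε s y : ℝ} (hε : ε ≤ 2) (hs : 0 < s) :
    (if |y| ≤ s then y else 0) ^ 2 ≤ |y| ^ ε * (s ^ (1 - ε) * s) := by
  have e : s ^ (1 - ε) * s = s ^ (2 - ε) := by
    rw [← Real.rpow_add_one hs.ne']; congr 1; ring
  rw [e]
  split_ifs with h
  · rcases (abs_nonneg y).eq_or_lt with hy | hy
    · rw [← sq_abs, ← hy, zero_pow two_ne_zero]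
      exact mul_nonneg (Real.rpow_nonneg le_rfl _) (Real.rpow_nonneg hs.le _)
    · have h1 : |y| ^ (2 - ε) ≤ s ^ (2 - ε) := Real.rpow_le_rpow hy.le h (by linarith)
      calc y ^ 2 = |y| ^ ε * |y| ^ (2 - ε) := by
            rw [← Real.rpow_add hy, ← sq_abs, ← Real.rpow_two]; congr 1; ring
        _ ≤ _ := by gcongr
  · rw [zero_pow two_ne_zero]
    exact mul_nonneg (Real.rpow_nonneg (abs_nonneg _) _) (Real.rpow_nonneg hs.le _)

/-- Jensen's inequality. It bounds the mean losses, and thereby the cost of exploration. -/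
theorem abs_integral_le_rpow {Ω : Type*} [MeasurableSpace Ω] {ν : Measure Ω}
    [IsProbabilityMeasure ν] {f : Ω → ℝ} (hf : Integrable f ν) {ε σ : ℝ} (hε : 1 ≤ ε)
    (hi : Integrable (fun x => |f x| ^ ε) ν) (hσ : ∫ x, |f x| ^ ε ∂ν ≤ σ) :
    |∫ x, f x ∂ν| ≤ σ ^ (1 / ε) := by
  have h0 : 0 < ε := by linarith
  refine (abs_integral_le_integral_abs (f := f)).trans ?_
  have h1 : (∫ x, |f x| ∂ν) ^ ε ≤ σ := by
    refine le_trans ?_ hσ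
    exact (convexOn_rpow hε).map_integral_le (Real.continuous_rpow_const h0.le).continuousOn
      isClosed_Ici (Filter.Eventually.of_forall fun x => abs_nonneg (f x)) hf.abs hi
  have h2 : 0 ≤ ∫ x, |f x| ∂ν := integral_nonneg fun x => abs_nonneg _
  have h3 := Real.rpow_le_rpow (Real.rpow_nonneg h2 ε) h1 (by positivity : 0 ≤ 1 / ε)
  rwa [← Real.rpow_mul h2, mul_one_div_cancel h0.ne', Real.rpow_one] at h3

end Clipping

namespace Params

variable {K d : ℕ} {P : Params K d}

/-- The regret of a round against `a`, minus what the analysis of the algorithm charges to it. -/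
noncomputable def excess (P : Params K d) (a : Fin K) (st : State K) (o : Outcome K) : ℝ :=
  o.2 o.1 - o.2 a - (∑ b, P.q st b * P.est st (o.1, o.2 o.1) b - P.est st (o.1, o.2 o.1) a -
    P.stab st (o.1, o.2 o.1)) - 512 * P.incr st

theorem MeasurableState.est {Ω : Type*} [MeasurableSpace Ω] {F : Ω → State K}
    (hF : P.MeasurableState F) (hP : P.IsAdmissible) {o : Ω → Obs K} (ho : Measurable o)
    (a : Fin K) : Measurable fun ω => P.est (F ω) (o ω) a :=
  (hF.lossHat hP ho a).sub (hF.bonus hP a)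

theorem MeasurableState.incr {Ω : Type*} [MeasurableSpace Ω] {F : Ω → State K}
    (hF : P.MeasurableState F) (hP : P.IsAdmissible) : Measurable fun ω => P.incr (F ω) := by
  have := hF.measurable_β
  have := hF.z hP
  have := hF.w hP
  unfold Params.incr
  fun_prop

theorem _root_.HTLinearBandit.measurable_obs :
    Measurable fun o : Outcome K => ((o.1, o.2 o.1) : Obs K) :=
  measurable_fst.prodMk (measurable_from_prod_countable_right fun a => measurable_pi_apply a)

theorem MeasurableState.excess {Ω : Type*} [MeasurableSpace Ω] {F : Ω → State K}
    (hF : P.MeasurableState F) (hP : P.IsAdmissible) {o : Ω → Outcome K} (ho : Measurable o)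
    (a : Fin K) : Measurable fun ω => P.excess a (F ω) (o ω) := by
  have h0 := measurable_obs.comp ho
  have h1 : Measurable fun ω => (o ω).2 (o ω).1 := measurable_snd.comp h0
  have h2 := fun b => hF.est hP h0 b
  have h3 := hF.qS hP
  have h4 := fun b => (measurable_pi_apply b).comp (hF.q hP)
  have h5 := hF.incr hP
  have h6 := hF.measurable_β
  have h7 : Measurable fun ω => (o ω).2 a :=
    (measurable_pi_apply a).comp (measurable_snd.comp ho)
  simp only [Function.comp_def] at h2 h4
  unfold Params.excess stab
  fun_prop

namespace IsAdmissible

variable (hP : P.IsAdmissible)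
include hP

/-- A bound on the part of the excess that does not come from the current losses. -/
noncomputable def _root_.HTLinearBandit.Params.excessBound (P : Params K d) (M : ℝ) : ℝ :=
  4 * M + 18 * M ^ 2 / (P.β₁ * (1 - P.α)) +
    1024 * ((1 - P.α) ^ (-2 : ℝ) * (d : ℝ) ^ P.ε * (P.β₁ ^ (1 - P.ε) * P.σ))

theorem abs_excess_le {st : State K} (hβ : P.β₁ ≤ st.β) {M : ℝ} (hM : P.s st ≤ M) (a : Fin K)
    (o : Outcome K) : |P.excess a st o| ≤ |o.2 o.1| + |o.2 a| + P.excessBound M := by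
  have hs := hP.s_pos hβ
  have hu := hP.one_sub_α_pos
  have hb := hP.β_pos hβ
  have hb1 := hP.β₁_pos
  have hqS := hP.qS_pos hβ
  have hσ := hP.σ_pos
  have hd := hP.d_pos
  have hg : ∀ c, |P.est st (o.1, o.2 o.1) c| ≤ 2 * M := fun c =>
    (hP.abs_lossHat_sub_bonus_le hβ _ c).trans (by linarith)
  have h1 : |∑ b, P.q st b * P.est st (o.1, o.2 o.1) b| ≤ 2 * M := by
    calc _ ≤ ∑ b, |P.q st b * P.est st (o.1, o.2 o.1) b| := Finset.abs_sum_le_sum_abs _ _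
      _ ≤ ∑ b, P.q st b * (2 * M) := Finset.sum_le_sum fun b _ => by
          rw [abs_mul, abs_of_nonneg (hP.q_nonneg st b)]
          exact mul_le_mul_of_nonneg_left (hg b) (hP.q_nonneg st b)
      _ = 2 * M := by rw [← Finset.sum_mul, hP.q_sum, one_mul]
  have h2 : ∑ b, P.q st b * P.est st (o.1, o.2 o.1) b ^ 2 ≤ 4 * M ^ 2 := by
    calc _ ≤ ∑ b, P.q st b * (4 * M ^ 2) := Finset.sum_le_sum fun b _ => by
          refine mul_le_mul_of_nonneg_left ?_ (hP.q_nonneg st b)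
          rw [← sq_abs]
          have := pow_le_pow_left₀ (abs_nonneg _) (hg b) 2
          linarith
      _ = _ := by rw [← Finset.sum_mul, hP.q_sum, one_mul]
  have h2n : 0 ≤ ∑ b, P.q st b * P.est st (o.1, o.2 o.1) b ^ 2 :=
    Finset.sum_nonneg fun b _ => mul_nonneg (hP.q_nonneg st b) (sq_nonneg _)
  have hq1 : qStar (P.q st) ^ (1 - P.α) ≤ 1 := Real.rpow_le_one hqS.le qS_le_one hu.le
  have h3 : P.stab st (o.1, o.2 o.1) ≤ 18 * M ^ 2 / (P.β₁ * (1 - P.α)) := by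
    calc P.stab st (o.1, o.2 o.1) ≤ 9 / 2 * 1 / (P.β₁ * (1 - P.α)) * (4 * M ^ 2) := by
          unfold stab; gcongr
      _ = _ := by ring
  have h3n : 0 ≤ P.stab st (o.1, o.2 o.1) := by
    unfold stab; positivity
  have h4 : P.incr st ≤ 2 * ((1 - P.α) ^ (-2 : ℝ) * (d : ℝ) ^ P.ε * (P.β₁ ^ (1 - P.ε) * P.σ)) := by
    refine (hP.increment_le hβ).trans ?_
    have : qStar (P.q st) ^ P.αbar ≤ 1 := Real.rpow_le_one hqS.le qS_le_one hP.αbar_pos.le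
    refine mul_le_mul_of_nonneg_left (mul_le_of_le_one_right (by positivity) this) two_pos.le
  have h4n := hP.incr_nonneg hβ
  have h5 := abs_le.mp h1
  have h6 := abs_le.mp (hg a)
  have h7 := neg_abs_le (o.2 o.1)
  have h8 := le_abs_self (o.2 o.1)
  have h9 := neg_abs_le (o.2 a)
  have h10 := le_abs_self (o.2 a)
  rw [excess, excessBound, abs_le]
  constructor <;> linarith

section OneRound

variable {st : State K} (hβ : P.β₁ ≤ st.β) {π : Measure (Fin K)} [IsProbabilityMeasure π]
  (hπ : ∀ a, π {a} = ENNReal.ofReal (P.p st a)) {ν : Measure (Fin K → ℝ)}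
  [IsProbabilityMeasure ν] {θ : Fin d → ℝ}
  (hi : ∀ a, Integrable (fun l => l a) ν) (hθ : ∀ a, ∫ l, l a ∂ν = P.φ a ⬝ᵥ θ)
  (hεi : ∀ a, Integrable (fun l => |l a| ^ P.ε) ν) (hσ : ∀ a, ∫ l, |l a| ^ P.ε ∂ν ≤ P.σ)

theorem measurable_lossHat_const (st : State K) (hβ : P.β₁ ≤ st.β) (c : Fin K) :
    Measurable fun o : Obs K => P.lossHat st o c :=
  MeasurableState.lossHat (F := fun _ : Obs K => st)
    ⟨measurable_const, measurable_const, fun _ => hβ⟩ hP measurable_id c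

include hβ in
theorem integrable_lossHat (b c : Fin K) : Integrable (fun l => P.lossHat st (b, l b) c) ν := by
  refine Integrable.of_bound (C := P.s st) ?_ (Filter.Eventually.of_forall fun l => ?_)
  · exact ((hP.measurable_lossHat_const st hβ c).comp
      (measurable_const.prodMk (measurable_pi_apply b))).aestronglyMeasurable
  · exact hP.abs_lossHat_le hβ _ c

include hβ in
theorem integrable_lossHat_sq (b c : Fin K) :
    Integrable (fun l => P.lossHat st (b, l b) c ^ 2) ν := by
  refine Integrable.of_bound (C := P.s st ^ 2) ?_ (Filter.Eventually.of_forall fun l => ?_)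
  · exact (((hP.measurable_lossHat_const st hβ c).comp
      (measurable_const.prodMk (measurable_pi_apply b))).pow_const 2).aestronglyMeasurable
  · rw [Real.norm_eq_abs, abs_pow]
    exact pow_le_pow_left₀ (abs_nonneg _) (hP.abs_lossHat_le hβ _ c) 2

include hi hθ hεi hσ hβ

omit hP [IsProbabilityMeasure π] [IsProbabilityMeasure ν] hi hθ hεi hσ in
theorem real_singleton (hP : P.IsAdmissible) (hπ : ∀ a, π {a} = ENNReal.ofReal (P.p st a))
    (a : Fin K) : π.real {a} = P.p st a := by
  rw [measureReal_def, hπ, ENNReal.toReal_ofReal (hP.p_pos hβ a).le]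

/-- The bias of the clipped estimates. -/
theorem abs_sum_integral_lossHat_sub_le (c : Fin K) :
    |∑ b, P.p st b * ∫ l, P.lossHat st (b, l b) c ∂ν - centered P.φ (P.p st) c ⬝ᵥ θ| ≤
      P.bonus st c := by
  have hs := hP.s_pos hβ
  rw [← sum_mul_leverage_mul_feat (hP.featCov_posDef hβ) (hP.p_sum st), ← Finset.sum_sub_distrib,
    bonus, mul_assoc, Finset.sum_mul, Finset.mul_sum]
  refine (Finset.abs_sum_le_sum_abs _ _).trans (Finset.sum_le_sum fun b _ => ?_)
  rw [← mul_sub, abs_mul, abs_of_pos (hP.p_pos hβ b), ← hθ b, ← integral_const_mul,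
    ← integral_sub (hP.integrable_lossHat hβ b c) ((hi b).const_mul _)]
  have h1 : ∀ l : Fin K → ℝ, |P.lossHat st (b, l b) c - leverage P.φ (P.p st) c b * l b| ≤
      |leverage P.φ (P.p st) c b| ^ P.ε * P.s st ^ (1 - P.ε) * |l b| ^ P.ε := fun l => by
    refine (abs_sub_clip_le hP.one_lt_ε.le hs (y := leverage P.φ (P.p st) c b * l b)).trans
      (le_of_eq ?_)
    rw [abs_mul, Real.mul_rpow (abs_nonneg _) (abs_nonneg _)]; ring
  have h2 : |∫ l, (P.lossHat st (b, l b) c - leverage P.φ (P.p st) c b * l b) ∂ν| ≤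
      |leverage P.φ (P.p st) c b| ^ P.ε * P.s st ^ (1 - P.ε) * P.σ := by
    refine (abs_integral_le_integral_abs).trans ?_
    refine (integral_mono_of_nonneg (Filter.Eventually.of_forall fun _ => abs_nonneg _)
      ((hεi b).const_mul _) (Filter.Eventually.of_forall h1)).trans ?_
    rw [integral_const_mul]
    exact mul_le_mul_of_nonneg_left (hσ b) (by positivity)
  calc _ ≤ P.p st b * (|leverage P.φ (P.p st) c b| ^ P.ε * P.s st ^ (1 - P.ε) * P.σ) := by
        have := (hP.p_pos hβ b).le
        gcongr
    _ = _ := by ring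

omit [IsProbabilityMeasure ν] hi hθ in
/-- The second moment of the clipped estimates. -/
theorem sum_integral_lossHat_sq_le (c : Fin K) :
    ∑ b, P.p st b * ∫ l, P.lossHat st (b, l b) c ^ 2 ∂ν ≤ P.s st * P.bonus st c := by
  have hs := hP.s_pos hβ
  have e : P.s st * P.bonus st c = ∑ b, P.p st b *
      (|leverage P.φ (P.p st) c b| ^ P.ε * (P.s st ^ (1 - P.ε) * P.s st) * P.σ) := by
    rw [bonus, mul_assoc P.σ, Finset.sum_mul, Finset.mul_sum, Finset.mul_sum]
    exact Finset.sum_congr rfl fun b _ => by ring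
  rw [e]
  refine Finset.sum_le_sum fun b _ => mul_le_mul_of_nonneg_left ?_ (hP.p_pos hβ b).le
  have h1 : ∀ l : Fin K → ℝ, P.lossHat st (b, l b) c ^ 2 ≤
      |leverage P.φ (P.p st) c b| ^ P.ε * (P.s st ^ (1 - P.ε) * P.s st) * |l b| ^ P.ε :=
    fun l => by
    refine (clip_sq_le hP.ε_le_two hs (y := leverage P.φ (P.p st) c b * l b)).trans
      (le_of_eq ?_)
    rw [abs_mul, Real.mul_rpow (abs_nonneg _) (abs_nonneg _)]; ring
  refine (integral_mono_of_nonneg (Filter.Eventually.of_forall fun _ => sq_nonneg _)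
    ((hεi b).const_mul _) (Filter.Eventually.of_forall h1)).trans ?_
  rw [integral_const_mul]
  exact mul_le_mul_of_nonneg_left (hσ b) (by positivity)

include hπ

/-- The conditional expectation of the excess of a round is nonpositive. -/
theorem integral_excess_nonpos (a : Fin K) : ∫ o, P.excess a st o ∂(π.prod ν) ≤ 0 := by
  have hs := hP.s_pos hβ
  have hu := hP.one_sub_α_pos
  have hb := hP.β_pos hβ
  have hqS := hP.qS_pos hβ
  set c₀ := 9 / 2 * qStar (P.q st) ^ (1 - P.α) / (st.β * (1 - P.α)) with hc₀
  have hc₀n : 0 ≤ c₀ := by positivity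
  -- The stability coefficient is inversely proportional to s, so second moments of size s·b cost
  -- only a constant times b.
  have hc₀s : c₀ * P.s st = 9 / 16 := by
    have e : qStar (P.q st) ^ (1 - P.α) * qStar (P.q st) ^ (P.α - 1) = 1 := by
      rw [← Real.rpow_add hqS]; simp
    rw [hc₀, s]
    calc _ = 9 / 16 * (qStar (P.q st) ^ (1 - P.α) * qStar (P.q st) ^ (P.α - 1)) := by
          field_simp; ring
      _ = _ := by rw [e, mul_one]
  set B := ∑ c, P.q st c * P.bonus st c with hB
  -- A majorant of the excess in which the squared estimates are split into clipped losses and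
  -- bonuses, so that its expectation is explicit.
  set G : Outcome K → ℝ := fun o => o.2 o.1 - o.2 a -
    ∑ c, P.q st c * P.lossHat st (o.1, o.2 o.1) c + P.lossHat st (o.1, o.2 o.1) a +
    2 * c₀ * ∑ c, P.q st c * P.lossHat st (o.1, o.2 o.1) c ^ 2 +
    (B - P.bonus st a + 9 / 8 * B - 512 * P.incr st) with hG
  have hle : ∀ o, P.excess a st o ≤ G o := by
    intro o
    have h1 : P.stab st (o.1, o.2 o.1) ≤
        2 * c₀ * ∑ c, P.q st c * P.lossHat st (o.1, o.2 o.1) c ^ 2 + 9 / 8 * B := by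
      have h2 : ∑ c, P.q st c * P.est st (o.1, o.2 o.1) c ^ 2 ≤
          2 * ∑ c, P.q st c * P.lossHat st (o.1, o.2 o.1) c ^ 2 + 2 * P.s st * B := by
        rw [hB, Finset.mul_sum, Finset.mul_sum, ← Finset.sum_add_distrib]
        refine Finset.sum_le_sum fun c _ => ?_
        have h3 := hP.bonus_nonneg hβ c
        have h4 := hP.bonus_le hβ c
        have h5 : P.est st (o.1, o.2 o.1) c ^ 2 ≤
            2 * P.lossHat st (o.1, o.2 o.1) c ^ 2 + 2 * (P.s st * P.bonus st c) := by
          rw [est]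
          nlinarith [sq_nonneg (P.lossHat st (o.1, o.2 o.1) c + P.bonus st c)]
        have := mul_le_mul_of_nonneg_left h5 (hP.q_nonneg st c)
        linarith
      have h6 := mul_le_mul_of_nonneg_left h2 hc₀n
      rw [stab, ← hc₀]
      refine h6.trans (le_of_eq ?_)
      linear_combination 2 * B * hc₀s
    have h7 : ∑ c, P.q st c * P.est st (o.1, o.2 o.1) c =
        ∑ c, P.q st c * P.lossHat st (o.1, o.2 o.1) c - B := by
      rw [hB, ← Finset.sum_sub_distrib]
      exact Finset.sum_congr rfl fun c _ => by rw [est]; ring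
    rw [excess, h7, est, hG]
    linarith
  have hGm : Measurable G := by
    have h1 := measurable_snd.comp (measurable_obs (K := K))
    have h2 : ∀ c, Measurable fun o : Outcome K => P.lossHat st (o.1, o.2 o.1) c := fun c =>
      (hP.measurable_lossHat_const st hβ c).comp measurable_obs
    simp only [Function.comp_def] at h1
    fun_prop
  have hL1 := fun b c => hP.integrable_lossHat (ν := ν) hβ b c
  have hL2 := fun b c => hP.integrable_lossHat_sq (ν := ν) hβ b c
  have hGi : ∀ b, Integrable (fun l => G (b, l)) ν := fun b => by
    exact (((((hi b).sub (hi a)).sub (integrable_finsetSum _ fun c _ =>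
      (hL1 b c).const_mul _)).add (hL1 b a)).add ((integrable_finsetSum _ fun c _ =>
      (hL2 b c).const_mul _).const_mul _)).add (integrable_const _)
  have hGint : ∀ b, ∫ l, G (b, l) ∂ν = P.φ b ⬝ᵥ θ - P.φ a ⬝ᵥ θ -
      ∑ c, P.q st c * ∫ l, P.lossHat st (b, l b) c ∂ν + ∫ l, P.lossHat st (b, l b) a ∂ν +
      2 * c₀ * ∑ c, P.q st c * ∫ l, P.lossHat st (b, l b) c ^ 2 ∂ν +
      (B - P.bonus st a + 9 / 8 * B - 512 * P.incr st) := fun b => by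
    have i1 : Integrable (fun l : Fin K → ℝ => l b - l a) ν := (hi b).sub (hi a)
    have i2 : Integrable (fun l => ∑ c, P.q st c * P.lossHat st (b, l b) c) ν :=
      integrable_finsetSum _ fun c _ => (hL1 b c).const_mul _
    have i3 : Integrable (fun l => 2 * c₀ * ∑ c, P.q st c * P.lossHat st (b, l b) c ^ 2) ν :=
      (integrable_finsetSum _ fun c _ => (hL2 b c).const_mul _).const_mul _
    have i4 : Integrable (fun l => l b - l a - ∑ c, P.q st c * P.lossHat st (b, l b) c) ν :=
      i1.sub i2
    have i5 : Integrable (fun l => l b - l a - ∑ c, P.q st c * P.lossHat st (b, l b) c +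
      P.lossHat st (b, l b) a) ν := i4.add (hL1 b a)
    have i6 : Integrable (fun l => l b - l a - ∑ c, P.q st c * P.lossHat st (b, l b) c +
      P.lossHat st (b, l b) a + 2 * c₀ * ∑ c, P.q st c * P.lossHat st (b, l b) c ^ 2) ν :=
      i5.add i3
    simp only [hG]
    rw [integral_add i6 (integrable_const _), integral_add i5 i3, integral_add i4 (hL1 b a),
      integral_sub i1 i2, integral_sub (hi b) (hi a), hθ, hθ, integral_const_mul,
      integral_finsetSum _ fun c _ => (hL1 b c).const_mul _,
      integral_finsetSum _ fun c _ => (hL2 b c).const_mul _]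
    simp only [integral_const_mul, integral_const, probReal_univ, one_smul]
  have hexm : Measurable (P.excess a st) :=
    MeasurableState.excess (F := fun _ : Outcome K => st)
      ⟨measurable_const, measurable_const, fun _ => hβ⟩ hP measurable_id a
  have hex : Integrable (P.excess a st) (π.prod ν) :=
    integrable_prod_fin hexm fun b => by
      refine Integrable.mono' (((hi b).abs.add (hi a).abs).add
        (integrable_const (P.excessBound (P.s st)))) ?_ (Filter.Eventually.of_forall fun l =>
          hP.abs_excess_le hβ le_rfl a (b, l))
      exact (hexm.comp (measurable_const.prodMk measurable_id)).aestronglyMeasurable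
  refine (integral_mono hex (integrable_prod_fin hGm hGi) hle).trans ?_
  rw [integral_prod_fin hGm hGi]
  simp only [hP.real_singleton hβ hπ, hGint]
  set m := fun c => P.φ c ⬝ᵥ θ with hm
  set μ := ∑ b, P.p st b * m b with hμ
  set H := fun c => ∑ b, P.p st b * ∫ l, P.lossHat st (b, l b) c ∂ν with hH
  set Q := fun c => ∑ b, P.p st b * ∫ l, P.lossHat st (b, l b) c ^ 2 ∂ν with hQ
  have hcen : ∀ c, centered P.φ (P.p st) c ⬝ᵥ θ = m c - μ := fun c => by
    rw [centered, sub_dotProduct, featMean, sum_dotProduct]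
    simp only [smul_dotProduct, smul_eq_mul, hμ, hm]
  have hbias : ∀ c, |H c - (m c - μ)| ≤ P.bonus st c := fun c => by
    rw [← hcen]; exact hP.abs_sum_integral_lossHat_sub_le hβ hi hθ hεi hσ c
  have hvar : ∀ c, Q c ≤ P.s st * P.bonus st c := fun c =>
    hP.sum_integral_lossHat_sq_le hβ hεi hσ c
  have hsum : ∑ b, P.p st b * (P.φ b ⬝ᵥ θ - P.φ a ⬝ᵥ θ -
      ∑ c, P.q st c * ∫ l, P.lossHat st (b, l b) c ∂ν + ∫ l, P.lossHat st (b, l b) a ∂ν +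
      2 * c₀ * ∑ c, P.q st c * ∫ l, P.lossHat st (b, l b) c ^ 2 ∂ν +
      (B - P.bonus st a + 9 / 8 * B - 512 * P.incr st)) =
      μ - m a - ∑ c, P.q st c * H c + H a + 2 * c₀ * ∑ c, P.q st c * Q c +
      (B - P.bonus st a + 9 / 8 * B - 512 * P.incr st) := by
    have swap : ∀ f : Fin K → Fin K → ℝ, ∑ b, P.p st b * ∑ c, P.q st c * f b c =
        ∑ c, P.q st c * ∑ b, P.p st b * f b c := fun f => by
      simp only [Finset.mul_sum]
      rw [Finset.sum_comm]
      exact Finset.sum_congr rfl fun c _ => Finset.sum_congr rfl fun b _ => by ring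
    simp only [hH, hQ, ← swap]
    simp only [mul_add, mul_sub, Finset.sum_add_distrib, Finset.sum_sub_distrib,
      ← Finset.sum_mul, hP.p_sum, one_mul, hμ, hm]
    have : ∑ b, P.p st b * (2 * c₀ * ∑ c, P.q st c * ∫ l, P.lossHat st (b, l b) c ^ 2 ∂ν) =
        2 * c₀ * ∑ b, P.p st b * ∑ c, P.q st c * ∫ l, P.lossHat st (b, l b) c ^ 2 ∂ν := by
      rw [Finset.mul_sum]
      exact Finset.sum_congr rfl fun b _ => by ring
    rw [this]
  have hsum' := hsum
  simp only [hm] at hsum' ⊢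
  rw [hsum']
  -- The bias under q is paid by the averaged bonus B. For the comparator a it is paid by the bonus
  -- of a, which enters with the favourable sign and cancels: this is optimism.
  have h1 : -∑ c, P.q st c * H c ≤ μ - ∑ c, P.q st c * m c + B := by
    have : ∑ c, P.q st c * (m c - μ - P.bonus st c) ≤ ∑ c, P.q st c * H c :=
      Finset.sum_le_sum fun c _ => mul_le_mul_of_nonneg_left
        (by have := (abs_le.mp (hbias c)).1; linarith) (hP.q_nonneg st c)
    simp only [mul_sub, Finset.sum_sub_distrib, ← Finset.sum_mul, hP.q_sum, one_mul] at this
    linarith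
  have h2 := (abs_le.mp (hbias a)).2
  have h3 : 2 * c₀ * ∑ c, P.q st c * Q c ≤ 9 / 8 * B := by
    have h4 : ∑ c, P.q st c * Q c ≤ P.s st * B := by
      rw [hB, Finset.mul_sum]
      refine Finset.sum_le_sum fun c _ => ?_
      have := mul_le_mul_of_nonneg_left (hvar c) (hP.q_nonneg st c)
      linarith
    have h5 := mul_le_mul_of_nonneg_left h4 (by positivity : 0 ≤ 2 * c₀)
    refine h5.trans (le_of_eq ?_)
    linear_combination 2 * B * hc₀s
  -- Playing p instead of q costs at most 2γσ^(1/ε), which is 2 · 256 times β^(-2) w.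
  have h6 : μ - ∑ c, P.q st c * m c ≤ 512 * (st.β ^ (-2 : ℝ) * P.w st) := by
    have hmb : ∀ c, |m c| ≤ P.σ ^ (1 / P.ε) := fun c => by
      simp only [hm]
      rw [← hθ c]
      exact abs_integral_le_rpow (hi c) hP.one_lt_ε.le (hεi c) (hσ c)
    have hγ := hP.γ_pos hβ
    have e : μ - ∑ c, P.q st c * m c = P.γ st * (∑ c, P.p₀ c * m c - ∑ c, P.q st c * m c) := by
      rw [hμ, ← Finset.sum_sub_distrib, ← Finset.sum_sub_distrib, Finset.mul_sum]
      exact Finset.sum_congr rfl fun c _ => by rw [p]; ring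
    have h7 : ∑ c, P.p₀ c * m c ≤ P.σ ^ (1 / P.ε) := by
      calc _ ≤ ∑ c, P.p₀ c * P.σ ^ (1 / P.ε) := Finset.sum_le_sum fun c _ =>
            mul_le_mul_of_nonneg_left (abs_le.mp (hmb c)).2 (hP.p₀_nonneg c)
        _ = _ := by rw [← Finset.sum_mul, hP.design.1.2, one_mul]
    have h8 : -P.σ ^ (1 / P.ε) ≤ ∑ c, P.q st c * m c := by
      calc -P.σ ^ (1 / P.ε) = ∑ c, P.q st c * -P.σ ^ (1 / P.ε) := by
            rw [← Finset.sum_mul, hP.q_sum, one_mul]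
        _ ≤ _ := Finset.sum_le_sum fun c _ =>
            mul_le_mul_of_nonneg_left (abs_le.mp (hmb c)).1 (hP.q_nonneg st c)
    have h9 := hP.γ_mul_rpow_eq st
    rw [e]
    nlinarith
  have h10 := hP.sum_q_mul_bonus_le hβ
  have h11 : P.incr st = st.β ^ (1 - P.ε) * P.z st + st.β ^ (-2 : ℝ) * P.w st := rfl
  have h12 := mul_nonneg (Real.rpow_nonneg hb.le (1 - P.ε)) (hP.z_pos hβ).le
  rw [← hB] at h10
  -- The bonuses enter with total coefficient 17/4, hence cost at most 272 β^(1-ε) z; exploration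
  -- costs 512 β^(-2) w, and 512 covers both.
  linarith

end OneRound

end IsAdmissible

end Params

/-- Extension of a finite sequence by a constant. -/
def extend {α : Type*} (o₀ : α) {T : ℕ} (x : Fin T → α) : ℕ → α :=
  fun i => if h : i < T then x ⟨i, h⟩ else o₀

theorem extend_fin {α : Type*} (o₀ : α) {T : ℕ} (x : Fin T → α) (i : Fin T) :
    extend o₀ x i = x i := by simp [extend]

theorem extend_snoc_of_lt {α : Type*} (o₀ : α) {T : ℕ} (x : Fin T → α) (y : α) {i : ℕ} (hi : i < T) :
    extend o₀ (Fin.snoc (α := fun _ => α) x y) i = extend o₀ x i := by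
  simp only [extend, hi, Nat.lt_succ_of_lt hi, dif_pos]
  exact Fin.snoc_castSucc (α := fun _ => α) y x ⟨i, hi⟩

theorem extend_snoc_self {α : Type*} (o₀ : α) {T : ℕ} (x : Fin T → α) (y : α) :
    extend o₀ (Fin.snoc (α := fun _ => α) x y) T = y := by
  simp only [extend, Nat.lt_succ_self, dif_pos]
  exact Fin.snoc_last (α := fun _ => α) y x

theorem measurable_extend {α : Type*} [MeasurableSpace α] (o₀ : α) {T : ℕ} (i : ℕ) :
    Measurable fun x : Fin T → α => extend o₀ x i := by
  unfold extend
  split_ifs with h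
  · exact measurable_pi_apply _
  · exact measurable_const

/-! ### Rounds inside the law of a finite run. -/

namespace Environment

variable {K d : ℕ} {env : Environment.{u} K} {alg : Algorithm K}

/-- The past and the outcome of round `t`. -/
def round {S : Type*} (o₀ : Outcome K) (t : ℕ) {T : ℕ} (x : S × (Fin T → Outcome K)) :
    (S × (Fin t → Outcome K)) × Outcome K :=
  ((x.1, fun i => extend o₀ x.2 i), extend o₀ x.2 t)

theorem measurable_round {S : Type*} [MeasurableSpace S] (o₀ : Outcome K) (t T : ℕ) :
    Measurable (round o₀ t : S × (Fin T → Outcome K) → _) := by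
  refine (measurable_fst.prodMk (measurable_pi_lambda _ fun i => ?_)).prodMk ?_
  · exact (measurable_extend o₀ i).comp measurable_snd
  · exact (measurable_extend o₀ t).comp measurable_snd

/-- Later rounds do not change the law of earlier ones: each appended outcome is integrated out as
the second factor of a composition product. -/
theorem map_round (o₀ : Outcome K) {t T : ℕ} (ht : t < T) :
    (env.law alg T).map (round o₀ t) = env.law alg t ⊗ₘ env.step alg t := by
  induction T, ht using Nat.le_induction with
  | base =>
    rw [law, Measure.map_map (measurable_round o₀ t _) measurable_append]
    convert Measure.map_id using 2
    funext y
    simp only [Function.comp_def, round, append, id, extend_snoc_self]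
    refine Prod.ext (Prod.ext rfl (funext fun i => ?_)) rfl
    simp only
    rw [extend_snoc_of_lt _ _ _ i.2, extend_fin]
  | succ T ht ih =>
    rw [law, Measure.map_map (measurable_round o₀ t _) measurable_append, ← ih]
    have : round o₀ t ∘ append = round o₀ t ∘
        (Prod.fst : (env.Seed × (Fin T → Outcome K)) × Outcome K → _) := by
      funext y
      have ht' : t < T := ht
      simp only [Function.comp_def, round, append]
      rw [extend_snoc_of_lt _ _ _ ht']
      refine Prod.ext (Prod.ext rfl (funext fun i => ?_)) rfl
      exact extend_snoc_of_lt _ _ _ (i.2.trans ht')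
    rw [this, ← Measure.map_map (measurable_round o₀ t _) measurable_fst]
    congr 1
    exact Measure.fst_compProd _ _

theorem step_apply (t : ℕ) (x : env.Seed × (Fin t → Outcome K)) :
    env.step alg t x = (alg.policy t (observe x.2)).prod (env.loss t x) := by
  rw [step, Kernel.prod_apply, Kernel.comap_apply]

variable {ε σ : ℝ} {φ : Fin K → Fin d → ℝ}

/-- The bound |l| ≤ 1 + |l|^ε gives conditional absolute moments at most 1 + σ, uniformly in the
past. -/
theorem IsHeavyTailed.integrable_loss (hε : 1 ≤ ε) (hH : env.IsHeavyTailed ε σ) (t : ℕ)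
    (c : Fin K) : Integrable (fun y => y.2.2 c) (env.law alg t ⊗ₘ env.step alg t) := by
  have hm : Measurable fun y : (env.Seed × (Fin t → Outcome K)) × Outcome K => y.2.2 c := by
    fun_prop
  refine ⟨hm.aestronglyMeasurable, ?_⟩
  have key : ∀ x, ∫⁻ o, ‖o.2 c‖ₑ ∂(env.step alg t x) ≤ ENNReal.ofReal (1 + σ) := fun x => by
    rw [step_apply]
    have h1 : ∫⁻ o, ‖o.2 c‖ₑ ∂((alg.policy t (observe x.2)).prod (env.loss t x)) =
        ∫⁻ l, ‖l c‖ₑ ∂(env.loss t x) :=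
      (measurePreserving_snd (μ := alg.policy t (observe x.2))).lintegral_comp
        (f := fun l : Fin K → ℝ => ‖l c‖ₑ) (by fun_prop)
    rw [h1]
    obtain ⟨hi, hσ⟩ := hH t x c
    have h2 : ∀ l : Fin K → ℝ, ‖l c‖ₑ ≤ ENNReal.ofReal (1 + |l c| ^ ε) := fun l => by
      rw [Real.enorm_eq_ofReal_abs]
      refine ENNReal.ofReal_le_ofReal ?_
      have h0 := Real.rpow_nonneg (abs_nonneg (l c)) ε
      rcases le_total |l c| 1 with h | h
      · linarith
      · linarith [Real.self_le_rpow_of_one_le h hε]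
    refine (lintegral_mono h2).trans ?_
    have hi' : Integrable (fun l : Fin K → ℝ => 1 + |l c| ^ ε) (env.loss t x) :=
      (integrable_const _).add hi
    rw [← ofReal_integral_eq_lintegral_ofReal hi'
      (Filter.Eventually.of_forall fun l => by positivity)]
    refine ENNReal.ofReal_le_ofReal ?_
    rw [integral_add (integrable_const _) hi]
    simpa using hσ
  rw [HasFiniteIntegral, Measure.lintegral_compProd (by fun_prop)]
  refine (lintegral_mono key).trans_lt ?_
  simp

/-- Integrability of a function of a round that grows at most linearly in the losses. -/
theorem IsHeavyTailed.integrable_round (hε : 1 ≤ ε) (hH : env.IsHeavyTailed ε σ) {t : ℕ}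
    {f : (env.Seed × (Fin t → Outcome K)) × Outcome K → ℝ} (hf : Measurable f) {M : ℝ}
    (hM : ∀ y, |f y| ≤ M + 2 * ∑ c, |y.2.2 c|) :
    Integrable f (env.law alg t ⊗ₘ env.step alg t) := by
  refine Integrable.mono' (g := fun y => M + 2 * ∑ c, |y.2.2 c|) ?_ hf.aestronglyMeasurable
    (Filter.Eventually.of_forall hM)
  exact (integrable_const _).add ((integrable_finsetSum _ fun c _ =>
    (hH.integrable_loss hε t c).abs).const_mul 2)

theorem integral_round_nonpos {t : ℕ}
    {f : (env.Seed × (Fin t → Outcome K)) × Outcome K → ℝ}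
    (hf : Integrable f (env.law alg t ⊗ₘ env.step alg t))
    (h0 : ∀ x, ∫ o, f (x, o) ∂((alg.policy t (observe x.2)).prod (env.loss t x)) ≤ 0) :
    ∫ y, f y ∂(env.law alg t ⊗ₘ env.step alg t) ≤ 0 := by
  rw [Measure.integral_compProd hf]
  refine integral_nonpos fun x => ?_
  simpa only [step_apply, Pi.zero_apply] using h0 x

theorem integrable_comp_round (o₀ : Outcome K) {t T : ℕ} (ht : t < T)
    {f : (env.Seed × (Fin t → Outcome K)) × Outcome K → ℝ}
    (hf : Integrable f (env.law alg t ⊗ₘ env.step alg t)) :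
    Integrable (fun x => f (round o₀ t x)) (env.law alg T) := by
  rw [← map_round o₀ ht] at hf
  exact hf.comp_measurable (measurable_round o₀ t T)

theorem integral_comp_round (o₀ : Outcome K) {t T : ℕ} (ht : t < T)
    {f : (env.Seed × (Fin t → Outcome K)) × Outcome K → ℝ} (hf : Measurable f) :
    ∫ x, f (round o₀ t x) ∂(env.law alg T) = ∫ y, f y ∂(env.law alg t ⊗ₘ env.step alg t) := by
  rw [← map_round o₀ ht, integral_map (measurable_round o₀ t T).aemeasurable
    hf.aestronglyMeasurable]

/-- The observations of a finite run, continued by a constant. -/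
def obsSeq (o₀ : Outcome K) {S : Type*} {T : ℕ} (x : S × (Fin T → Outcome K)) : ℕ → Obs K :=
  fun i => ((extend o₀ x.2 i).1, (extend o₀ x.2 i).2 (extend o₀ x.2 i).1)

end Environment

/-! ### From pathwise to expected regret. -/

namespace Params.IsAdmissible

variable {K d : ℕ} {P : Params K d} {env : Environment.{u} K} {alg : Algorithm K}
variable (hP : P.IsAdmissible)
include hP

open Environment

theorem measurable_traj_obsSeq {S : Type*} [MeasurableSpace S] (o₀ : Outcome K) (T t : ℕ) :
    P.MeasurableState fun x : S × (Fin T → Outcome K) => P.traj (obsSeq o₀ x) t :=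
  (hP.measurableState t).comp (f := fun x : S × (Fin T → Outcome K) => fun i => obsSeq o₀ x i)
    (measurable_pi_lambda _ fun i =>
      measurable_obs.comp ((measurable_extend o₀ i).comp measurable_snd))

theorem integrable_sum_incr (o₀ : Outcome K) (T : ℕ) :
    Integrable (fun x => ∑ t ∈ Finset.range T, P.incr (P.traj (obsSeq o₀ x) t))
      (env.law alg T) := by
  refine integrable_finsetSum _ fun t ht => ?_
  refine Integrable.of_bound (C := P.zMax T * P.β₁ ^ (1 - P.ε) + P.wMax T * P.β₁ ^ (-2 : ℝ))
    ((hP.measurable_traj_obsSeq o₀ T t).incr hP).aestronglyMeasurable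
    (Filter.Eventually.of_forall fun x => ?_)
  rw [Real.norm_of_nonneg (hP.incr_nonneg (hP.β₁_le_traj _ _))]
  exact hP.incr_le _ (Finset.mem_range.mp ht)

variable (hL : env.IsLinear P.φ) (hH : env.IsHeavyTailed P.ε P.σ) (hR : P.IsRunBy alg)

include hH in
theorem integrable_excess (o₀ : Outcome K) {t T : ℕ} (ht : t < T) (a : Fin K) :
    Integrable (fun x => P.excess a (P.traj (obsSeq o₀ x) t) (extend o₀ x.2 t)) (env.law alg T) ∧
    (env.IsLinear P.φ → P.IsRunBy alg →
      ∫ x, P.excess a (P.traj (obsSeq o₀ x) t) (extend o₀ x.2 t) ∂(env.law alg T) ≤ 0) := by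
  obtain ⟨M, hM⟩ := hP.exists_s_bound t
  set f : (env.Seed × (Fin t → Outcome K)) × Outcome K → ℝ := fun y =>
    P.excess a (P.state t (observe y.1.2)) y.2 with hf
  have hfm : Measurable f :=
    ((hP.measurableState t).comp (measurable_observe.comp
      (measurable_snd.comp measurable_fst))).excess hP measurable_snd a
  have hfb : ∀ y, |f y| ≤ P.excessBound M + 2 * ∑ c, |y.2.2 c| := fun y => by
    have h1 := hP.abs_excess_le (hP.β₁_le_state t (observe y.1.2)) (hM _) a y.2
    have h2 : ∀ b, |y.2.2 b| ≤ ∑ c, |y.2.2 c| := fun b =>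
      Finset.single_le_sum (f := fun c => |y.2.2 c|) (fun c _ => abs_nonneg _) (Finset.mem_univ b)
    linarith [h2 a, h2 y.2.1]
  have hfi := hH.integrable_round (alg := alg) hP.one_lt_ε.le hfm hfb
  refine ⟨integrable_comp_round o₀ ht hfi, fun hL hR => ?_⟩
  refine (integral_comp_round o₀ ht hfm).trans_le (integral_round_nonpos hfi fun x => ?_)
  obtain ⟨θ, hθ⟩ := hL t x
  exact hP.integral_excess_nonpos (hP.β₁_le_state t (observe x.2)) (hR t _)
    (fun c => (hθ c).1) (fun c => (hθ c).2) (fun c => (hH t x c).1) (fun c => (hH t x c).2) a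

include hL hH hR

/-- The regret is bounded by the expected sum of the increments of the learning rate schedule. -/
theorem regret_le_incr (o₀ : Outcome K) (T : ℕ) :
    env.regret alg T ≤ P.β₁ * P.h₁ + P.βbar * P.hbar +
      518 * ∫ x, ∑ t ∈ Finset.range T, P.incr (P.traj (obsSeq o₀ x) t) ∂(env.law alg T) := by
  have : Nonempty (Fin K) := ⟨o₀.1⟩
  refine ciSup_le fun a => ?_
  have hI := hP.integrable_sum_incr (env := env) (alg := alg) o₀ T
  have hX : Integrable (fun x => ∑ t ∈ Finset.range T,
      P.excess a (P.traj (obsSeq o₀ x) t) (extend o₀ x.2 t)) (env.law alg T) :=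
    integrable_finsetSum _ fun t ht => (hP.integrable_excess hH o₀ (Finset.mem_range.mp ht) a).1
  have hX0 : ∫ x, ∑ t ∈ Finset.range T,
      P.excess a (P.traj (obsSeq o₀ x) t) (extend o₀ x.2 t) ∂(env.law alg T) ≤ 0 := by
    rw [integral_finsetSum _ fun t ht =>
      (hP.integrable_excess hH o₀ (Finset.mem_range.mp ht) a).1]
    exact Finset.sum_nonpos fun t ht =>
      (hP.integrable_excess hH o₀ (Finset.mem_range.mp ht) a).2 hL hR
  -- The pathwise regret is the excess, whose mean is nonpositive, plus the
  -- follow-the-regularized-leader part, plus 512 increments; the latter part adds 6 more.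
  have hpt : ∀ x : env.Seed × (Fin T → Outcome K),
      ∑ t, (x.2 t).2 (x.2 t).1 - ∑ t, (x.2 t).2 a =
      ∑ t ∈ Finset.range T, P.excess a (P.traj (obsSeq o₀ x) t) (extend o₀ x.2 t) +
      ∑ t ∈ Finset.range T, (∑ b, P.q (P.traj (obsSeq o₀ x) t) b *
          P.est (P.traj (obsSeq o₀ x) t) (obsSeq o₀ x t) b -
        P.est (P.traj (obsSeq o₀ x) t) (obsSeq o₀ x t) a -
        P.stab (P.traj (obsSeq o₀ x) t) (obsSeq o₀ x t)) +
      512 * ∑ t ∈ Finset.range T, P.incr (P.traj (obsSeq o₀ x) t) := fun x => by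
    have e : ∑ t, (x.2 t).2 (x.2 t).1 - ∑ t, (x.2 t).2 a = ∑ t ∈ Finset.range T,
        ((extend o₀ x.2 t).2 (extend o₀ x.2 t).1 - (extend o₀ x.2 t).2 a) := by
      rw [Finset.sum_range, ← Finset.sum_sub_distrib]
      simp only [extend_fin]
    rw [e, Finset.mul_sum, ← Finset.sum_add_distrib, ← Finset.sum_add_distrib]
    refine Finset.sum_congr rfl fun t _ => ?_
    simp only [excess, obsSeq]
    ring
  have hle : ∀ x : env.Seed × (Fin T → Outcome K),
      ∑ t, (x.2 t).2 (x.2 t).1 - ∑ t, (x.2 t).2 a ≤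
      ∑ t ∈ Finset.range T, P.excess a (P.traj (obsSeq o₀ x) t) (extend o₀ x.2 t) +
      (P.β₁ * P.h₁ + P.βbar * P.hbar) +
      518 * ∑ t ∈ Finset.range T, P.incr (P.traj (obsSeq o₀ x) t) := fun x => by
    rw [hpt x]
    have := hP.ftrl_regret (obsSeq o₀ x) a T
    linarith
  have hl : Integrable (fun x => ∑ t, (x.2 t).2 (x.2 t).1 - ∑ t, (x.2 t).2 a)
      (env.law alg T) := by
    refine Integrable.mono' (g := fun x => 2 * ∑ t ∈ Finset.range T, ∑ c,
      |(extend o₀ x.2 t).2 c|) ?_ ?_ (Filter.Eventually.of_forall fun x => ?_)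
    · refine (integrable_finsetSum _ fun t ht => integrable_finsetSum _ fun c _ => ?_).const_mul 2
      exact integrable_comp_round o₀ (Finset.mem_range.mp ht)
        (hH.integrable_loss hP.one_lt_ε.le t c).abs
    · have h1 : ∀ t : Fin T, Measurable fun x : env.Seed × (Fin T → Outcome K) =>
          (x.2 t).2 (x.2 t).1 := fun t =>
        (measurable_snd.comp measurable_obs).comp ((measurable_pi_apply t).comp measurable_snd)
      exact (by fun_prop : Measurable fun x : env.Seed × (Fin T → Outcome K) =>
        ∑ t, (x.2 t).2 (x.2 t).1 - ∑ t, (x.2 t).2 a).aestronglyMeasurable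
    · rw [Finset.sum_range, ← Finset.sum_sub_distrib, Finset.mul_sum]
      refine (norm_sum_le _ _).trans (Finset.sum_le_sum fun t _ => ?_)
      rw [extend_fin, Real.norm_eq_abs]
      have h2 : ∀ b, |(x.2 t).2 b| ≤ ∑ c, |(x.2 t).2 c| := fun b =>
        Finset.single_le_sum (f := fun c => |(x.2 t).2 c|) (fun c _ => abs_nonneg _)
          (Finset.mem_univ b)
      linarith [abs_sub ((x.2 t).2 (x.2 t).1) ((x.2 t).2 a), h2 a, h2 (x.2 t).1]
  have hX1 : Integrable (fun x => ∑ t ∈ Finset.range T,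
      P.excess a (P.traj (obsSeq o₀ x) t) (extend o₀ x.2 t) + (P.β₁ * P.h₁ + P.βbar * P.hbar))
      (env.law alg T) := hX.add (integrable_const _)
  refine (integral_mono hl (hX1.add (hI.const_mul 518)) hle).trans ?_
  simp only [Pi.add_apply]
  rw [integral_add hX1 (hI.const_mul 518), integral_add hX (integrable_const _),
    integral_const_mul]
  simp only [integral_const, probReal_univ, one_smul]
  linarith

omit hL hH hR in
theorem sum_incr_integral_le_expectedBound (o₀ : Outcome K) {T : ℕ} (hT : 1 ≤ T) :
    P.β₁ * P.h₁ + ∫ x, ∑ t ∈ Finset.range T, P.incr (P.traj (obsSeq o₀ x) t) ∂(env.law alg T) ≤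
      P.expectedBound env alg T := by
  have hI := hP.integrable_sum_incr (env := env) (alg := alg) o₀ T
  have e : ∀ x : env.Seed × (Fin T → Outcome K),
      ∑ t : Fin T, P.roundBound t (fun i => observe x.2 (Fin.castLE t.isLt.le i)) =
      ∑ t ∈ Finset.range T, P.roundBound t (fun i => obsSeq o₀ x i) := fun x => by
    rw [Finset.sum_range]
    refine Finset.sum_congr rfl fun t _ => ?_
    congr 1
    funext i
    have := extend_fin o₀ x.2 (Fin.castLE t.isLt.le i)
    simp only [Fin.val_castLE] at this
    simp only [obsSeq, observe, this]
  rw [expectedBound]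
  simp only [e]
  have h1 := fun x : env.Seed × (Fin T → Outcome K) =>
    hP.sum_incr_le_sum_roundBound (obsSeq o₀ x) hT
  have h2 := fun x : env.Seed × (Fin T → Outcome K) => hP.sum_roundBound_le (obsSeq o₀ x) T
  have hh := mul_pos hP.β₁_pos hP.h₁_pos
  have hI0 := fun x : env.Seed × (Fin T → Outcome K) => Finset.sum_nonneg fun t (_ : t ∈ Finset.range T) =>
    hP.incr_nonneg (hP.β₁_le_traj (obsSeq o₀ x) t)
  have hB : Integrable (fun x => ∑ t ∈ Finset.range T, P.roundBound t (fun i => obsSeq o₀ x i))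
      (env.law alg T) := by
    refine Integrable.mono' (((integrable_const (P.β₁ * P.h₁)).add (hI.const_mul 7))) ?_
      (Filter.Eventually.of_forall fun x => ?_)
    · refine (Finset.measurable_sum _ fun t _ => ?_).aestronglyMeasurable
      simp only [roundBound_traj]
      have hS := hP.measurable_traj_obsSeq (S := env.Seed) o₀ T
      have m1 := (hS t).measurable_β
      have m2 := (hS (t - 1)).measurable_β
      have m3 := (hS t).h hP
      have m4 := (hS t).incr hP
      split_ifs <;> fun_prop
    · rw [Real.norm_of_nonneg (by linarith [h1 x, hI0 x])]
      exact h2 x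
  have h3 := integral_mono ((integrable_const (P.β₁ * P.h₁)).add hI) hB h1
  simp only [Pi.add_apply] at h3
  rw [integral_add (integrable_const _) hI] at h3
  simpa using h3

omit hL hH in
/-- The expected gap of the sampling distributions is the expected gap of the played arms. -/
theorem integral_sum_gap_le (o₀ : Outcome K) (T : ℕ) (Δ : Fin K → ℝ) (hΔ : ∀ a, 0 ≤ Δ a) :
    Integrable (fun x => ∑ t ∈ Finset.range T, ∑ a, Δ a * P.p (P.traj (obsSeq o₀ x) t) a)
      (env.law alg T) ∧
    ∫ x, ∑ t ∈ Finset.range T, ∑ a, Δ a * P.p (P.traj (obsSeq o₀ x) t) a ∂(env.law alg T) ≤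
      ∫ x, ∑ t, Δ (x.2 t).1 ∂(env.law alg T) := by
  have hps : ∀ {S : Type u} [MeasurableSpace S], ∀ t, Measurable fun x : S × (Fin T → Outcome K) =>
      ∑ a, Δ a * P.p (P.traj (obsSeq o₀ x) t) a := fun t =>
    Finset.measurable_sum _ fun a _ => ((measurable_pi_apply a).comp
      ((hP.measurable_traj_obsSeq o₀ T t).p hP)).const_mul _
  have hpn : ∀ (st : State K), P.β₁ ≤ st.β → |∑ a, Δ a * P.p st a| ≤ ∑ a, Δ a := fun st hst => by
    have hp := fun a => (hP.p_pos hst a).le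
    rw [abs_of_nonneg (Finset.sum_nonneg fun a _ => mul_nonneg (hΔ a) (hp a))]
    refine Finset.sum_le_sum fun a _ => mul_le_of_le_one_right (hΔ a) ?_
    rw [← hP.p_sum st]
    exact Finset.single_le_sum (f := P.p st) (fun b _ => hp b) (Finset.mem_univ a)
  have hI1 : ∀ t, Integrable (fun x => ∑ a, Δ a * P.p (P.traj (obsSeq o₀ x) t) a)
      (env.law alg T) := fun t =>
    Integrable.of_bound (C := ∑ a, Δ a) (hps t).aestronglyMeasurable
      (Filter.Eventually.of_forall fun x => hpn _ (hP.β₁_le_traj _ _))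
  refine ⟨integrable_finsetSum _ fun t _ => hI1 t, ?_⟩
  have hΔ1 : ∀ b, |Δ b| ≤ ∑ a, Δ a := fun b => by
    rw [abs_of_nonneg (hΔ b)]
    exact Finset.single_le_sum (f := Δ) (fun b _ => hΔ b) (Finset.mem_univ b)
  have hΔm : Measurable Δ := measurable_of_finite _
  have hI2 : ∀ t, Integrable (fun x : env.Seed × (Fin T → Outcome K) => Δ (extend o₀ x.2 t).1)
      (env.law alg T) := fun t =>
    Integrable.of_bound (C := ∑ a, Δ a) (hΔm.comp (measurable_fst.comp
      ((measurable_extend o₀ t).comp measurable_snd))).aestronglyMeasurable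
      (Filter.Eventually.of_forall fun x => hΔ1 _)
  have e : ∀ x : env.Seed × (Fin T → Outcome K), ∑ t, Δ (x.2 t).1 =
      ∑ t ∈ Finset.range T, Δ (extend o₀ x.2 t).1 := fun x => by
    rw [Finset.sum_range]
    simp only [extend_fin]
  simp only [e]
  rw [integral_finsetSum _ fun t _ => hI1 t, integral_finsetSum _ fun t _ => hI2 t]
  refine Finset.sum_le_sum fun t ht => ?_
  rw [← sub_nonpos, ← integral_sub (hI1 t) (hI2 t)]
  set f : (env.Seed × (Fin t → Outcome K)) × Outcome K → ℝ := fun y =>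
    ∑ a, Δ a * P.p (P.state t (observe y.1.2)) a - Δ y.2.1
  have hfm : Measurable f := by
    refine Measurable.sub (Finset.measurable_sum _ fun a _ => Measurable.const_mul ?_ _)
      (hΔm.comp (measurable_fst.comp measurable_snd))
    exact (measurable_pi_apply a).comp (((hP.measurableState t).comp (measurable_observe.comp
      (measurable_snd.comp measurable_fst))).p hP)
  have hfi : Integrable f (env.law alg t ⊗ₘ env.step alg t) := by
    refine Integrable.of_bound (C := ∑ a, Δ a + ∑ a, Δ a) hfm.aestronglyMeasurable
      (Filter.Eventually.of_forall fun y => ?_)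
    exact (norm_sub_le _ _).trans (add_le_add (hpn _ (hP.β₁_le_state t _)) (hΔ1 _))
  -- Given the past, the played arm has law p, so the difference has conditional mean zero.
  refine (integral_comp_round o₀ (Finset.mem_range.mp ht) hfm).trans_le
    (integral_round_nonpos hfi fun x => le_of_eq ?_)
  have hst := hP.β₁_le_state t (observe x.2)
  rw [integral_prod_fin (F := fun o => f (x, o)) (hfm.comp measurable_prodMk_left)
    fun a => by simp only [f]; exact integrable_const _]
  simp only [f, integral_const, probReal_univ, one_smul, hP.real_singleton hst (hR t _)]
  simp only [mul_sub, Finset.sum_sub_distrib]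
  rw [← Finset.sum_mul, hP.p_sum, one_mul, sub_eq_zero]
  exact Finset.sum_congr rfl fun a _ => mul_comm _ _

end Params.IsAdmissible

/-! ### The learning-rate recursion. -/

section Schedule

variable {r H Z : ℝ} {β h z : ℕ → ℝ}

theorem rpow_sub_rpow_le {r x y : ℝ} (hr : 1 ≤ r) (hx : 0 ≤ x) (hy : 0 < y) :
    y ^ r - x ^ r ≤ r * y ^ (r - 1) * (y - x) := by
  have h := one_add_mul_self_le_rpow_one_add (s := x / y - 1)
    (by have := div_nonneg hx hy.le; linarith) hr
  rw [add_sub_cancel, Real.div_rpow hx hy.le, le_div_iff₀ (Real.rpow_pos_of_pos hy r)] at h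
  have e : y ^ r = y ^ (r - 1) * y := by rw [← Real.rpow_add_one hy.ne']; congr 1; ring
  have e2 : (1 + r * (x / y - 1)) * y ^ r = y ^ r - r * y ^ (r - 1) * (y - x) := by
    rw [e]; field_simp; ring
  linarith

theorem add_rpow_inv_le {r a b : ℝ} (hr : 1 ≤ r) (ha : 0 ≤ a) (hb : 0 ≤ b) :
    (a ^ r + b) ^ (1 / r) ≤ a + b ^ (1 / r) := by
  have h0 : 0 < r := by linarith
  have h := Real.rpow_add_le_add_rpow (p := 1 / r) (Real.rpow_nonneg ha r) hb (by positivity)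
    (by rw [div_le_one h0]; exact hr)
  rwa [← Real.rpow_mul ha, mul_one_div_cancel h0.ne', Real.rpow_one] at h

variable (hr : 1 < r) (hb : 0 < β 0) (hh : ∀ t, 0 < h t) (hH : ∀ t, h t ≤ H)
  (hz : ∀ t, 0 ≤ z t) (hZ : ∀ t, z t ≤ Z)
  (hβ : ∀ t, β t + β t ^ (1 - r) * z t / h t ≤ β (t + 1))

include hb hh hz hβ

theorem schedule_pos (n : ℕ) : β 0 ≤ β n ∧ 0 < β n := by
  induction n with
  | zero => exact ⟨le_rfl, hb⟩
  | succ n ih =>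
    have h1 : 0 ≤ β n ^ (1 - r) * z n / h n :=
      div_nonneg (mul_nonneg (Real.rpow_nonneg ih.2.le _) (hz n)) (hh n).le
    have := hβ n
    constructor <;> linarith

omit hb hh hz in
theorem schedule_ge (n : ℕ) :
    β 0 + ∑ t ∈ Finset.range n, β t ^ (1 - r) * z t / h t ≤ β n := by
  induction n with
  | zero => simp
  | succ n ih => rw [Finset.sum_range_succ]; linarith [hβ n]

include hr hZ hH

/-- Let Y be the partial sum. While Y is below the largest possible increment, adding one keeps it
below twice that. Afterwards an increment at most doubles Y, and β ≥ Y/H bounds it by H^(r-1) Z /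
Y^(r-1), so the r-th power grows by a constant per round. -/
theorem sum_rpow_le (n : ℕ) : (∑ t ∈ Finset.range n, β t ^ (1 - r) * z t) ^ r ≤
    (2 * (Z * β 0 ^ (1 - r))) ^ r + r * 2 ^ (r - 1) * (H ^ (r - 1) * Z * n) := by
  have hZ0 : 0 ≤ Z := (hz 0).trans (hZ 0)
  have hH0 : 0 < H := (hh 0).trans_le (hH 0)
  have hp := schedule_pos hb hh hz hβ
  have hy : ∀ t, 0 ≤ β t ^ (1 - r) * z t := fun t =>
    mul_nonneg (Real.rpow_nonneg (hp t).2.le _) (hz t)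
  have hM0 : 0 ≤ Z * β 0 ^ (1 - r) := mul_nonneg hZ0 (Real.rpow_nonneg hb.le _)
  have hyM : ∀ t, β t ^ (1 - r) * z t ≤ Z * β 0 ^ (1 - r) := fun t => by
    rw [mul_comm Z]
    exact mul_le_mul (Real.rpow_le_rpow_of_nonpos hb (hp t).1 (by linarith)) (hZ t) (hz t)
      (Real.rpow_nonneg hb.le _)
  have hc : 0 ≤ r * 2 ^ (r - 1) * (H ^ (r - 1) * Z) := by positivity
  induction n with
  | zero =>
    simp only [Finset.range_zero, Finset.sum_empty]
    rw [Real.zero_rpow (by linarith)]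
    positivity
  | succ n ih =>
    set Y := ∑ t ∈ Finset.range n, β t ^ (1 - r) * z t with hY
    have hY0 : 0 ≤ Y := Finset.sum_nonneg fun t _ => hy t
    rw [Finset.sum_range_succ, ← hY]
    have hc' : 0 ≤ r * 2 ^ (r - 1) * (H ^ (r - 1) * Z * (n + 1 : ℕ)) := by positivity
    rcases lt_or_ge Y (Z * β 0 ^ (1 - r)) with hlt | hge
    · have := Real.rpow_le_rpow (add_nonneg hY0 (hy n))
        (by linarith [hyM n] : Y + β n ^ (1 - r) * z n ≤ 2 * (Z * β 0 ^ (1 - r)))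
        (by linarith : 0 ≤ r)
      linarith
    · rcases hY0.eq_or_lt with h0 | hYp
      · have : β n ^ (1 - r) * z n = 0 := le_antisymm (by linarith [hyM n]) (hy n)
        rw [this, ← h0, add_zero, Real.zero_rpow (by linarith)]
        positivity
      · have h1 := rpow_sub_rpow_le hr.le hY0
          (by linarith [hy n] : 0 < Y + β n ^ (1 - r) * z n)
        have h2 : Y / H ≤ β n := by
          refine le_trans ?_ (schedule_ge hβ n)
          rw [hY, Finset.sum_div]
          refine le_trans (Finset.sum_le_sum fun t _ => ?_) (le_add_of_nonneg_left hb.le)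
          exact div_le_div_of_nonneg_left (hy t) (hh t) (hH t)
        have h3 : β n ^ (1 - r) ≤ H ^ (r - 1) / Y ^ (r - 1) := by
          refine (Real.rpow_le_rpow_of_nonpos (by positivity) h2 (by linarith)).trans_eq ?_
          rw [← neg_sub r 1, Real.rpow_neg (by positivity), Real.div_rpow hY0 hH0.le, inv_div]
        have h4 : (Y + β n ^ (1 - r) * z n) ^ (r - 1) ≤ 2 ^ (r - 1) * Y ^ (r - 1) := by
          rw [← Real.mul_rpow two_pos.le hY0]
          exact Real.rpow_le_rpow (add_nonneg hY0 (hy n)) (by linarith [hyM n]) (by linarith)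
        have h5 : β n ^ (1 - r) * z n ≤ H ^ (r - 1) / Y ^ (r - 1) * Z :=
          mul_le_mul h3 (hZ n) (hz n) (by positivity)
        have h6 : r * (Y + β n ^ (1 - r) * z n) ^ (r - 1) * (Y + β n ^ (1 - r) * z n - Y) ≤
            r * 2 ^ (r - 1) * (H ^ (r - 1) * Z) := by
          have hYr : 0 < Y ^ (r - 1) := Real.rpow_pos_of_pos hYp _
          calc _ ≤ r * (2 ^ (r - 1) * Y ^ (r - 1)) * (H ^ (r - 1) / Y ^ (r - 1) * Z) := by
                rw [add_sub_cancel_left]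
                exact mul_le_mul (mul_le_mul_of_nonneg_left h4 (by linarith)) h5 (hy n)
                  (by positivity)
            _ = _ := by field_simp
        push_cast
        linarith

/-- The growth of the sum of the increments in the worst case. -/
theorem sum_increment_le (hr3 : r ≤ 3) (n : ℕ) : ∑ t ∈ Finset.range n, β t ^ (1 - r) * z t ≤
    2 * (Z * β 0 ^ (1 - r)) + 12 * (H ^ (r - 1) * Z * n) ^ (1 / r) := by
  have hZ0 : 0 ≤ Z := (hz 0).trans (hZ 0)
  have hH0 : 0 < H := (hh 0).trans_le (hH 0)
  have hp := schedule_pos hb hh hz hβ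
  have hr0 : 0 < r := by linarith
  have hY0 : 0 ≤ ∑ t ∈ Finset.range n, β t ^ (1 - r) * z t := Finset.sum_nonneg fun t _ =>
    mul_nonneg (Real.rpow_nonneg (hp t).2.le _) (hz t)
  have h1 := Real.rpow_le_rpow (Real.rpow_nonneg hY0 r) (sum_rpow_le hr hb hh hH hz hZ hβ n)
    (by positivity : 0 ≤ 1 / r)
  rw [← Real.rpow_mul hY0, mul_one_div_cancel hr0.ne', Real.rpow_one] at h1
  have hN : 0 ≤ H ^ (r - 1) * Z * n := by positivity
  refine h1.trans ((add_rpow_inv_le hr.le (by positivity) (by positivity)).trans ?_)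
  rw [Real.mul_rpow (by positivity) hN]
  -- The value 12 is attained at r = 3.
  have h2 : r * 2 ^ (r - 1) ≤ 12 := by
    have : (2 : ℝ) ^ (r - 1) ≤ 2 ^ (2 : ℝ) :=
      Real.rpow_le_rpow_of_exponent_le one_le_two (by linarith)
    rw [Real.rpow_two] at this
    nlinarith
  have h3 : (r * 2 ^ (r - 1)) ^ (1 / r) ≤ 12 := by
    have h4 : 1 ≤ r * 2 ^ (r - 1) := by
      have := Real.one_le_rpow one_le_two (by linarith : 0 ≤ r - 1)
      nlinarith
    refine le_trans ?_ h2
    refine (Real.rpow_le_rpow_of_exponent_le h4 ?_).trans_eq (Real.rpow_one _)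
    rw [div_le_one hr0]; exact hr.le
  gcongr

/-- Logarithmic growth of the sum of the increments, in terms of `h` and `z`. -/
theorem sum_increment_le_log {B Λ : ℝ} (hB : β 0 ≤ B) (hΛ : 0 < Λ) (n : ℕ) :
    ∑ t ∈ Finset.range n, β t ^ (1 - r) * z t ≤
      Λ ^ (1 - r) * ∑ t ∈ Finset.range n, h t ^ (r - 1) * z t +
      1 / (1 - 2 ^ (1 - r)) * (Z * β 0 ^ (1 - r)) + 2 * (H * B) +
      2 * Λ * (Real.log (max (β 0 + ∑ t ∈ Finset.range n, β t ^ (1 - r) * z t / h t) B) -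
        Real.log B) := by
  have hZ0 : 0 ≤ Z := (hz 0).trans (hZ 0)
  have hH0 : 0 < H := (hh 0).trans_le (hH 0)
  have hB0 : 0 < B := hb.trans_le hB
  have hp := schedule_pos hb hh hz hβ
  have hy : ∀ t, 0 ≤ β t ^ (1 - r) * z t := fun t =>
    mul_nonneg (Real.rpow_nonneg (hp t).2.le _) (hz t)
  have hy' : ∀ t, 0 ≤ β t ^ (1 - r) * z t / h t := fun t => div_nonneg (hy t) (hh t).le
  -- A minorant of β that follows the recursion with equality, so that its increments telescope even
  -- if β grows faster.
  set x : ℕ → ℝ := fun n => β 0 + ∑ t ∈ Finset.range n, β t ^ (1 - r) * z t / h t with hx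
  have hxs : ∀ t, x (t + 1) = x t + β t ^ (1 - r) * z t / h t := fun t => by
    simp only [hx]; rw [Finset.sum_range_succ]; ring
  have hxp : ∀ t, 0 < x t := fun t =>
    add_pos_of_pos_of_nonneg hb (Finset.sum_nonneg fun s _ => hy' s)
  have hxβ : ∀ t, x t ≤ β t := schedule_ge hβ
  have hc : (2 : ℝ) ^ (1 - r) < 1 := Real.rpow_lt_one_of_one_lt_of_neg one_lt_two (by linarith)
  have hc0 : 0 < 1 / (1 - (2 : ℝ) ^ (1 - r)) := by
    have := sub_pos.mpr hc
    positivity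
  -- Each summand on the right is nonnegative and telescopes or sums to a term of the claim; in
  -- every round one of them alone pays for the increment.
  have step : ∀ t, β t ^ (1 - r) * z t ≤ Λ ^ (1 - r) * (h t ^ (r - 1) * z t) +
      1 / (1 - 2 ^ (1 - r)) * (Z * (x t ^ (1 - r) - x (t + 1) ^ (1 - r))) +
      H * (min (x (t + 1)) (2 * B) - min (x t) (2 * B)) +
      2 * Λ * (Real.log (max (x (t + 1)) B) - Real.log (max (x t) B)) := fun t => by
    have hxx : x t ≤ x (t + 1) := by linarith [hxs t, hy' t]
    have n1 : 0 ≤ Λ ^ (1 - r) * (h t ^ (r - 1) * z t) :=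
      mul_nonneg (Real.rpow_nonneg hΛ.le _) (mul_nonneg (Real.rpow_nonneg (hh t).le _) (hz t))
    have n2 : 0 ≤ 1 / (1 - 2 ^ (1 - r)) * (Z * (x t ^ (1 - r) - x (t + 1) ^ (1 - r))) :=
      mul_nonneg hc0.le (mul_nonneg hZ0 (sub_nonneg.mpr
        (Real.rpow_le_rpow_of_nonpos (hxp t) hxx (by linarith))))
    have n3 : 0 ≤ H * (min (x (t + 1)) (2 * B) - min (x t) (2 * B)) :=
      mul_nonneg hH0.le (sub_nonneg.mpr (min_le_min_right _ hxx))
    have n4 : 0 ≤ 2 * Λ * (Real.log (max (x (t + 1)) B) - Real.log (max (x t) B)) := by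
      have hm : 0 < max (x t) B := lt_max_of_lt_right hB0
      exact mul_nonneg (by positivity) (sub_nonneg.mpr
        (Real.log_le_log hm (max_le_max_right _ hxx)))
    rcases lt_or_ge (2 * x t) (x (t + 1)) with hd | hd
    -- If x more than doubles, x^(1-r) drops by a fixed proportion, and its telescoped total is at
    -- most β 0 ^ (1-r).
    · have h1 : x (t + 1) ^ (1 - r) ≤ 2 ^ (1 - r) * x t ^ (1 - r) := by
        rw [← Real.mul_rpow two_pos.le (hxp t).le]
        exact Real.rpow_le_rpow_of_nonpos (by linarith [hxp t]) hd.le (by linarith)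
      have h2 : x t ^ (1 - r) ≤ 1 / (1 - 2 ^ (1 - r)) * (x t ^ (1 - r) - x (t + 1) ^ (1 - r)) := by
        rw [one_div, inv_mul_eq_div, le_div_iff₀ (sub_pos.mpr hc)]
        linarith
      have h3 : β t ^ (1 - r) * z t ≤ x t ^ (1 - r) * Z :=
        mul_le_mul (Real.rpow_le_rpow_of_nonpos (hxp t) (hxβ t) (by linarith)) (hZ t) (hz t)
          (Real.rpow_nonneg (hxp t).le _)
      have h4 := mul_le_mul_of_nonneg_right h2 hZ0
      linarith
    · rcases le_or_gt (x t) B with hs | hs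
      -- As long as x ≤ B, increments are paid by H times the growth of x up to 2B.
      · rw [min_eq_left (by linarith : x (t + 1) ≤ 2 * B),
          min_eq_left (by linarith : x t ≤ 2 * B)] at n3 ⊢
        have : β t ^ (1 - r) * z t ≤ H * (x (t + 1) - x t) := by
          rw [hxs, add_sub_cancel_left]
          calc β t ^ (1 - r) * z t = h t * (β t ^ (1 - r) * z t / h t) := by
                field_simp [(hh t).ne']
            _ ≤ _ := mul_le_mul_of_nonneg_right (hH t) (hy' t)
        linarith
      · rw [max_eq_left (by linarith : B ≤ x (t + 1)), max_eq_left hs.le] at n4 ⊢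
        -- If h β ≥ Λ, the increment is at most Λ^(1-r) h^(r-1) z. Otherwise it equals h times the
        -- growth of x, hence is at most Λ times the relative growth, which is logarithmic because x
        -- at most doubles.
        rcases le_or_gt Λ (h t * β t) with hl | hl
        · have h1 : β t ^ (1 - r) ≤ Λ ^ (1 - r) * h t ^ (r - 1) := by
            have := Real.rpow_le_rpow_of_nonpos hΛ hl (by linarith : 1 - r ≤ 0)
            rw [Real.mul_rpow (hh t).le (hp t).2.le, ← neg_sub r 1, Real.rpow_neg (hh t).le,
              inv_mul_le_iff₀ (Real.rpow_pos_of_pos (hh t) _)] at this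
            rw [← neg_sub r 1]
            linarith
          have := mul_le_mul_of_nonneg_right h1 (hz t)
          linarith
        · have h1 : β t ^ (1 - r) * z t ≤ Λ * ((x (t + 1) - x t) / x t) := by
            have e : β t ^ (1 - r) * z t = h t * (x (t + 1) - x t) := by
              rw [hxs, add_sub_cancel_left]; field_simp [(hh t).ne']
            rw [e, ← mul_div_assoc, le_div_iff₀ (hxp t)]
            have h5 : h t * x t ≤ Λ :=
              (mul_le_mul_of_nonneg_left (hxβ t) (hh t).le).trans hl.le
            have := mul_le_mul_of_nonneg_right h5 (sub_nonneg.mpr hxx)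
            linarith
          have h2 : (x (t + 1) - x t) / x t ≤ 2 * (Real.log (x (t + 1)) - Real.log (x t)) := by
            rw [← Real.log_div (hxp _).ne' (hxp t).ne']
            have h6 := Real.one_sub_inv_le_log_of_pos (div_pos (hxp (t + 1)) (hxp t))
            rw [inv_div] at h6
            have h7 : (x (t + 1) - x t) / x t ≤ 2 * (1 - x t / x (t + 1)) := by
              rw [one_sub_div (hxp _).ne', ← mul_div_assoc, div_le_div_iff₀ (hxp t) (hxp _)]
              nlinarith
            linarith
          have h3 := mul_le_mul_of_nonneg_left h2 hΛ.le
          linarith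
  have hs := Finset.sum_le_sum fun t (_ : t ∈ Finset.range n) => step t
  simp only [Finset.sum_add_distrib, ← Finset.mul_sum] at hs
  rw [Finset.sum_range_sub' (fun t => x t ^ (1 - r)),
    Finset.sum_range_sub (fun t => min (x t) (2 * B)),
    Finset.sum_range_sub (fun t => Real.log (max (x t) B))] at hs
  have hx0 : x 0 = β 0 := by simp [hx]
  rw [hx0, max_eq_right hB] at hs
  have e1 : 1 / (1 - 2 ^ (1 - r)) * (Z * (β 0 ^ (1 - r) - x n ^ (1 - r))) ≤
      1 / (1 - 2 ^ (1 - r)) * (Z * β 0 ^ (1 - r)) := by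
    refine mul_le_mul_of_nonneg_left (mul_le_mul_of_nonneg_left ?_ hZ0) hc0.le
    linarith [Real.rpow_nonneg (hxp n).le (1 - r)]
  have e2 : H * (min (x n) (2 * B) - min (β 0) (2 * B)) ≤ 2 * (H * B) := by
    have h1 : min (x n) (2 * B) ≤ 2 * B := min_le_right _ _
    have h2 : 0 ≤ min (β 0) (2 * B) := le_min hb.le (by linarith)
    nlinarith
  linarith

omit hb hh hz hβ hr hZ hH in
/-- The constant in the logarithmic growth bound. -/
noncomputable def scheduleConst (r : ℝ) : ℝ := 1 / (1 - 2 ^ (1 - r)) + 2 / (r - 1) + 32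

omit hb hh hz hβ hr hZ hH in
theorem scheduleConst_ge {r : ℝ} (hr : 1 < r) : 32 ≤ scheduleConst r := by
  have hc : (2 : ℝ) ^ (1 - r) < 1 := Real.rpow_lt_one_of_one_lt_of_neg one_lt_two (by linarith)
  have h1 : 0 < 1 / (1 - (2 : ℝ) ^ (1 - r)) := by
    have := sub_pos.mpr hc
    positivity
  have h2 : 0 < 2 / (r - 1) := by
    have := sub_pos.mpr hr
    positivity
  unfold scheduleConst
  linarith

/-- Rounds of small entropy could make log β large. They are treated by the worst-case bound with
the entropy capped at θ; the other rounds have entropy at least θ, which limits the range of the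
logarithm. Both subfamilies still satisfy the recursion, since deleting increments only weakens it.
-/
theorem sum_increment_le_logPlus (hr3 : r ≤ 3) {U Λ : ℝ} (hU : 0 < U) (hΛ : 0 < Λ) (hZp : 0 < Z)
    {n : ℕ} (hn : 1 ≤ n) : ∑ t ∈ Finset.range n, β t ^ (1 - r) * z t ≤
      Λ ^ (1 - r) * ∑ t ∈ Finset.range n, h t ^ (r - 1) * z t +
      scheduleConst r * (Z * β 0 ^ (1 - r) + β 0 * H + U +
        Λ * Params.logPlus (Z * H ^ (r - 1) * n / U ^ r)) := by
  have hr0 : 0 < r := by linarith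
  have hr1 : 0 < r - 1 := by linarith
  have hH0 : 0 < H := (hh 0).trans_le (hH 0)
  have hn0 : (0 : ℝ) < n := by exact_mod_cast hn
  have hp := schedule_pos hb hh hz hβ
  have hC := scheduleConst_ge hr
  have hM : 0 ≤ Z * β 0 ^ (1 - r) := by positivity
  have hHb : 0 < β 0 * H := by positivity
  have hl : 1 ≤ Params.logPlus (Z * H ^ (r - 1) * n / U ^ r) := le_max_left _ _
  have hS : 0 ≤ Λ ^ (1 - r) * ∑ t ∈ Finset.range n, h t ^ (r - 1) * z t :=
    mul_nonneg (Real.rpow_nonneg hΛ.le _) (Finset.sum_nonneg fun t _ =>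
      mul_nonneg (Real.rpow_nonneg (hh t).le _) (hz t))
  have hΛl : 0 ≤ Λ * Params.logPlus (Z * H ^ (r - 1) * n / U ^ r) := by positivity
  -- Chosen so that the worst-case bound with entropy at most θ is of order U.
  set θ : ℝ := (U ^ r / (Z * n)) ^ (1 / (r - 1)) with hθ
  have hθ0 : 0 < θ := by positivity
  have hθr : θ ^ (r - 1) * Z * n = U ^ r := by
    rw [hθ, ← Real.rpow_mul (by positivity), one_div_mul_cancel hr1.ne', Real.rpow_one]
    field_simp
  have hUr : (θ ^ (r - 1) * Z * n) ^ (1 / r) = U := by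
    rw [hθr, ← Real.rpow_mul hU.le, mul_one_div_cancel hr0.ne', Real.rpow_one]
  have hlow : ∑ t ∈ Finset.range n, β t ^ (1 - r) * (if h t ≤ θ then z t else 0) ≤
      2 * (Z * β 0 ^ (1 - r)) + 12 * U := by
    rw [← hUr]
    refine sum_increment_le (h := fun t => min (h t) θ) (z := fun t => if h t ≤ θ then z t else 0)
      hr hb (fun t => lt_min (hh t) hθ0) (fun t => min_le_right _ _) (fun t => ?_) (fun t => ?_)
      (fun t => ?_) hr3 n
    · split_ifs
      · exact hz t
      · exact le_rfl
    · split_ifs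
      · exact hZ t
      · exact hZp.le
    · have := hβ t
      have h1 := div_nonneg (mul_nonneg (Real.rpow_nonneg (hp t).2.le (1 - r)) (hz t)) (hh t).le
      split_ifs with hc
      · rwa [min_eq_left hc]
      · rw [mul_zero, zero_div]; linarith
  have hsplit : ∑ t ∈ Finset.range n, β t ^ (1 - r) * z t =
      ∑ t ∈ Finset.range n, β t ^ (1 - r) * (if h t ≤ θ then z t else 0) +
      ∑ t ∈ Finset.range n, β t ^ (1 - r) * (if h t ≤ θ then 0 else z t) := by
    rw [← Finset.sum_add_distrib]
    refine Finset.sum_congr rfl fun t _ => ?_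
    split_ifs <;> simp
  rcases le_or_gt H θ with hHθ | hHθ
  · have : ∑ t ∈ Finset.range n, β t ^ (1 - r) * (if h t ≤ θ then 0 else z t) = 0 := by
      refine Finset.sum_eq_zero fun t _ => ?_
      rw [if_pos ((hH t).trans hHθ), mul_zero]
    rw [hsplit, this, add_zero]
    nlinarith
  · have q1 : ∀ t, 0 < max (h t) θ := fun t => lt_max_of_lt_right hθ0
    have q2 : ∀ t, max (h t) θ ≤ H := fun t => max_le (hH t) hHθ.le
    have q3 : ∀ t, 0 ≤ (if h t ≤ θ then 0 else z t) := fun t => by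
      split_ifs
      · exact le_rfl
      · exact hz t
    have q4 : ∀ t, (if h t ≤ θ then 0 else z t) ≤ Z := fun t => by
      split_ifs
      · exact hZp.le
      · exact hZ t
    have q5 : ∀ t, β t + β t ^ (1 - r) * (if h t ≤ θ then 0 else z t) / max (h t) θ ≤ β (t + 1) :=
      fun t => by
        have := hβ t
        have h1 := div_nonneg (mul_nonneg (Real.rpow_nonneg (hp t).2.le (1 - r)) (hz t)) (hh t).le
        split_ifs with hc
        · rw [mul_zero, zero_div]; linarith
        · rwa [max_eq_left (not_le.mp hc).le]
    set M := Z * β 0 ^ (1 - r) with hMdef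
    -- The largest initial phase whose cost H B is still made of terms of the claim. Starting the
    -- logarithm at B removes β 0 and M from its argument.
    set B := β 0 + (U + M) / H with hBdef
    have hB0 : β 0 ≤ B := le_add_of_nonneg_right (by positivity)
    have hBp : 0 < B := hb.trans_le hB0
    have hhigh := sum_increment_le_log hr hb q1 q2 q3 q4 q5 hB0 hΛ n
    have hY := sum_increment_le hr hb q1 q2 q3 q4 q5 hr3 n
    rw [← hMdef] at hhigh hY
    have e1 : ∑ t ∈ Finset.range n, max (h t) θ ^ (r - 1) * (if h t ≤ θ then 0 else z t) ≤
        ∑ t ∈ Finset.range n, h t ^ (r - 1) * z t := by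
      refine Finset.sum_le_sum fun t _ => ?_
      split_ifs with hc
      · rw [mul_zero]
        exact mul_nonneg (Real.rpow_nonneg (hh t).le _) (hz t)
      · rw [max_eq_left (not_le.mp hc).le]
    set N := H ^ (r - 1) * Z * n with hN
    have hN0 : 0 < N := by positivity
    have e2 : ∑ t ∈ Finset.range n,
        β t ^ (1 - r) * (if h t ≤ θ then 0 else z t) / max (h t) θ ≤
        (2 * M + 12 * N ^ (1 / r)) / θ := by
      refine le_trans ?_ (div_le_div_of_nonneg_right hY hθ0.le)
      rw [Finset.sum_div]
      refine Finset.sum_le_sum fun t _ => ?_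
      exact div_le_div_of_nonneg_left (mul_nonneg (Real.rpow_nonneg (hp t).2.le _) (q3 t)) hθ0
        (le_max_right _ _)
    set X := Z * H ^ (r - 1) * n / U ^ r with hX
    have hXN : X = N / U ^ r := by rw [hX, hN]; ring
    have hX0 : 0 < X := by positivity
    have hHX : H / θ = X ^ (1 / (r - 1)) := by
      have h1 : H = (H ^ (r - 1)) ^ (1 / (r - 1)) := by
        rw [← Real.rpow_mul hH0.le, mul_one_div_cancel hr1.ne', Real.rpow_one]
      have h2 : X = H ^ (r - 1) / (U ^ r / (Z * n)) := by
        rw [hX]; field_simp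
      rw [h2, Real.div_rpow (by positivity) (by positivity), ← h1]
    have hNX : N ^ (1 / r) / U = X ^ (1 / r) := by
      rw [hXN, Real.div_rpow hN0.le (by positivity), ← Real.rpow_mul hU.le,
        mul_one_div_cancel hr0.ne', Real.rpow_one]
    have hX1 : 1 ≤ X := by
      by_contra! hlt
      have h1 : X ^ (1 / (r - 1)) < 1 := Real.rpow_lt_one hX0.le hlt (by positivity)
      rw [← hHX, div_lt_one hθ0] at h1
      linarith
    -- The ratio is at most 15 X^(1/(r-1) + 1/r), with 15 = 1 + 2 + 12, so its logarithm is a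
    -- multiple of `logPlus X`.
    have e3 : Real.log (max (β 0 + ∑ t ∈ Finset.range n,
        β t ^ (1 - r) * (if h t ≤ θ then 0 else z t) / max (h t) θ) B) - Real.log B ≤
        (15 + 1 / (r - 1)) * Params.logPlus X := by
      have hmp : 0 < max (β 0 + ∑ t ∈ Finset.range n,
        β t ^ (1 - r) * (if h t ≤ θ then 0 else z t) / max (h t) θ) B := lt_max_of_lt_right hBp
      rw [← Real.log_div hmp.ne' hBp.ne']
      have f1 : max (β 0 + ∑ t ∈ Finset.range n,
          β t ^ (1 - r) * (if h t ≤ θ then 0 else z t) / max (h t) θ) B ≤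
          B + (2 * M + 12 * N ^ (1 / r)) / θ := by
        refine max_le (by linarith) (le_add_of_nonneg_right (by positivity))
      have f2 : (2 * M + 12 * N ^ (1 / r)) / θ ≤ B * (H / θ * (2 + 12 * X ^ (1 / r))) := by
        rw [← hNX]
        have g1 : (U + M) / H ≤ B := by rw [hBdef]; linarith
        refine le_trans ?_ (mul_le_mul_of_nonneg_right g1 (by positivity))
        have g2 : (U + M) / H * (H / θ * (2 + 12 * (N ^ (1 / r) / U))) =
            (2 * M + 12 * N ^ (1 / r) + (2 * U + 12 * (M * N ^ (1 / r) / U))) / θ := by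
          field_simp; ring
        rw [g2]
        refine div_le_div_of_nonneg_right (le_add_of_nonneg_right ?_) hθ0.le
        positivity
      have f3 : 1 + H / θ * (2 + 12 * X ^ (1 / r)) ≤ 15 * X ^ (1 / (r - 1) + 1 / r) := by
        rw [hHX, Real.rpow_add hX0]
        have g1 : 1 ≤ X ^ (1 / (r - 1)) := Real.one_le_rpow hX1 (by positivity)
        have g2 : 1 ≤ X ^ (1 / r) := Real.one_le_rpow hX1 (by positivity)
        nlinarith
      have f4 : max (β 0 + ∑ t ∈ Finset.range n,
          β t ^ (1 - r) * (if h t ≤ θ then 0 else z t) / max (h t) θ) B / B ≤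
          15 * X ^ (1 / (r - 1) + 1 / r) := by
        rw [div_le_iff₀ hBp]
        have := mul_le_mul_of_nonneg_left f3 hBp.le
        linarith
      refine (Real.log_le_log (div_pos hmp hBp) f4).trans ?_
      rw [Real.log_mul (by norm_num) (by positivity), Real.log_rpow hX0]
      have g1 : Real.log 15 ≤ 14 := by
        have := Real.log_le_sub_one_of_pos (by norm_num : (0 : ℝ) < 15)
        linarith
      have g2 : Real.log X ≤ Params.logPlus X := le_max_right _ _
      have g3 : 1 / r ≤ 1 := by rw [div_le_one hr0]; exact hr.le
      have g4 : (1 / (r - 1) + 1 / r) * Real.log X ≤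
          (1 / (r - 1) + 1) * Params.logPlus X :=
        mul_le_mul (by linarith) g2 (Real.log_nonneg hX1) (by positivity)
      linarith
    have hHB : H * B = β 0 * H + U + M := by
      rw [hBdef]; field_simp; ring
    have e4 := mul_le_mul_of_nonneg_left e1 (Real.rpow_nonneg hΛ.le (1 - r))
    have e5 := mul_le_mul_of_nonneg_left e3 (by linarith : 0 ≤ 2 * Λ)
    rw [hHB] at hhigh
    rw [hsplit]
    have hc1 : 1 / (1 - (2 : ℝ) ^ (1 - r)) + 32 ≤ scheduleConst r := by
      have : 0 < 2 / (r - 1) := by positivity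
      unfold scheduleConst; linarith
    have hc2 : 30 + 2 * (1 / (r - 1)) ≤ scheduleConst r := by
      have hc : (2 : ℝ) ^ (1 - r) < 1 :=
        Real.rpow_lt_one_of_one_lt_of_neg one_lt_two (by linarith)
      have : 0 < 1 / (1 - (2 : ℝ) ^ (1 - r)) := one_div_pos.mpr (sub_pos.mpr hc)
      have e : 2 / (r - 1) = 2 * (1 / (r - 1)) := by ring
      unfold scheduleConst; linarith
    have t1 := mul_le_mul_of_nonneg_right hc1 hM
    have t2 := mul_le_mul_of_nonneg_right hC hHb.le
    have t3 := mul_le_mul_of_nonneg_right hC hU.le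
    have t4 := mul_le_mul_of_nonneg_right hc2 hΛl
    linarith

end Schedule

/-! ### The schedule bounds for z and w. -/

namespace Params.IsAdmissible

variable {K d : ℕ} {P : Params K d} (hP : P.IsAdmissible)
include hP

/-- The bounds on the sum of one of the two components of the increments. -/
theorem sum_component_le {r : ℝ} (hr : 1 < r) (hr3 : r ≤ 3) {f : State K → ℝ}
    (hf : ∀ st, P.β₁ ≤ st.β → 0 ≤ f st)
    (hfi : ∀ st, P.β₁ ≤ st.β → st.β ^ (1 - r) * f st ≤ P.incr st) (o : ℕ → Obs K) {T : ℕ}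
    (hT : 1 ≤ T) {Z : ℝ} (hZ0 : 0 < Z) (hZ : ∀ t < T, f (P.traj o t) ≤ Z) :
    ∑ t ∈ Finset.range T, (P.traj o t).β ^ (1 - r) * f (P.traj o t) ≤
      2 * (Z * P.β₁ ^ (1 - r)) + 12 * (P.h₁ ^ (r - 1) * Z * T) ^ (1 / r) ∧
    ∀ {U Λ : ℝ}, 0 < U → 0 < Λ →
      ∑ t ∈ Finset.range T, (P.traj o t).β ^ (1 - r) * f (P.traj o t) ≤
        Λ ^ (1 - r) * ∑ t ∈ Finset.range T, P.h (P.traj o t) ^ (r - 1) * f (P.traj o t) +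
        scheduleConst r * (Z * P.β₁ ^ (1 - r) + P.β₁ * P.h₁ + U +
          Λ * logPlus (Z * P.h₁ ^ (r - 1) * T / U ^ r)) := by
  -- The bound Z is known only before round T, whereas the schedule lemmas concern infinite
  -- sequences.
  set g : ℕ → ℝ := fun t => if t < T then f (P.traj o t) else 0 with hg
  have hst := hP.β₁_le_traj o
  have e1 : ∑ t ∈ Finset.range T, (P.traj o t).β ^ (1 - r) * f (P.traj o t) =
      ∑ t ∈ Finset.range T, (P.traj o t).β ^ (1 - r) * g t :=
    Finset.sum_congr rfl fun t ht => by rw [hg]; simp only; rw [if_pos (Finset.mem_range.mp ht)]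
  have e2 : ∑ t ∈ Finset.range T, P.h (P.traj o t) ^ (r - 1) * f (P.traj o t) =
      ∑ t ∈ Finset.range T, P.h (P.traj o t) ^ (r - 1) * g t :=
    Finset.sum_congr rfl fun t ht => by rw [hg]; simp only; rw [if_pos (Finset.mem_range.mp ht)]
  have hb : 0 < (P.traj o 0).β := hP.β_pos (hst 0)
  have hh : ∀ t, 0 < P.h (P.traj o t) := fun t => hP.h_pos (hst t)
  have hH : ∀ t, P.h (P.traj o t) ≤ P.h₁ := fun t => hP.h_le_h₁ _
  have g0 : ∀ t, 0 ≤ g t := fun t => by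
    simp only [hg]; split_ifs
    · exact hf _ (hst t)
    · exact le_rfl
  have gZ : ∀ t, g t ≤ Z := fun t => by
    simp only [hg]; split_ifs with h
    · exact hZ t h
    · exact hZ0.le
  have hβ : ∀ t, (P.traj o t).β + (P.traj o t).β ^ (1 - r) * g t / P.h (P.traj o t) ≤
      (P.traj o (t + 1)).β := fun t => by
    have h1 := hP.next_β_sub (hst t) (o t)
    have h2 : (P.traj o t).β ^ (1 - r) * g t ≤ P.incr (P.traj o t) := by
      refine le_trans ?_ (hfi _ (hst t))
      refine mul_le_mul_of_nonneg_left ?_ (Real.rpow_nonneg (hP.β_pos (hst t)).le _)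
      simp only [hg]; split_ifs
      · exact le_rfl
      · exact hf _ (hst t)
    have h3 : (P.traj o t).β ^ (1 - r) * g t / P.h (P.traj o t) ≤
        (P.traj o (t + 1)).β - (P.traj o t).β := by
      rw [div_le_iff₀ (hh t), traj_succ, h1]
      exact h2
    linarith
  rw [e1, e2]
  exact ⟨sum_increment_le hr hb hh hH g0 gZ hβ hr3 T, fun hU hΛ =>
    sum_increment_le_logPlus hr hb hh hH g0 gZ hβ hr3 hU hΛ hZ0 hT⟩

theorem sum_z_component_le (o : ℕ → Obs K) {T : ℕ} (hT : 1 ≤ T) :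
    ∑ t ∈ Finset.range T, (P.traj o t).β ^ (1 - P.ε) * P.z (P.traj o t) ≤
      2 * (P.zMax T * P.β₁ ^ (1 - P.ε)) +
        12 * (P.h₁ ^ (P.ε - 1) * P.zMax T * T) ^ (1 / P.ε) ∧
    ∀ {U Λ : ℝ}, 0 < U → 0 < Λ →
      ∑ t ∈ Finset.range T, (P.traj o t).β ^ (1 - P.ε) * P.z (P.traj o t) ≤
        Λ ^ (1 - P.ε) * ∑ t ∈ Finset.range T, P.h (P.traj o t) ^ (P.ε - 1) * P.z (P.traj o t) +
        scheduleConst P.ε * (P.zMax T * P.β₁ ^ (1 - P.ε) + P.β₁ * P.h₁ + U +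
          Λ * logPlus (P.zMax T * P.h₁ ^ (P.ε - 1) * T / U ^ P.ε)) :=
  hP.sum_component_le hP.one_lt_ε (hP.ε_le_two.trans (by norm_num)) (f := P.z)
    (fun _ h => (hP.z_pos h).le) (fun _ h => le_add_of_nonneg_right
      (mul_nonneg (Real.rpow_nonneg (hP.β_pos h).le _) (hP.w_pos h).le)) o hT
    (hP.zMax_pos hT) (fun _ ht => hP.z_le_zMax _ ht)

theorem sum_w_component_le (o : ℕ → Obs K) {T : ℕ} (hT : 1 ≤ T) :
    ∑ t ∈ Finset.range T, (P.traj o t).β ^ (-2 : ℝ) * P.w (P.traj o t) ≤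
      2 * (P.wMax T * P.β₁ ^ (-2 : ℝ)) +
        12 * (P.h₁ ^ (2 : ℝ) * P.wMax T * T) ^ (1 / 3 : ℝ) ∧
    ∀ {U Λ : ℝ}, 0 < U → 0 < Λ →
      ∑ t ∈ Finset.range T, (P.traj o t).β ^ (-2 : ℝ) * P.w (P.traj o t) ≤
        Λ ^ (-2 : ℝ) * ∑ t ∈ Finset.range T, P.h (P.traj o t) ^ (2 : ℝ) * P.w (P.traj o t) +
        scheduleConst 3 * (P.wMax T * P.β₁ ^ (-2 : ℝ) + P.β₁ * P.h₁ + U +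
          Λ * logPlus (P.wMax T * P.h₁ ^ (2 : ℝ) * T / U ^ (3 : ℝ))) := by
  have e1 : (1 - 3 : ℝ) = -2 := by norm_num
  have e2 : (3 - 1 : ℝ) = 2 := by norm_num
  have := hP.sum_component_le (r := 3) (by norm_num) le_rfl (f := P.w)
    (fun _ h => (hP.w_pos h).le) (fun _ h => by
      rw [e1]
      exact le_add_of_nonneg_left
        (mul_nonneg (Real.rpow_nonneg (hP.β_pos h).le _) (hP.z_pos h).le)) o hT
    (hP.wMax_pos hT) (fun _ ht => hP.w_le_wMax _ ht)
  rwa [e1, e2] at this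

theorem sum_incr_le (o : ℕ → Obs K) {T : ℕ} (hT : 1 ≤ T) :
    ∑ t ∈ Finset.range T, P.incr (P.traj o t) ≤
      2 * (P.zMax T * P.β₁ ^ (1 - P.ε) + P.wMax T * P.β₁ ^ (-2 : ℝ)) +
      12 * (P.h₁ ^ (1 - 1 / P.ε) * (P.zMax T * T) ^ (1 / P.ε) +
        P.h₁ ^ (2 / 3 : ℝ) * (P.wMax T * T) ^ (1 / 3 : ℝ)) := by
  have h1 := (hP.sum_z_component_le o hT).1
  have h2 := (hP.sum_w_component_le o hT).1
  have hh := hP.h₁_pos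
  have hz := hP.zMax_pos hT
  have hw := hP.wMax_pos hT
  have hε := hP.ε_pos
  rw [mul_assoc _ (P.zMax T), Real.mul_rpow (by positivity) (by positivity),
    ← Real.rpow_mul hh.le, show (P.ε - 1) * (1 / P.ε) = 1 - 1 / P.ε by field_simp] at h1
  rw [mul_assoc _ (P.wMax T), Real.mul_rpow (by positivity) (by positivity),
    ← Real.rpow_mul hh.le, show (2 : ℝ) * (1 / 3) = 2 / 3 by norm_num] at h2
  simp only [incr, Finset.sum_add_distrib]
  linarith

/-- The cutoffs U are (ζ^(ε/(ε-1)) + C)^(1/ε) and (ω^(3/2) + C)^(1/3); their r-th powers are the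
denominators inside the logarithms. -/
theorem sum_incr_le_log (o : ℕ → Obs K) {T : ℕ} (hT : 1 ≤ T) {Δ : Fin K → ℝ} {astar : Fin K}
    (hΔ : ∀ a, 0 ≤ Δ a) (hpos : ∀ a, a ≠ astar → 0 < Δ a) (hΔ1 : ∀ a, Δ a ≤ 1) {C : ℝ} (hC : 0 ≤ C)
    {Λ Λ' : ℝ} (hΛ : 0 < Λ) (hΛ' : 0 < Λ') :
    ∑ t ∈ Finset.range T, P.incr (P.traj o t) ≤
      (Λ ^ (1 - P.ε) * P.ζ Δ astar + Λ' ^ (-2 : ℝ) * (2 * P.ω Δ astar)) *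
        ∑ t ∈ Finset.range T, ∑ a, Δ a * P.p (P.traj o t) a +
      (scheduleConst P.ε + scheduleConst 3) * (2 * P.κ T +
        (P.ζ Δ astar ^ (P.ε / (P.ε - 1)) + C) ^ (1 / P.ε) +
        (P.ω Δ astar ^ (3 / 2 : ℝ) + C) ^ (1 / 3 : ℝ) +
        Λ * logPlus (P.zMax T * P.h₁ ^ (P.ε - 1) * T / (P.ζ Δ astar ^ (P.ε / (P.ε - 1)) + C)) +
        Λ' * logPlus (P.wMax T * P.h₁ ^ 2 * T / (P.ω Δ astar ^ (3 / 2 : ℝ) + C))) := by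
  have hζ := hP.ζ_pos hpos
  have hω := hP.ω_pos hpos
  have hst := hP.β₁_le_traj o
  have hε := hP.ε_pos
  have hU : 0 < P.ζ Δ astar ^ (P.ε / (P.ε - 1)) + C := by positivity
  have hU' : 0 < P.ω Δ astar ^ (3 / 2 : ℝ) + C := by positivity
  have h1 := (hP.sum_z_component_le o hT).2 (Real.rpow_pos_of_pos hU (1 / P.ε)) hΛ
  have h2 := (hP.sum_w_component_le o hT).2 (Real.rpow_pos_of_pos hU' (1 / 3)) hΛ'
  rw [← Real.rpow_mul hU.le, one_div_mul_cancel hε.ne', Real.rpow_one] at h1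
  rw [← Real.rpow_mul hU'.le, one_div_mul_cancel three_ne_zero, Real.rpow_one] at h2
  simp only [Real.rpow_two] at h2
  set Sz := ∑ t ∈ Finset.range T, P.h (P.traj o t) ^ (P.ε - 1) * P.z (P.traj o t)
  set Sw := ∑ t ∈ Finset.range T, P.h (P.traj o t) ^ 2 * P.w (P.traj o t)
  have h3 : Sz ≤ P.ζ Δ astar * ∑ t ∈ Finset.range T, ∑ a, Δ a * P.p (P.traj o t) a := by
    rw [Finset.mul_sum]
    exact Finset.sum_le_sum fun t _ => hP.h_rpow_mul_z_le hΔ hpos (hst t)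
  have h4 : Sw ≤ 2 * P.ω Δ astar * ∑ t ∈ Finset.range T, ∑ a, Δ a * P.p (P.traj o t) a := by
    rw [Finset.mul_sum]
    exact Finset.sum_le_sum fun t _ => hP.h_sq_mul_w_le hΔ hpos (hst t) hΔ1
  have h5 := mul_le_mul_of_nonneg_left h3 (Real.rpow_nonneg hΛ.le (1 - P.ε))
  have h6 := mul_le_mul_of_nonneg_left h4 (Real.rpow_nonneg hΛ'.le (-2))
  set L := logPlus (P.zMax T * P.h₁ ^ (P.ε - 1) * T / (P.ζ Δ astar ^ (P.ε / (P.ε - 1)) + C))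
  set L' := logPlus (P.wMax T * P.h₁ ^ 2 * T / (P.ω Δ astar ^ (3 / 2 : ℝ) + C))
  have hL : 1 ≤ L := le_max_left _ _
  have hL' : 1 ≤ L' := le_max_left _ _
  set U := (P.ζ Δ astar ^ (P.ε / (P.ε - 1)) + C) ^ (1 / P.ε)
  set U' := (P.ω Δ astar ^ (3 / 2 : ℝ) + C) ^ (1 / 3 : ℝ)
  have hU0 : 0 < U := Real.rpow_pos_of_pos hU _
  have hU0' : 0 < U' := Real.rpow_pos_of_pos hU' _
  have hb := hP.β₁_pos
  have hh := hP.h₁_pos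
  have hz := hP.zMax_pos hT
  have hw := hP.wMax_pos hT
  have hbar := mul_nonneg hP.βbar_pos.le hP.hbar_nonneg
  have n1 : 0 < P.zMax T * P.β₁ ^ (1 - P.ε) := by positivity
  have n2 : 0 < P.wMax T * P.β₁ ^ (-2 : ℝ) := by positivity
  have n3 : 0 < P.β₁ * P.h₁ := by positivity
  have n4 : 0 < Λ * L := by positivity
  have n5 : 0 < Λ' * L' := by positivity
  have c1 := scheduleConst_ge hP.one_lt_ε
  have c2 := scheduleConst_ge (r := 3) (by norm_num)
  have e : ∑ t ∈ Finset.range T, P.incr (P.traj o t) =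
      ∑ t ∈ Finset.range T, (P.traj o t).β ^ (1 - P.ε) * P.z (P.traj o t) +
      ∑ t ∈ Finset.range T, (P.traj o t).β ^ (-2 : ℝ) * P.w (P.traj o t) := by
    simp only [incr, Finset.sum_add_distrib]
  rw [e]
  have h7 : scheduleConst P.ε * (P.zMax T * P.β₁ ^ (1 - P.ε) + P.β₁ * P.h₁ + U + Λ * L) +
      scheduleConst 3 * (P.wMax T * P.β₁ ^ (-2 : ℝ) + P.β₁ * P.h₁ + U' + Λ' * L') ≤
      (scheduleConst P.ε + scheduleConst 3) * (2 * P.κ T + U + U' + Λ * L + Λ' * L') := by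
    unfold κ
    nlinarith [mul_nonneg (by linarith : 0 ≤ scheduleConst P.ε) (by linarith : 0 ≤ P.zMax T * P.β₁ ^ (1 - P.ε) + P.β₁ * P.h₁ + 2 * (P.wMax T * P.β₁ ^ (-2 : ℝ)) + 2 * (P.βbar * P.hbar) + U' + Λ' * L'),
      mul_nonneg (by linarith : 0 ≤ scheduleConst 3) (by linarith : 0 ≤ 2 * (P.zMax T * P.β₁ ^ (1 - P.ε)) + P.β₁ * P.h₁ + P.wMax T * P.β₁ ^ (-2 : ℝ) + 2 * (P.βbar * P.hbar) + U + Λ * L)]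
  linarith

end Params.IsAdmissible

/-- The trade-off between the leading term and the corruption. -/
theorem exists_tradeoff {ε I C : ℝ} (hε : 1 < ε) (hI : 0 < I) (hC : 0 ≤ C) :
    ∃ τ : ℝ, 0 < τ ∧ τ ≤ 1 ∧ τ * C ≤ I + C ^ (1 / ε) * I ^ (1 - 1 / ε) ∧
      τ ^ (-(1 / (ε - 1))) * I ≤ I + C ^ (1 / ε) * I ^ (1 - 1 / ε) := by
  have h0 : 0 < ε := by linarith
  have h1 : 0 < ε - 1 := by linarith
  have hIC : 0 < I + C := by linarith
  have hJ : I ^ (1 - 1 / ε) * (I + C) ^ (1 / ε) ≤ I + C ^ (1 / ε) * I ^ (1 - 1 / ε) := by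
    have h2 := Real.rpow_add_le_add_rpow (p := 1 / ε) hI.le hC (by positivity)
      (by rw [div_le_one h0]; exact hε.le)
    refine (mul_le_mul_of_nonneg_left h2 (Real.rpow_nonneg hI.le _)).trans_eq ?_
    rw [mul_add, ← Real.rpow_add hI, sub_add_cancel, Real.rpow_one, mul_comm (C ^ _)]
  -- This τ makes τ(I + C) and τ^(-1/(ε-1)) I both equal to I^(1-1/ε) (I + C)^(1/ε).
  refine ⟨(I / (I + C)) ^ (1 - 1 / ε), by positivity, ?_, ?_, ?_⟩
  · refine Real.rpow_le_one (by positivity) ?_ ?_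
    · rw [div_le_one hIC]; linarith
    · rw [sub_nonneg, div_le_one h0]; exact hε.le
  · refine le_trans ?_ hJ
    calc (I / (I + C)) ^ (1 - 1 / ε) * C ≤ (I / (I + C)) ^ (1 - 1 / ε) * (I + C) := by
          gcongr; linarith
      _ = _ := by
          rw [Real.div_rpow hI.le hIC.le, div_mul_eq_mul_div, mul_div_assoc]
          congr 1
          rw [div_eq_iff (by positivity), ← Real.rpow_add hIC, add_sub_cancel, Real.rpow_one]
  · refine le_trans (le_of_eq ?_) hJ
    rw [← Real.rpow_mul (by positivity), show (1 - 1 / ε) * -(1 / (ε - 1)) = -(1 / ε) by field_simp,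
      Real.rpow_neg (by positivity), Real.div_rpow hI.le hIC.le, inv_div, Real.rpow_sub hI,
      Real.rpow_one]
    ring

/-- A lower bound on the leading term `ι'`. -/
noncomputable def iotaFloor (ε σ₀ : ℝ) : ℝ := (σ₀ ^ (3 / ε)) ^ (1 / 2 : ℝ) * (3 / 2 : ℝ) ^ (-1 / 2 : ℝ)

/-- The constant of the regret bound under a self-bounding constraint. -/
noncomputable def selfBoundingConst (ε σ₀ : ℝ) : ℝ :=
  max 1 (3 + 1036 * (scheduleConst ε + scheduleConst 3) *
    (4 + 1 / iotaFloor ε σ₀ + 2 * iotaFloor ε σ₀ ^ (-(1 - 1 / ε)) +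
      ((2072 : ℝ) ^ (1 / (ε - 1)) + 6216)))

/-! ### The regret bounds. -/

namespace Params.IsAdmissible

open Environment

variable {K d : ℕ} {P : Params K d} {env : Environment.{u} K} {alg : Algorithm K}
variable (hP : P.IsAdmissible)
include hP

/-- Gaps at most 1 make `gapSum` at least 1, so ω ≥ σ₀^(3/ε). This floor lets the leading terms
absorb additive constants, and is why the final constant depends on σ₀. -/
theorem iotaFloor_le {σ₀ : ℝ} (hσ₀ : 0 < σ₀) (hσ : σ₀ ≤ P.σ) {Δ : Fin K → ℝ} {astar : Fin K}
    (hpos : ∀ a, a ≠ astar → 0 < Δ a) (hΔ1 : ∀ a, Δ a ≤ 1) (C : ℝ) (T : ℕ) :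
    iotaFloor P.ε σ₀ ≤ P.ι' Δ astar C T := by
  have hα := hP.α_pos
  have hu := hP.one_sub_α_pos
  have hε := hP.ε_pos
  have hω : σ₀ ^ (3 / P.ε) ≤ P.ω Δ astar := by
    have h1 : 1 ≤ (P.α * (1 - P.α)) ^ (-2 : ℝ) :=
      Real.one_le_rpow_of_pos_of_le_one_of_nonpos (by positivity) (by nlinarith) (by norm_num)
    have h2 : σ₀ ^ (3 / P.ε) ≤ P.σ ^ (3 / P.ε) := Real.rpow_le_rpow hσ₀.le hσ (by positivity)
    have h3 : 1 ≤ P.gapSum Δ astar := by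
      have : Nontrivial (Fin K) := Fin.nontrivial_iff_two_le.mpr hP.two_le_K
      obtain ⟨b, hb⟩ := exists_ne astar
      refine le_trans ?_ (Finset.single_le_sum (f := fun a => Δ a ^ (P.α / (P.α - 1)))
        (fun a ha => Real.rpow_nonneg (hpos a (Finset.ne_of_mem_erase ha)).le _)
        (Finset.mem_erase.mpr ⟨hb, Finset.mem_univ b⟩))
      exact Real.one_le_rpow_of_pos_of_le_one_of_nonpos (hpos b hb) (hΔ1 b)
        (div_nonpos_of_nonneg_of_nonpos hα.le (by linarith))
    have h4 : 1 ≤ P.gapSum Δ astar ^ (2 * (1 - P.α)) := Real.one_le_rpow h3 (by linarith)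
    have h5 : (1 : ℝ) ≤ d := by exact_mod_cast hP.one_le_d
    have h6 : 0 < P.σ ^ (3 / P.ε) := Real.rpow_pos_of_pos hP.σ_pos _
    unfold ω
    calc σ₀ ^ (3 / P.ε) ≤ 1 * P.σ ^ (3 / P.ε) * 1 * 1 := by linarith
      _ ≤ _ := by gcongr
  unfold iotaFloor ι'
  have h1 : (σ₀ ^ (3 / P.ε)) ^ (1 / 2 : ℝ) ≤ P.ω Δ astar ^ (1 / 2 : ℝ) :=
    Real.rpow_le_rpow (Real.rpow_nonneg hσ₀.le _) hω (by norm_num)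
  have h2 : 0 ≤ P.ω Δ astar ^ (1 / 2 : ℝ) * (3 / 2 : ℝ) ^ (-1 / 2 : ℝ) :=
    mul_nonneg (Real.rpow_nonneg (hP.ω_pos hpos).le _) (by positivity)
  calc _ ≤ P.ω Δ astar ^ (1 / 2 : ℝ) * (3 / 2 : ℝ) ^ (-1 / 2 : ℝ) := by gcongr
    _ ≤ _ := le_mul_of_one_le_right h2 (le_max_left _ _)

theorem rpow_mul_logPlus_le_ι {Δ : Fin K → ℝ} {astar : Fin K} (hpos : ∀ a, a ≠ astar → 0 < Δ a)
    (C : ℝ) (T : ℕ) : P.ζ Δ astar ^ (1 / (P.ε - 1)) *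
      logPlus (P.zMax T * P.h₁ ^ (P.ε - 1) * T / (P.ζ Δ astar ^ (P.ε / (P.ε - 1)) + C)) ≤
      P.ι Δ astar C T := by
  have hζ := hP.ζ_pos hpos
  have h1 := hP.ε_sub_one_pos
  have hε := hP.ε_pos
  set L := logPlus (P.zMax T * P.h₁ ^ (P.ε - 1) * T / (P.ζ Δ astar ^ (P.ε / (P.ε - 1)) + C))
    with hL
  have hL1 : 1 ≤ L := le_max_left _ _
  rw [ι, ← hL, le_div_iff₀ h1]
  have h2 : 1 ≤ (P.ε / 2) ^ (1 / (1 - P.ε)) :=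
    Real.one_le_rpow_of_pos_of_le_one_of_nonpos (by positivity)
      (by linarith [hP.ε_le_two]) (div_nonpos_of_nonneg_of_nonpos one_pos.le (by linarith))
  have h3 : 0 ≤ P.ζ Δ astar ^ (1 / (P.ε - 1)) * L := by positivity
  calc _ ≤ P.ζ Δ astar ^ (1 / (P.ε - 1)) * L * 1 :=
        mul_le_mul_of_nonneg_left (by linarith [hP.ε_le_two]) h3
    _ ≤ P.ζ Δ astar ^ (1 / (P.ε - 1)) * L * (P.ε / 2) ^ (1 / (1 - P.ε)) :=
        mul_le_mul_of_nonneg_left h2 h3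
    _ = _ := by ring

theorem rpow_mul_logPlus_le_ι' {Δ : Fin K → ℝ} {astar : Fin K} (hpos : ∀ a, a ≠ astar → 0 < Δ a)
    (C : ℝ) (T : ℕ) : P.ω Δ astar ^ (1 / 2 : ℝ) *
      logPlus (P.wMax T * P.h₁ ^ 2 * T / (P.ω Δ astar ^ (3 / 2 : ℝ) + C)) ≤
      3 / 2 * P.ι' Δ astar C T := by
  have hω := hP.ω_pos hpos
  set L := logPlus (P.wMax T * P.h₁ ^ 2 * T / (P.ω Δ astar ^ (3 / 2 : ℝ) + C)) with hL
  have hL1 : 1 ≤ L := le_max_left _ _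
  rw [ι', ← hL]
  have h2 : (2 / 3 : ℝ) ≤ (3 / 2 : ℝ) ^ (-1 / 2 : ℝ) := by
    have := Real.rpow_le_rpow_of_exponent_le (by norm_num : (1 : ℝ) ≤ 3 / 2)
      (by norm_num : (-1 : ℝ) ≤ -1 / 2)
    rw [Real.rpow_neg_one] at this
    linarith
  have h3 : 0 ≤ P.ω Δ astar ^ (1 / 2 : ℝ) * L := by positivity
  have := mul_le_mul_of_nonneg_left h2 h3
  linarith

theorem κ_eq_and_le {T : ℕ} (hT : 1 ≤ T) : P.zMax T * P.β₁ ^ (1 - P.ε) + P.wMax T * P.β₁ ^ (-2 : ℝ) +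
    (P.β₁ * P.h₁ + P.βbar * P.hbar) = P.κ T ∧ 0 ≤ P.β₁ * P.h₁ + P.βbar * P.hbar ∧
    P.β₁ * P.h₁ + P.βbar * P.hbar ≤ P.κ T := by
  have h1 := hP.β₁_pos
  have h2 := hP.zMax_pos hT
  have h3 := hP.wMax_pos hT
  have h4 := mul_nonneg hP.βbar_pos.le hP.hbar_nonneg
  have h5 := mul_pos h1 hP.h₁_pos
  have h6 : 0 < P.zMax T * P.β₁ ^ (1 - P.ε) := by positivity
  have h7 : 0 < P.wMax T * P.β₁ ^ (-2 : ℝ) := by positivity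
  unfold κ
  refine ⟨by ring, by linarith, by linarith⟩

variable (hL : env.IsLinear P.φ) (hH : env.IsHeavyTailed P.ε P.σ) (hR : P.IsRunBy alg)

theorem nonempty_outcome : Nonempty (Outcome K) :=
  ⟨⟨⟨0, by have := hP.two_le_K; omega⟩, 0⟩⟩

include hL hH hR

theorem regret_le_expectedBound {T : ℕ} (hT : 1 ≤ T) :
    env.regret alg T ≤ 518 * (P.expectedBound env alg T + P.βbar * P.hbar) := by
  obtain ⟨o₀⟩ := hP.nonempty_outcome
  have h1 := hP.regret_le_incr hL hH hR o₀ T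
  have h2 := hP.sum_incr_integral_le_expectedBound (env := env) (alg := alg) o₀ hT
  have h3 := mul_nonneg hP.βbar_pos.le hP.hbar_nonneg
  have h5 := mul_pos hP.β₁_pos hP.h₁_pos
  linarith

theorem regret_le_adversarial {T : ℕ} (hT : 1 ≤ T) :
    env.regret alg T ≤ 6216 * (P.h₁ ^ (1 - 1 / P.ε) * (P.zMax T * T) ^ (1 / P.ε) +
      P.h₁ ^ (2 / 3 : ℝ) * (P.wMax T * T) ^ (1 / 3 : ℝ) + P.κ T) := by
  obtain ⟨o₀⟩ := hP.nonempty_outcome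
  have h1 := hP.regret_le_incr hL hH hR o₀ T
  have h2 := integral_mono (hP.integrable_sum_incr (env := env) (alg := alg) o₀ T)
    (integrable_const _) fun x => hP.sum_incr_le (obsSeq o₀ x) hT
  rw [integral_const, probReal_univ, one_smul] at h2
  obtain ⟨e, hκ, hκ'⟩ := hP.κ_eq_and_le hT
  have h3 : 0 ≤ P.zMax T * P.β₁ ^ (1 - P.ε) + P.wMax T * P.β₁ ^ (-2 : ℝ) := by linarith
  linarith

theorem regret_le_of_selfBounding {T : ℕ} (hT : 1 ≤ T) {σ₀ : ℝ} {Δ : Fin K → ℝ} {astar : Fin K}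
    {C : ℝ} (hσ₀ : 0 < σ₀) (hσ : σ₀ ≤ P.σ) (hΔ : ∀ a, 0 ≤ Δ a) (hpos : ∀ a, a ≠ astar → 0 < Δ a)
    (hΔ1 : ∀ a, Δ a ≤ 1) (hC : 0 ≤ C) (hS : env.SelfBounding Δ C T) :
    env.regret alg T ≤ selfBoundingConst P.ε σ₀ * (P.ι Δ astar C T + P.ι' Δ astar C T +
      C ^ (1 / P.ε) * (P.ι Δ astar C T + P.ι' Δ astar C T) ^ (1 - 1 / P.ε) + P.κ T) := by
  obtain ⟨o₀⟩ := hP.nonempty_outcome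
  have hε := hP.ε_pos
  have hε1 := hP.ε_sub_one_pos
  have hζ := hP.ζ_pos hpos
  have hω := hP.ω_pos hpos
  have hreg := hP.regret_le_incr hL hH hR o₀ T
  obtain ⟨hDi, hD⟩ := hP.integral_sum_gap_le (env := env) hR o₀ T Δ hΔ
  have hSB := hS alg
  obtain ⟨-, hκ, hκ'⟩ := hP.κ_eq_and_le hT
  have hm : 0 < iotaFloor P.ε σ₀ := by unfold iotaFloor; positivity
  have hmI := hP.iotaFloor_le hσ₀ hσ hpos hΔ1 C T
  have hι1 := hP.rpow_mul_logPlus_le_ι hpos C T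
  have hι2 := hP.rpow_mul_logPlus_le_ι' hpos C T
  have hlog := fun (Λ Λ' : ℝ) (hΛ : 0 < Λ) (hΛ' : 0 < Λ') (o : ℕ → Obs K) =>
    hP.sum_incr_le_log o hT hΔ hpos hΔ1 hC hΛ hΛ'
  set L := logPlus (P.zMax T * P.h₁ ^ (P.ε - 1) * T / (P.ζ Δ astar ^ (P.ε / (P.ε - 1)) + C))
  set L' := logPlus (P.wMax T * P.h₁ ^ 2 * T / (P.ω Δ astar ^ (3 / 2 : ℝ) + C))
  have hL1 : 1 ≤ L := le_max_left _ _
  have hL1' : 1 ≤ L' := le_max_left _ _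
  set ζ := P.ζ Δ astar
  set ω := P.ω Δ astar
  set i₁ := P.ι Δ astar C T
  set i₂ := P.ι' Δ astar C T
  set m := iotaFloor P.ε σ₀ with hmdef
  have hζr : 0 < ζ ^ (1 / (P.ε - 1)) := by positivity
  have hωr : 0 < ω ^ (1 / 2 : ℝ) := by positivity
  have hi₁ : ζ ^ (1 / (P.ε - 1)) ≤ i₁ := (le_mul_of_one_le_right hζr.le hL1).trans hι1
  have hi₂ : ω ^ (1 / 2 : ℝ) ≤ 3 / 2 * i₂ := (le_mul_of_one_le_right hωr.le hL1').trans hι2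
  have hI : 0 < i₁ + i₂ := by linarith
  obtain ⟨τ, hτ, hτ1, hτC, hτI⟩ := exists_tradeoff hP.one_lt_ε hI hC
  set G := C ^ (1 / P.ε) * (i₁ + i₂) ^ (1 - 1 / P.ε) with hG
  have hG0 : 0 ≤ G := by positivity
  -- the free parameters of the logarithmic growth bound
  set Λ := (ζ * 2072 / τ) ^ (1 / (P.ε - 1)) with hΛdef
  set Λ' := (ω * 4144 / τ) ^ (1 / 2 : ℝ) with hΛdef'
  have hΛ : 0 < Λ := by positivity
  have hΛ' : 0 < Λ' := by positivity
  -- As 2072 = 4 · 518, the two components together contribute (τ/2) D to the regret.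
  have eΛ : Λ ^ (1 - P.ε) * ζ = τ / 2072 := by
    rw [hΛdef, ← Real.rpow_mul (by positivity),
      show 1 / (P.ε - 1) * (1 - P.ε) = -1 by field_simp; ring, Real.rpow_neg_one]
    field_simp
  have eΛ' : Λ' ^ (-2 : ℝ) * (2 * ω) = τ / 2072 := by
    rw [hΛdef', ← Real.rpow_mul (by positivity),
      show (1 / 2 : ℝ) * (-2) = -1 by norm_num, Real.rpow_neg_one]
    field_simp; norm_num
  have eΛL : Λ * L ≤ (2072 : ℝ) ^ (1 / (P.ε - 1)) * (i₁ + i₂ + G) := by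
    have e : Λ = ζ ^ (1 / (P.ε - 1)) * 2072 ^ (1 / (P.ε - 1)) * τ ^ (-(1 / (P.ε - 1))) := by
      rw [hΛdef, Real.div_rpow (by positivity) hτ.le, Real.mul_rpow hζ.le (by norm_num),
        Real.rpow_neg hτ.le, div_eq_mul_inv]
    calc Λ * L = 2072 ^ (1 / (P.ε - 1)) * (τ ^ (-(1 / (P.ε - 1))) *
          (ζ ^ (1 / (P.ε - 1)) * L)) := by rw [e]; ring
      _ ≤ 2072 ^ (1 / (P.ε - 1)) * (τ ^ (-(1 / (P.ε - 1))) * (i₁ + i₂)) := by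
          gcongr
          linarith
      _ ≤ _ := by gcongr
  have eΛL' : Λ' * L' ≤ 6216 * (i₁ + i₂ + G) := by
    have e : Λ' = ω ^ (1 / 2 : ℝ) * 4144 ^ (1 / 2 : ℝ) * τ ^ (-(1 / 2) : ℝ) := by
      rw [hΛdef', Real.div_rpow (by positivity) hτ.le, Real.mul_rpow hω.le (by norm_num),
        Real.rpow_neg hτ.le, div_eq_mul_inv]
    have h1 : (4144 : ℝ) ^ (1 / 2 : ℝ) ≤ 4144 :=
      (Real.rpow_le_rpow_of_exponent_le (by norm_num) (by norm_num)).trans_eq (Real.rpow_one _)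
    -- The w-component needs a smaller power of 1/τ, so the τ tuned for z serves both.
    have h2 : τ ^ (-(1 / 2) : ℝ) ≤ τ ^ (-(1 / (P.ε - 1))) := by
      refine Real.rpow_le_rpow_of_exponent_ge hτ hτ1 (neg_le_neg ?_)
      rw [div_le_div_iff₀ two_pos hε1]
      linarith [hP.ε_le_two]
    calc Λ' * L' = 4144 ^ (1 / 2 : ℝ) * (τ ^ (-(1 / 2) : ℝ) * (ω ^ (1 / 2 : ℝ) * L')) := by
          rw [e]; ring
      _ ≤ 4144 * (τ ^ (-(1 / (P.ε - 1))) * (3 / 2 * (i₁ + i₂))) := by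
          have h3 : ω ^ (1 / 2 : ℝ) * L' ≤ 3 / 2 * (i₁ + i₂) := by linarith
          exact mul_le_mul h1 (mul_le_mul h2 h3 (by positivity) (by positivity)) (by positivity)
            (by norm_num)
      _ = 6216 * (τ ^ (-(1 / (P.ε - 1))) * (i₁ + i₂)) := by ring
      _ ≤ _ := by gcongr
  -- the residual terms
  have hCG : C ^ (1 / P.ε) ≤ m ^ (-(1 - 1 / P.ε)) * G := by
    have h0 : 0 ≤ 1 - 1 / P.ε := by
      rw [sub_nonneg, div_le_one hε]; exact hP.one_lt_ε.le
    have h1 : m ^ (1 - 1 / P.ε) ≤ (i₁ + i₂) ^ (1 - 1 / P.ε) :=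
      Real.rpow_le_rpow hm.le (by linarith) h0
    have h2 : 0 < m ^ (1 - 1 / P.ε) := Real.rpow_pos_of_pos hm _
    rw [Real.rpow_neg hm.le, inv_mul_eq_div, le_div_iff₀ h2, hG]
    exact mul_le_mul_of_nonneg_left h1 (by positivity)
  have hU : (ζ ^ (P.ε / (P.ε - 1)) + C) ^ (1 / P.ε) ≤ i₁ + C ^ (1 / P.ε) := by
    refine (Real.rpow_add_le_add_rpow (by positivity) hC (by positivity)
      (by rw [div_le_one hε]; exact hP.one_lt_ε.le)).trans (add_le_add_left ?_ _)
    rw [← Real.rpow_mul hζ.le, show P.ε / (P.ε - 1) * (1 / P.ε) = 1 / (P.ε - 1) by field_simp]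
    exact hi₁
  have hU' : (ω ^ (3 / 2 : ℝ) + C) ^ (1 / 3 : ℝ) ≤ 3 / 2 * i₂ + (1 + C ^ (1 / P.ε)) := by
    refine (Real.rpow_add_le_add_rpow (by positivity) hC (by norm_num) (by norm_num)).trans
      (add_le_add ?_ ?_)
    · rw [← Real.rpow_mul hω.le, show (3 / 2 : ℝ) * (1 / 3) = 1 / 2 by norm_num]
      exact hi₂
    -- The exponent 1/3 of C does not match 1/ε; for small C the mismatch costs the constant 1,
    -- absorbed below through the floor m.
    · rcases le_total C 1 with h | h
      · have := Real.rpow_le_one hC h (by norm_num : (0 : ℝ) ≤ 1 / 3)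
        have := Real.rpow_nonneg hC (1 / P.ε)
        linarith
      · have : C ^ (1 / 3 : ℝ) ≤ C ^ (1 / P.ε) := by
          refine Real.rpow_le_rpow_of_exponent_le h ?_
          exact one_div_le_one_div_of_le hε (by linarith [hP.ε_le_two])
        linarith
  have hone : 1 ≤ 1 / m * (i₁ + i₂) := by
    rw [one_div, inv_mul_eq_div, le_div_iff₀ hm]; linarith
  -- integration of the logarithmic growth bound
  set E := ∫ x, ∑ t ∈ Finset.range T, P.incr (P.traj (obsSeq o₀ x) t) ∂(env.law alg T)
  set D := ∫ x, ∑ t ∈ Finset.range T, ∑ a, Δ a * P.p (P.traj (obsSeq o₀ x) t) a ∂(env.law alg T)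
  have hE := integral_mono (hP.integrable_sum_incr (env := env) (alg := alg) o₀ T)
    ((hDi.const_mul _).add (integrable_const _)) fun x => hlog Λ Λ' hΛ hΛ' (obsSeq o₀ x)
  simp only [Pi.add_apply] at hE
  rw [integral_add (hDi.const_mul _) (integrable_const _), integral_const_mul, integral_const,
    probReal_univ, one_smul, eΛ, eΛ'] at hE
  set c := scheduleConst P.ε + scheduleConst 3 with hc
  have hc0 : 0 < c := by
    have := scheduleConst_ge hP.one_lt_ε
    have := scheduleConst_ge (r := 3) (by norm_num)
    linarith
  set A := (2072 : ℝ) ^ (1 / (P.ε - 1)) with hA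
  have hA0 : 0 < A := by positivity
  set S := i₁ + i₂ + G + P.κ T with hSdef
  have hS0 : 0 ≤ S := by linarith
  set m' := m ^ (-(1 - 1 / P.ε)) with hm'
  have hm'0 : 0 < m' := Real.rpow_pos_of_pos hm _
  set W := 4 + 1 / m + 2 * m' + (A + 6216) with hW
  have hsum : 2 * P.κ T + (ζ ^ (P.ε / (P.ε - 1)) + C) ^ (1 / P.ε) +
      (ω ^ (3 / 2 : ℝ) + C) ^ (1 / 3 : ℝ) + Λ * L + Λ' * L' ≤ W * S := by
    have hm1 : 0 < 1 / m := by positivity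
    have a1 : 1 / m * (i₁ + i₂) ≤ 1 / m * S := mul_le_mul_of_nonneg_left (by linarith) hm1.le
    have a2 : m' * G ≤ m' * S := mul_le_mul_of_nonneg_left (by linarith) hm'0.le
    have a3 : A * (i₁ + i₂ + G) ≤ A * S := mul_le_mul_of_nonneg_left (by linarith) hA0.le
    have hi₁0 : 0 < i₁ := hζr.trans_le hi₁
    have hi₂0 : 0 < i₂ := hm.trans_le hmI
    rw [hW]
    linarith
  have hE' : E ≤ (τ / 2072 + τ / 2072) * D + c * (W * S) :=
    hE.trans (add_le_add_right (mul_le_mul_of_nonneg_left hsum hc0.le) _)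
  have hDR : D ≤ env.regret alg T + C := by linarith
  have hτD := mul_le_mul_of_nonneg_left hDR (by positivity : 0 ≤ τ / 2072 + τ / 2072)
  have hW0 : 0 < W := by positivity
  have hcWS : 0 ≤ c * (W * S) := by positivity
  -- For positive regret, (τ/2) Reg is absorbed because τ ≤ 1. Doubling leaves 2κ, the term τ C ≤ S,
  -- and 2 · 518 c W S.
  have hfin : env.regret alg T ≤ (3 + 1036 * c * W) * S := by
    rcases le_or_gt (env.regret alg T) 0 with h | h
    · exact h.trans (by positivity)
    · have h1 : τ * env.regret alg T ≤ env.regret alg T := mul_le_of_le_one_left h.le hτ1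
      linarith
  exact hfin.trans (mul_le_mul_of_nonneg_right (le_max_right _ _) hS0)

end Params.IsAdmissible

end HTLinearBandit

theorem theorem3 :
    ∃ c₀ : ℝ, 0 < c₀ ∧ ∃ c₁ : ℝ → ℝ → ℝ, (∀ ε σ₀, 0 < c₁ ε σ₀) ∧
      ∀ (K d : ℕ) (P : Params K d), P.IsAdmissible →
        -- the algorithm is well defined
        (∃ alg : Algorithm K, P.IsRunBy alg) ∧
        -- positivity of `z_t`, `w_t`, and the stability of `h_t`
        (∀ (t : ℕ) (o : Fin t → Obs K), 0 < P.z (P.state t o) ∧ 0 < P.w (P.state t o)) ∧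
        (∀ (t : ℕ) (o : Fin (t + 1) → Obs K),
          P.h (P.state (t + 1) o) ≤ c₀ * P.h (P.state t (Fin.init o))) ∧
        -- bounds on the entropies of the first iterate
        P.h₁ ≤ 1 / P.α * (K : ℝ) ^ (1 - P.α) ∧
        P.hbar ≤ 1 / P.αbar * (K : ℝ) ^ (1 - P.αbar) ∧
        -- the round-wise self-bounding conditions
        (∀ (Δ : Fin K → ℝ) (astar : Fin K), (∀ a, 0 ≤ Δ a) → (∀ a, a ≠ astar → 0 < Δ a) →
          0 < P.ζ Δ astar ∧ 0 < P.ω Δ astar ∧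
          ∀ (t : ℕ) (o : Fin t → Obs K),
            P.h (P.state t o) ^ (P.ε - 1) * P.z (P.state t o) ≤
              P.ζ Δ astar * ∑ a, Δ a * P.p (P.state t o) a ∧
            ((∀ a, Δ a ≤ 1) →
              P.h (P.state t o) ^ 2 * P.w (P.state t o) ≤
                2 * P.ω Δ astar * ∑ a, Δ a * P.p (P.state t o) a)) ∧
        ∀ T : ℕ, 1 ≤ T →
          -- `z_max` and `w_max` are upper bounds, with explicit control
          (∀ (t : ℕ) (o : Fin t → Obs K), t < T →
            P.z (P.state t o) ≤ P.zMax T ∧ P.w (P.state t o) ≤ P.wMax T) ∧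
          P.h₁ ^ (1 - 1 / P.ε) * P.zMax T ^ (1 / P.ε) ≤
            (P.α * (1 - P.α)) ^ (1 / P.ε - 1) * P.σ ^ (1 / P.ε) * (d : ℝ) ^ (1 / 2 : ℝ) *
              (K : ℝ) ^ ((1 - P.α) * (1 - 1 / P.ε)) ∧
          P.h₁ ^ (2 / 3 : ℝ) * P.wMax T ^ (1 / 3 : ℝ) ≤
            (P.α * (1 - P.α)) ^ (-2 / 3 : ℝ) * P.σ ^ (1 / P.ε) * (d : ℝ) ^ (1 / 3 : ℝ) *
              (K : ℝ) ^ (2 * (1 - P.α) / 3) ∧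
          ∀ (env : Environment.{u} K) (alg : Algorithm K),
            env.IsLinear P.φ → env.IsHeavyTailed P.ε P.σ → P.IsRunBy alg →
            -- the regret decomposition
            env.regret alg T ≤ c₀ * (P.expectedBound env alg T + P.βbar * P.hbar) ∧
            -- the adversarial regime
            env.regret alg T ≤ c₀ *
              (P.h₁ ^ (1 - 1 / P.ε) * (P.zMax T * T) ^ (1 / P.ε) +
                P.h₁ ^ (2 / 3 : ℝ) * (P.wMax T * T) ^ (1 / 3 : ℝ) + P.κ T) ∧
            -- the adversarial regime with a self-bounding constraint
            ∀ (σ₀ : ℝ) (Δ : Fin K → ℝ) (astar : Fin K) (C : ℝ), 0 < σ₀ → σ₀ ≤ P.σ →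
              (∀ a, 0 ≤ Δ a) → (∀ a, a ≠ astar → 0 < Δ a) → (∀ a, Δ a ≤ 1) → 0 ≤ C →
              env.SelfBounding Δ C T →
              env.regret alg T ≤ c₁ P.ε σ₀ *
                (P.ι Δ astar C T + P.ι' Δ astar C T +
                  C ^ (1 / P.ε) * (P.ι Δ astar C T + P.ι' Δ astar C T) ^ (1 - 1 / P.ε) +
                  P.κ T) := by
  -- The absolute constant is 518 · 12, from the adversarial bound; it also covers the factors 6 and
  -- 518.
  refine ⟨6216, by norm_num, selfBoundingConst, fun ε σ₀ => lt_max_of_lt_left one_pos,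
    fun K d P hP => ⟨hP.exists_isRunBy, fun t o => ?_, fun t o => ?_, hP.h₁_le, hP.hbar_le,
      fun Δ astar hΔ hpos => ⟨hP.ζ_pos hpos, hP.ω_pos hpos, fun t o => ?_⟩, fun T hT => ⟨?_,
        hP.h₁_mul_zMax_le hT, hP.h₁_mul_wMax_le hT, fun env alg hL hH hR => ⟨?_,
          hP.regret_le_adversarial hL hH hR hT, ?_⟩⟩⟩⟩
  · exact ⟨hP.z_pos (hP.β₁_le_state t o), hP.w_pos (hP.β₁_le_state t o)⟩
  · have hβ := hP.β₁_le_state t (Fin.init o)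
    refine (hP.h_next_le hβ (o (Fin.last t))).trans ?_
    linarith [hP.h_pos hβ]
  · have hβ := hP.β₁_le_state t o
    exact ⟨hP.h_rpow_mul_z_le hΔ hpos hβ, fun hΔ1 => hP.h_sq_mul_w_le hΔ hpos hβ hΔ1⟩
  · exact fun t o ht => ⟨hP.z_le_zMax o ht, hP.w_le_wMax o ht⟩
  · refine (hP.regret_le_expectedBound hL hH hR hT).trans ?_
    obtain ⟨o₀⟩ := hP.nonempty_outcome
    have h1 := hP.sum_incr_integral_le_expectedBound (env := env) (alg := alg) o₀ hT
    have h2 : 0 ≤ ∫ x, ∑ t ∈ Finset.range T,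
        P.incr (P.traj (Environment.obsSeq o₀ x) t) ∂(env.law alg T) :=
      integral_nonneg fun x => Finset.sum_nonneg fun t _ => hP.incr_nonneg (hP.β₁_le_traj _ _)
    have h3 := mul_nonneg hP.βbar_pos.le hP.hbar_nonneg
    have h4 := mul_pos hP.β₁_pos hP.h₁_pos
    linarith
  · exact fun σ₀ Δ astar C hσ₀ hσ hΔ hpos hΔ1 hC hS =>
      hP.regret_le_of_selfBounding hL hH hR hT hσ₀ hσ hΔ hpos hΔ1 hC hS
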